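/- Let $n\ge 2$, $\tau\in\mathbb C$ with $\operatorname{Im}\tau>0$, and let $\theta(u)=\sum_{\mu\in\frac12+\mathbb Z}\exp 2\pi i\left(\mu(u+\tfrac12)+\tfrac{\mu^2}{2}\tau\right)$ be the Jacobi theta function, $\theta^{(k)}$ its $k$-th derivative. Let the variable $\lambda$ range either over $\mathbb C^n$, with $e_i=\epsilon_i$ the standard basis vectors, or over the weight space $\{\lambda\in\mathbb C^n:\sum_i\lambda_i=0\}$ of $sl_n$, with $e_i=\epsilon_i-\frac1n\sum_k\epsilon_k$. Let $(T_i^\hbar f)(\lambda)=f(\lambda+\hbar e_i)$, let $\partial_i$ be the derivative in the direction $e_i$, $\partial^J=\prod_{j\in J}\partial_j$, and $\Delta(\lambda)=\prod_{i<j}\theta(\lambda_i-\lambda_j)$. For $c,\hbar\in\mathbb C$ and $u\in\mathbb C\setminus(\mathbb Z+\mathbb Z\tau)$ let $\tilde L_\hbar(c|u)$ be the $n\times n$ matrix of difference operators $$\tilde L_\hbar(c|u)^i_j=\frac{\theta(\frac{c\hbar}{n}+u+\lambda_j-\lambda_i)}{\theta(u)}\prod_{k\ne j}\frac{\theta(\frac{c\hbar}{n}+\lambda_k-\lambda_i)}{\theta(\lambda_k-\lambda_j)}\;T_i^\hbar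 ,$$ and let $:\det[\,\cdot\,]:$ be the normally ordered determinant (all shifts and derivatives are put to the right of all functions of $\lambda$). All operators act on functions that are holomorphic on an open set, and identities hold at the points of that set with $\lambda_i-\lambda_j\notin\mathbb Z+\mathbb Z\tau$ for $i\ne j$. Then: 1. $\tilde L_\hbar(c|u)$ is differentiable in $\hbar$ at $\hbar=0$. Its derivative $\tilde L'_0(c|u)$ is the matrix of differential operators whose entry $(i,j)$ is the derivative at $\hbar=0$ of the coefficient of $T_i^\hbar$ above, plus $\delta_{ij}\partial_i$. For every $t\in\mathbb C$, $$\lim_{\hbar\to0}:\det\left[\frac{\tilde L_\hbar(c|u)-(1+\hbar t)}{\hbar}\right]:\;=\;:\det[\tilde L'_0(c|u)-t]:\;=\;\sum_{d=0}^n(-t)^{n-d}D_d(c|u),$$ where the differential operators $D_d(c|u)$ are defined by the last equality. 2. $[D_d(c|u),D_{d'}(c|v)]=0$ for all $0\le d,d'\le n$ and all $u,v\notin\mathbb Z+\mathbb Z\tau$. 3. If $c\ne0$, then for $0\le d\le n$, with $(-\frac nc\partial)^J=\prod_{j\in J}(-\frac nc\partial_j)$ and $I,I'\subset\{1,\dots,n\}$,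 $$D_d(c|u)=\left(-\frac cn\right)^{d}\sum_{|I|=d}\;\sum_{J'\sqcup J''\subset I}(-1)^{|J'|}\frac{\theta^{(|J'|)}(u)}{\theta(u)}\,\frac{\partial^{J''}\Delta}{\Delta}(\lambda)\left(-\frac nc\partial\right)^{I\setminus(J'\sqcup J'')}$$ $$=\left(-\frac cn\right)^{d}\sum_{k=0}^{d}(-1)^k\binom{n-d+k}{k}\frac{\theta^{(k)}(u)}{\theta(u)}\sum_{|I'|=d-k}\;\sum_{J''\subset I'}\frac{\partial^{J''}\Delta}{\Delta}(\lambda)\left(-\frac nc\partial\right)^{I'\setminus J''}.$$ -/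

import Mathlib

noncomputable section

namespace EllipticCM

/-- The theta series `θ_{m,l}(u, τ) = ∑_{μ ∈ m + lℤ} exp 2πi (μ u + μ² τ / (2l))`. -/
def thetaSeries (m l u τ : ℂ) : ℂ :=
  ∑' k : ℤ, Complex.exp
    (2 * Real.pi * Complex.I * ((m + l * k) * u + (m + l * k) ^ 2 / (2 * l) * τ))

/-- The Jacobi theta function `θ(u) = θ_{1/2,1}(u + 1/2, τ)`; it is odd, and its zeros are
the points of `ℤ + ℤτ`. -/
def theta (τ u : ℂ) : ℂ := thetaSeries (1 / 2) 1 (u + 1 / 2) τ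

/-- The lattice `ℤ + ℤτ`. -/
def lattice (τ : ℂ) : Set ℂ := {z | ∃ a b : ℤ, z = a + b * τ}

/-- The two spaces on which the operators act: functions of `λ ∈ ℂⁿ`, or functions on the
weight space of `sl_n`, realized as the orthogonal complement of `ε₁ + ⋯ + εₙ` in `ℂⁿ`. -/
inductive Realization
  | full
  | weight

/-- The space of the variable `λ`, as a subspace of `ℂⁿ`. -/
def Realization.space (n : ℕ) : Realization → Submodule ℂ (Fin n → ℂ)
  | full => ⊤
  | weight =>
    { carrier := {x | ∑ i, x i = 0}
      zero_mem' := by simp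
      add_mem' := by
        intro a b ha hb
        simp only [Set.mem_ofPred_eq] at ha hb ⊢
        simp [Finset.sum_add_distrib, ha, hb]
      smul_mem' := by
        intro r a ha
        simp only [Set.mem_ofPred_eq] at ha ⊢
        simp [← Finset.mul_sum, ha] }

/-- The direction of the `i`-th shift and of the `i`-th partial derivative: the basis vector
`ε_i` for `ℂⁿ`, and its orthogonal projection `ε_i - (ε₁ + ⋯ + εₙ)/n` for the weight space. -/
def Realization.dir (n : ℕ) : (r : Realization) → Fin n → r.space n
  | full => fun i => ⟨Pi.single i 1, Submodule.mem_top⟩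
  | weight => fun i => ⟨fun k => (Pi.single i 1 : Fin n → ℂ) k - 1 / n, by
      have hn : (n : ℂ) ≠ 0 := by
        have := i.pos
        exact_mod_cast this.ne'
      change ∑ k, ((Pi.single i 1 : Fin n → ℂ) k - 1 / n) = 0
      simp [Finset.sum_sub_distrib, hn]⟩

section Operators

variable {n : ℕ} {S : Submodule ℂ (Fin n → ℂ)}

/-- The shift operator `(T_i^ħ f)(λ) = f(λ + ħ e_i)`. -/
def shift (e : Fin n → S) (h : ℂ) (i : Fin n) (f : S → ℂ) : S → ℂ :=
  fun x => f (x + h • e i)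

/-- The derivative `∂_i f` in the direction `e_i`. -/
def pd (e : Fin n → S) (i : Fin n) (f : S → ℂ) : S → ℂ :=
  fun x => lineDeriv ℂ f x (e i)

/-- The operator monomial `A_1^{m_1} A_2^{m_2} ⋯ A_n^{m_n}`. -/
def opMonomial (A : Fin n → (S → ℂ) → (S → ℂ)) (m : Fin n → ℕ) (f : S → ℂ) : S → ℂ :=
  (List.finRange n).foldr (fun i g => (A i)^[m i] g) f

/-- The operator `A^J = ∏_{j ∈ J} A_j`. -/
def opProd (A : Fin n → (S → ℂ) → (S → ℂ)) (J : Finset (Fin n)) (f : S → ℂ) : S → ℂ :=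
  opMonomial A (fun i => if i ∈ J then 1 else 0) f

/-- Normally ordered expressions: commutative polynomials in the letters `X_1, …, X_n`, which
stand for the shifts or for the derivatives, with functions of `λ` as coefficients. -/
abbrev OpSymbol (S : Submodule ℂ (Fin n → ℂ)) : Type := MvPolynomial (Fin n) (S → ℂ)

/-- The operator `∑_m a_m(λ) A^m` of the expression `∑_m a_m(λ) X^m`: the operators `A_i` are
put to the right of all functions of `λ`. -/
def normalOp (A : Fin n → (S → ℂ) → (S → ℂ)) (p : OpSymbol S) (f : S → ℂ) : S → ℂ :=
  fun x => ∑ m ∈ p.support, MvPolynomial.coeff m p x * opMonomial A m f x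

/-- The normally ordered determinant `:det N:`. -/
def normalDet (A : Fin n → (S → ℂ) → (S → ℂ)) (N : Matrix (Fin n) (Fin n) (OpSymbol S))
    (f : S → ℂ) : S → ℂ :=
  normalOp A N.det f

/-- The coefficient of `T_i^ħ` in the entry `(i, j)` of the matrix `L̃_ħ(c|u)`. -/
def laxCoeff (τ c u h : ℂ) (i j : Fin n) : S → ℂ := fun x =>
  theta τ (c * h / n + u + (x.1 j - x.1 i)) / theta τ u *
    ∏ k ∈ Finset.univ.erase j,
      theta τ (c * h / n + (x.1 k - x.1 i)) / theta τ (x.1 k - x.1 j)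

/-- The matrix `L̃_ħ(c|u)` of difference operators; the letter `X_i` stands for `T_i^ħ`. -/
def lax (S : Submodule ℂ (Fin n → ℂ)) (τ c u h : ℂ) :
    Matrix (Fin n) (Fin n) (OpSymbol S) :=
  Matrix.of fun i j => MvPolynomial.C (laxCoeff τ c u h i j) * MvPolynomial.X i

/-- The matrix `L̃'_0(c|u)`, the `ħ`-derivative of `L̃_ħ(c|u)` at `ħ = 0`, whose entries are
differential operators; the letter `X_i` stands for `∂_i`. -/
def laxDeriv (S : Submodule ℂ (Fin n → ℂ)) (τ c u : ℂ) :
    Matrix (Fin n) (Fin n) (OpSymbol S) :=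
  Matrix.of fun i j =>
    MvPolynomial.C (fun x => deriv (fun h => laxCoeff τ c u h i j x) 0) +
      if i = j then MvPolynomial.X i else 0

/-- The differential operator `D_d(c|u)`, for `0 ≤ d ≤ n`: the coefficient of `(-t)^{n-d}` in
`:det[L̃'_0(c|u) - t]:`, as a polynomial in `t`. -/
def diffOp (e : Fin n → S) (τ c u : ℂ) (d : ℕ) (f : S → ℂ) : S → ℂ :=
  normalOp (pd e)
    ((-1) ^ (n - d) *
      ((laxDeriv S τ c u).map Polynomial.C -
        (Polynomial.X : Polynomial (OpSymbol S)) • 1).det.coeff (n - d)) f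

/-- The function `Δ(λ) = ∏_{i<j} θ(λ_i - λ_j)`. -/
def Delta (S : Submodule ℂ (Fin n → ℂ)) (τ : ℂ) : S → ℂ := fun x =>
  ∏ i, ∏ j ∈ Finset.Ioi i, theta τ (x.1 i - x.1 j)

end Operators

end EllipticCM

end

noncomputable section

namespace EllipticCM

open Complex Filter Topology

/-! ### The theta function -/

/-! The differential operators are obtained as limits of difference operators, for which both the
determinant and the commutators can be computed exactly.

Evaluation. The entry `(i, j)` of the Lax matrix is the value at `λ_i - cħ/n` of the `j`-th Lagrange
interpolation theta function with nodes `λ_k`. Expanding the normally ordered determinant by rows,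
the coefficient of `∏_{i ∈ J} T_i` is a determinant in which the points with index in `J` are
displaced and the others stay at the nodes. A Frobenius-type formula (`det_lagrange`, `rowMix_lax`)
gives it as `θ(u + |J|cħ/n)/θ(u)` times a ratio of values of `Δ`. So each term is a joint shift of
`θ(y) Δ(y') f(y'')`, taken at `y = u`, `y' = y'' = λ`, in the directions `c/n`, `-(c/n) e_i`, `e_i`.
After subtracting `1 + ħt` and dividing by `ħ`, the shifts combine into divided differences, which
tend to derivatives. Comparison with the direct limit `tendsto_normalDet_lax` gives `D_d` as a sum
of `d`-fold derivatives of the triple product (`diffOp_eq_tripleFun`), and the Leibniz rule yields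
the explicit formulas.

Commutativity. In the explicit formula the spectral parameter occurs only in scalar factors:
`D_d(c|u)` is a combination of operators `cmOp` that do not depend on `u` (`diffOp_eq_sum_cmOp`). It
suffices that these commute. Replacing derivatives by divided differences turns `cmOp` into a
weighted sum of difference operators of Macdonald–Ruijsenaars type (`cmFamily_eq_shiftSum`). Two
such sums commute (`shiftSum_comm`): fixing the intersection and the symmetric difference `K` of the
two index sets, what remains is a sum over subsets of `K` that must be unchanged when the kernel `G`
is reflected to `G(-·)`. This is `IsSplitKernel.splitSum_eq`. By induction on the set, the
difference of the two sides has no poles in any coordinate, hence is constant by Liouville's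
theorem; it is also odd in `λ`, hence zero.

Analysis. The passage `ħ → 0` must survive composition of operators, so limits for fixed functions
are not enough. A divided difference of a jointly holomorphic family is again jointly holomorphic
through `ħ = 0`, by a contour integral (`HolAt.divDiff`); composed families are therefore continuous
at `ħ = 0`.

The theta function enters through the three-term identity, its quasi-periods, `θ'(0) ≠ 0`, and the
fact that its zeros lie in the lattice. -/

theorem theta_eq_jacobiTheta₂ (τ u : ℂ) :
    theta τ u = cexp (Real.pi * I * (u + 1 / 2) + Real.pi * I * τ / 4) *
      jacobiTheta₂ (u + 1 / 2 + τ / 2) τ := by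
  rw [theta, thetaSeries, jacobiTheta₂, ← tsum_mul_left]
  refine tsum_congr fun k => ?_
  rw [jacobiTheta₂_term, ← Complex.exp_add]
  congr 1
  ring

theorem differentiable_theta {τ : ℂ} (hτ : 0 < τ.im) : Differentiable ℂ (theta τ) := by
  have h : theta τ = fun u => cexp (Real.pi * I * (u + 1 / 2) + Real.pi * I * τ / 4) *
      jacobiTheta₂ (u + 1 / 2 + τ / 2) τ := funext (theta_eq_jacobiTheta₂ τ)
  rw [h]
  intro u
  have h1 := (differentiableAt_jacobiTheta₂_fst (u + 1 / 2 + τ / 2) hτ).comp u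
    (by fun_prop : DifferentiableAt ℂ (fun u : ℂ => u + 1 / 2 + τ / 2) u)
  exact DifferentiableAt.mul (by fun_prop) h1

theorem theta_add_one (τ u : ℂ) : theta τ (u + 1) = -theta τ u := by
  rw [theta_eq_jacobiTheta₂, theta_eq_jacobiTheta₂,
    show u + 1 + 1 / 2 + τ / 2 = u + 1 / 2 + τ / 2 + 1 by ring, jacobiTheta₂_add_left,
    show (Real.pi * I * (u + 1 + 1 / 2) + Real.pi * I * τ / 4 : ℂ) =
      (Real.pi * I * (u + 1 / 2) + Real.pi * I * τ / 4) + Real.pi * I by ring,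
    Complex.exp_add _ (Real.pi * I), Complex.exp_pi_mul_I]
  ring

theorem theta_add_tau (τ u : ℂ) :
    theta τ (u + τ) = -cexp (-(Real.pi * I * (τ + 2 * u))) * theta τ u := by
  rw [theta_eq_jacobiTheta₂, theta_eq_jacobiTheta₂,
    show u + τ + 1 / 2 + τ / 2 = u + 1 / 2 + τ / 2 + τ by ring, jacobiTheta₂_add_left',
    ← mul_assoc, ← mul_assoc, ← Complex.exp_add]
  congr 1
  rw [← neg_one_mul (cexp _), ← Complex.exp_pi_mul_I, ← Complex.exp_add, ← Complex.exp_add]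
  rw [Complex.exp_eq_exp_iff_exists_int]
  exact ⟨-1, by push_cast; ring⟩

theorem theta_neg (τ u : ℂ) : theta τ (-u) = -theta τ u := by
  rw [theta_eq_jacobiTheta₂, theta_eq_jacobiTheta₂,
    show u + 1 / 2 + τ / 2 = -(-u + 1 / 2 + τ / 2) + τ + 1 by ring, jacobiTheta₂_add_left,
    jacobiTheta₂_add_left', jacobiTheta₂_neg_left, ← mul_assoc, ← Complex.exp_add, ← neg_mul,
    ← neg_one_mul (cexp _), ← Complex.exp_pi_mul_I, ← Complex.exp_add]
  congr 1
  rw [Complex.exp_eq_exp_iff_exists_int]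
  exact ⟨-1, by push_cast; ring⟩

theorem theta_zero (τ : ℂ) : theta τ 0 = 0 := by
  have h := theta_neg τ 0
  rw [neg_zero] at h
  exact self_eq_neg.mp h

/-! ### The addition formula and the three-term identity. -/

/-- The even part of the two-dimensional space of theta functions of degree two. -/
def thetaEven (τ x : ℂ) : ℂ := jacobiTheta₂ (2 * x) (2 * τ)

/-- The odd part of the two-dimensional space of theta functions of degree two. -/
def thetaOdd (τ x : ℂ) : ℂ :=
  cexp (2 * Real.pi * I * x + Real.pi * I * τ / 2) * jacobiTheta₂ (2 * x + τ) (2 * τ)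

/-- The pairs of integers, split by the parity of their difference. -/
def intPairEquiv : (ℤ × ℤ) ⊕ (ℤ × ℤ) ≃ ℤ × ℤ :=
  Equiv.ofBijective
    (Sum.elim (fun p => (p.1 + p.2, p.1 - p.2 - 1)) (fun p => (p.1 + p.2, p.1 - p.2))) <| by
    constructor
    · rintro (⟨a, b⟩ | ⟨a, b⟩) (⟨c, d⟩ | ⟨c, d⟩) h <;>
        simp only [Sum.elim_inl, Sum.elim_inr, Prod.mk.injEq] at h <;>
        first
        | (exfalso; omega)
        | (have h1 : a = c := by omega
           have h2 : b = d := by omega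
           rw [h1, h2])
    · rintro ⟨k, l⟩
      rcases Int.even_or_odd' (k - l) with ⟨q, hq | hq⟩
      · exact ⟨Sum.inr (l + q, q), by simp only [Sum.elim_inr, Prod.mk.injEq]; omega⟩
      · exact ⟨Sum.inl (l + q + 1, q), by simp only [Sum.elim_inl, Prod.mk.injEq]; omega⟩

theorem intPairEquiv_inl (p q : ℤ) : intPairEquiv (Sum.inl (p, q)) = (p + q, p - q - 1) := rfl

theorem intPairEquiv_inr (p q : ℤ) : intPairEquiv (Sum.inr (p, q)) = (p + q, p - q) := rfl

/-- In the double series over half-integers `μ`, `ν` the exponent depends on `μ + ν` and `μ - ν`,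
which have opposite parity. Splitting by parity separates the variables into series in `2τ`. The
shift by `1/2` in the definition of theta contributes the sign `exp πi(μ + ν)`, which is `-1` on the
second half. -/
theorem theta_add_mul_theta_sub {τ : ℂ} (hτ : 0 < τ.im) (x y : ℂ) :
    theta τ (x + y) * theta τ (x - y) =
      thetaEven τ x * thetaOdd τ y - thetaOdd τ x * thetaEven τ y := by
  have hτ2 : 0 < (2 * τ).im := by simpa using hτ
  let t : ℂ → ℤ → ℂ := fun u k =>
    cexp (Real.pi * I * (u + 1 / 2) + Real.pi * I * τ / 4) *
      jacobiTheta₂_term k (u + 1 / 2 + τ / 2) τ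
  have ht : ∀ u, HasSum (t u) (theta τ u) := fun u => by
    rw [theta_eq_jacobiTheta₂]
    exact (hasSum_jacobiTheta₂_term _ hτ).mul_left _
  let a : ℂ → ℤ → ℂ := fun u k => jacobiTheta₂_term k (2 * u) (2 * τ)
  let b : ℂ → ℤ → ℂ := fun u k =>
    cexp (2 * Real.pi * I * u + Real.pi * I * τ / 2) * jacobiTheta₂_term k (2 * u + τ) (2 * τ)
  have ha : ∀ u, HasSum (a u) (thetaEven τ u) := fun u => hasSum_jacobiTheta₂_term _ hτ2
  have hb : ∀ u, HasSum (b u) (thetaOdd τ u) := fun u =>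
    (hasSum_jacobiTheta₂_term _ hτ2).mul_left _
  have hmul : ∀ {f g : ℤ → ℂ} {r s : ℂ}, HasSum f r → HasSum g s →
      HasSum (fun p : ℤ × ℤ => f p.1 * g p.2) (r * s) := fun hf hg =>
    hf.mul hg (summable_mul_of_summable_norm hf.summable.norm hg.summable.norm)
  have h1 := hmul (ht (x + y)) (ht (x - y))
  have h2 : HasSum ((fun p : ℤ × ℤ => t (x + y) p.1 * t (x - y) p.2) ∘ intPairEquiv)
      (thetaEven τ x * thetaOdd τ y + -(thetaOdd τ x * thetaEven τ y)) := by
    refine HasSum.sum ?_ ?_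
    · refine (hmul (ha x) (hb y)).congr_fun ?_
      rintro ⟨p, q⟩
      simp only [Function.comp_apply, intPairEquiv_inl, t, a, b,
        jacobiTheta₂_term, ← Complex.exp_add]
      rw [Complex.exp_eq_exp_iff_exists_int]
      exact ⟨p, by push_cast; ring⟩
    · refine (hmul (hb x) (ha y)).neg.congr_fun ?_
      rintro ⟨p, q⟩
      simp only [Function.comp_apply, intPairEquiv_inr, t, a, b,
        jacobiTheta₂_term, ← Complex.exp_add]
      rw [← neg_one_mul (cexp _), ← Complex.exp_pi_mul_I, ← Complex.exp_add,
        Complex.exp_eq_exp_iff_exists_int]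
      exact ⟨p, by push_cast; ring⟩
  rw [sub_eq_add_neg]
  exact h1.unique (intPairEquiv.hasSum_iff.mp h2)

/-- Weierstrass' three-term identity. -/
theorem theta_three_term {τ : ℂ} (hτ : 0 < τ.im) (x y z w : ℂ) :
    theta τ (x + y) * theta τ (x - y) * (theta τ (z + w) * theta τ (z - w)) +
      theta τ (x + z) * theta τ (x - z) * (theta τ (w + y) * theta τ (w - y)) +
      theta τ (x + w) * theta τ (x - w) * (theta τ (y + z) * theta τ (y - z)) = 0 := by
  -- Each product is now a `2 × 2` minor of the vectors `(thetaEven, thetaOdd)`, and the identity is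
  -- the Plücker relation for four vectors in a plane.
  simp only [theta_add_mul_theta_sub hτ]
  ring

/-! ### The zeros of theta. -/

/-- The integral is the zeroth Fourier coefficient. It serves to show that theta is not identically
zero. -/
theorem integral_jacobiTheta₂ {τ : ℂ} (hτ : 0 < τ.im) :
    ∫ x in (0 : ℝ)..1, jacobiTheta₂ x τ = 1 := by
  have h := intervalIntegral.hasSum_integral_of_dominated_convergence (μ := MeasureTheory.volume)
    (a := 0) (b := 1) (F := fun (n : ℤ) (x : ℝ) => jacobiTheta₂_term n x τ)
    (f := fun x : ℝ => jacobiTheta₂ x τ) (fun n _ => ‖jacobiTheta₂_term n 0 τ‖)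
    (fun n => by
      refine Continuous.aestronglyMeasurable ?_
      unfold jacobiTheta₂_term
      fun_prop)
    (fun n => by
      refine Eventually.of_forall fun x _ => le_of_eq ?_
      simp [norm_jacobiTheta₂_term])
    (Eventually.of_forall fun x _ => ((summable_jacobiTheta₂_term_iff 0 τ).mpr hτ).norm)
    (by simp)
    (Eventually.of_forall fun x _ => hasSum_jacobiTheta₂_term x hτ)
  refine h.unique ?_
  have h2 : ∀ n : ℤ, ∫ x in (0 : ℝ)..1, jacobiTheta₂_term n x τ = if n = 0 then 1 else 0 := by
    intro n
    unfold jacobiTheta₂_term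
    split_ifs with hn
    · simp [hn]
    · have hc : (2 * Real.pi * I * n : ℂ) ≠ 0 := by
        simp [Real.pi_ne_zero, hn]
      simp only [Complex.exp_add, intervalIntegral.integral_mul_const]
      rw [integral_exp_mul_complex hc]
      have : (2 * Real.pi * I * n * (1 : ℝ) : ℂ) = n * (2 * Real.pi * I) := by push_cast; ring
      rw [this, Complex.exp_int_mul_two_pi_mul_I]
      simp
  simp only [h2]
  exact hasSum_ite_eq 0 1

theorem exists_theta_ne_zero {τ : ℂ} (hτ : 0 < τ.im) : ∃ u, theta τ u ≠ 0 := by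
  by_contra! h
  have h0 : ∀ z, jacobiTheta₂ z τ = 0 := fun z => by
    have := h (z - 1 / 2 - τ / 2)
    rw [theta_eq_jacobiTheta₂, show z - 1 / 2 - τ / 2 + 1 / 2 + τ / 2 = z by ring] at this
    simpa [Complex.exp_ne_zero] using this
  have := integral_jacobiTheta₂ hτ
  simp [h0] at this

/-- Two entire functions with vanishing Wronskian are proportional. -/
theorem exists_eq_const_mul_of_wronskian_eq_zero {f g : ℂ → ℂ} (hf : Differentiable ℂ f)
    (hg : Differentiable ℂ g) (h : ∀ z, deriv f z * g z = f z * deriv g z) {p : ℂ}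
    (hp : g p ≠ 0) : ∃ a, ∀ z, f z = a * g z := by
  obtain ⟨ε, hε, hball⟩ := Metric.eventually_nhds_iff_ball.mp (hg.continuous.continuousAt.eventually_ne hp)
  have hconst : ∀ z ∈ Metric.ball p ε, f z / g z = f p / g p := by
    intro z hz
    refine (convex_ball p ε).is_const_of_fderivWithin_eq_zero (𝕜 := ℂ) (f := fun z => f z / g z) ?_ ?_ hz
      (Metric.mem_ball_self hε)
    · exact fun w hw => ((hf w).div (hg w) (hball w hw)).differentiableWithinAt
    · intro w hw
      rw [fderivWithin_of_isOpen Metric.isOpen_ball hw]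
      ext
      have := deriv_fun_div (hf w) (hg w) (hball w hw)
      rw [h w, sub_self, zero_div] at this
      simpa using this
  refine ⟨f p / g p, fun z => ?_⟩
  have hfa : AnalyticOnNhd ℂ f Set.univ := hf.differentiableOn.analyticOnNhd isOpen_univ
  have hga : AnalyticOnNhd ℂ (fun z => f p / g p * g z) Set.univ :=
    (hg.const_mul _).differentiableOn.analyticOnNhd isOpen_univ
  have := hfa.eq_of_eventuallyEq hga (z₀ := p) (by
    filter_upwards [Metric.ball_mem_nhds p hε] with w hw
    rw [← hconst w hw, div_mul_cancel₀ _ (hball w hw)])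
  exact congrFun this z

theorem differentiable_thetaEven {τ : ℂ} (hτ : 0 < τ.im) : Differentiable ℂ (thetaEven τ) := by
  intro x
  have hτ2 : 0 < (2 * τ).im := by simpa using hτ
  exact (differentiableAt_jacobiTheta₂_fst (2 * x) hτ2).comp x
    (by fun_prop : DifferentiableAt ℂ (fun u : ℂ => 2 * u) x)

theorem differentiable_thetaOdd {τ : ℂ} (hτ : 0 < τ.im) : Differentiable ℂ (thetaOdd τ) := by
  intro x
  have hτ2 : 0 < (2 * τ).im := by simpa using hτ
  have h1 := (differentiableAt_jacobiTheta₂_fst (2 * x + τ) hτ2).comp x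
    (by fun_prop : DifferentiableAt ℂ (fun u : ℂ => 2 * u + τ) x)
  exact DifferentiableAt.mul (by fun_prop) h1

/-- Differentiating the addition formula on the diagonal shows that `θ(2z) θ'(0)` is the Wronskian
of `thetaEven` and `thetaOdd`. If it vanished, the two would be proportional, and every product `θ(x
+ y) θ(x - y)` would be zero. -/
theorem deriv_theta_zero_ne_zero {τ : ℂ} (hτ : 0 < τ.im) : deriv (theta τ) 0 ≠ 0 := by
  intro h0
  have hd := differentiable_theta hτ
  have hE := differentiable_thetaEven hτ
  have hO := differentiable_thetaOdd hτ
  have hw : ∀ z, deriv (thetaEven τ) z * thetaOdd τ z = thetaEven τ z * deriv (thetaOdd τ) z := by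
    intro z
    have h1 : HasDerivAt (fun x => theta τ (x + z) * theta τ (x - z))
        (deriv (theta τ) (z + z) * theta τ (z - z) + theta τ (z + z) * deriv (theta τ) (z - z)) z :=
      ((hd _).hasDerivAt.comp_add_const z z).mul ((hd _).hasDerivAt.comp_sub_const z z)
    have h2 : HasDerivAt (fun x => theta τ (x + z) * theta τ (x - z))
        (deriv (thetaEven τ) z * thetaOdd τ z - deriv (thetaOdd τ) z * thetaEven τ z) z := by
      simp only [theta_add_mul_theta_sub hτ]
      exact ((hE z).hasDerivAt.mul_const _).sub ((hO z).hasDerivAt.mul_const _)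
    have h3 := h1.unique h2
    rw [sub_self, theta_zero, h0, mul_zero, mul_zero, add_zero] at h3
    linear_combination -h3
  obtain ⟨u, hu⟩ := exists_theta_ne_zero hτ
  have hsq : ∀ x, theta τ (x + x) * theta τ (x - x) = 0 := fun x => by simp [theta_zero]
  have hadd := theta_add_mul_theta_sub hτ
  have hprod : ∀ x y, theta τ (x + y) * theta τ (x - y) = 0 := by
    intro x y
    rw [hadd]
    by_cases hz : ∃ p, thetaOdd τ p ≠ 0
    · obtain ⟨p, hp⟩ := hz
      obtain ⟨a, ha⟩ := exists_eq_const_mul_of_wronskian_eq_zero hE hO hw hp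
      rw [ha, ha]
      ring
    · push Not at hz
      simp [hz]
  have := hprod u 0
  simp [hu] at this

theorem exists_theta_mul_theta_ne_zero {τ : ℂ} (hτ : 0 < τ.im) (a : ℂ) :
    ∃ p, theta τ p ≠ 0 ∧ theta τ (p + a) ≠ 0 := by
  obtain ⟨u, hu⟩ := exists_theta_ne_zero hτ
  by_contra! h
  have hd := differentiable_theta hτ
  have hfa : AnalyticOnNhd ℂ (fun p => theta τ (p + a)) Set.univ :=
    (hd.comp (differentiable_id.add_const a)).differentiableOn.analyticOnNhd isOpen_univ
  have h0 := hfa.eq_of_eventuallyEq (g := fun _ => 0) analyticOnNhd_const (z₀ := u) (by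
    filter_upwards [hd.continuous.continuousAt.eventually_ne hu] with p hp using h p hp)
  have := congrFun h0 (u - a)
  simp [hu] at this

/-- No contour integration is needed: if `θ(a) = 0`, one term of the three-term identity drops out,
and the rest says that the logarithmic derivative of `θ(p + a)/θ(p)` does not depend on `p`. Hence
`θ(p + a) = A exp(Bp) θ(p)`, and comparing multipliers under `1` and `τ` forces `a` into the
lattice. -/
theorem theta_ne_zero {τ : ℂ} (hτ : 0 < τ.im) {a : ℂ} (ha : a ∉ lattice τ) : theta τ a ≠ 0 := by
  intro h0
  refine ha ?_
  have hd := differentiable_theta hτ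
  have key : ∀ p q s, theta τ (p + a) * theta τ (q + a) * (theta τ (p + s) * theta τ (q - s)) =
      theta τ (p + s + a) * theta τ (q - s + a) * (theta τ p * theta τ q) := by
    intro p q s
    -- The arguments are chosen so that the first term contains `θ(a)`.
    have h := theta_three_term hτ ((p + q) / 2 + a) ((p + q) / 2) ((p - q) / 2) ((p - q) / 2 + s)
    rw [show (p + q) / 2 + a - (p + q) / 2 = a by ring, h0,
      show (p + q) / 2 + a + (p - q) / 2 = p + a by ring,
      show (p + q) / 2 + a - (p - q) / 2 = q + a by ring,
      show (p - q) / 2 + s + (p + q) / 2 = p + s by ring,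
      show (p - q) / 2 + s - (p + q) / 2 = -(q - s) by ring,
      show (p + q) / 2 + a + ((p - q) / 2 + s) = p + s + a by ring,
      show (p + q) / 2 + a - ((p - q) / 2 + s) = q - s + a by ring,
      show (p + q) / 2 + (p - q) / 2 = p by ring,
      show (p + q) / 2 - (p - q) / 2 = q by ring, theta_neg] at h
    linear_combination -h
  obtain ⟨q, hq, hqa⟩ := exists_theta_mul_theta_ne_zero hτ a
  set B : ℂ := deriv (theta τ) (q + a) / theta τ (q + a) - deriv (theta τ) q / theta τ q with hB
  have hW : ∀ p, theta τ (p + a) * deriv (theta τ) p + B * (theta τ (p + a) * theta τ p) =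
      deriv (theta τ) (p + a) * theta τ p := by
    intro p
    have h1 : HasDerivAt (fun s => theta τ (p + a) * theta τ (q + a) *
        (theta τ (p + s) * theta τ (q - s)))
        (theta τ (p + a) * theta τ (q + a) *
          (deriv (theta τ) (p + 0) * theta τ (q - 0) + theta τ (p + 0) * -deriv (theta τ) (q - 0))) 0 :=
      (((hd _).hasDerivAt.comp_const_add p 0).mul ((hd _).hasDerivAt.comp_const_sub q 0)).const_mul _
    have h2 : HasDerivAt (fun s => theta τ (p + a) * theta τ (q + a) *
        (theta τ (p + s) * theta τ (q - s)))
        ((deriv (theta τ) (p + a + 0) * theta τ (q + a - 0) +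
          theta τ (p + a + 0) * -deriv (theta τ) (q + a - 0)) * (theta τ p * theta τ q)) 0 := by
      simp only [key]
      have h3 := (((hd _).hasDerivAt.comp_const_add (p + a) 0).mul
        ((hd _).hasDerivAt.comp_const_sub (q + a) 0)).mul_const (theta τ p * theta τ q)
      refine h3.congr_of_eventuallyEq (Eventually.of_forall fun s => ?_)
      simp only [Pi.mul_apply]
      rw [show p + s + a = p + a + s by ring, show q - s + a = q + a - s by ring]
    have h3 := h1.unique h2
    simp only [add_zero, sub_zero] at h3
    have h4 : B * (theta τ (q + a) * theta τ q) =
        deriv (theta τ) (q + a) * theta τ q - deriv (theta τ) q * theta τ (q + a) := by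
      rw [hB]
      field_simp
    refine mul_right_cancel₀ (mul_ne_zero hqa hq) ?_
    linear_combination h3 + theta τ (p + a) * theta τ p * h4
  obtain ⟨A, hA⟩ := exists_eq_const_mul_of_wronskian_eq_zero
    (f := fun p => theta τ (p + a) * cexp (-(B * p))) (g := theta τ) (by
      exact (hd.comp (differentiable_id.add_const a)).mul (by fun_prop)) hd (fun z => by
      have h1 : HasDerivAt (fun p => theta τ (p + a) * cexp (-(B * p)))
          (deriv (theta τ) (z + a) * cexp (-(B * z)) +
            theta τ (z + a) * (cexp (-(B * z)) * -(B * 1))) z :=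
        ((hd _).hasDerivAt.comp_add_const z a).mul ((((hasDerivAt_id z).const_mul B).neg).cexp)
      rw [h1.deriv]
      linear_combination -cexp (-(B * z)) * hW z) hq
  have hE := Complex.exp_ne_zero (-(B * q))
  have hone := hA (q + 1)
  rw [show q + 1 + a = q + a + 1 by ring, theta_add_one, theta_add_one,
    show -(B * (q + 1)) = -(B * q) + -B by ring, Complex.exp_add] at hone
  have h1 : cexp (-B) = 1 := by
    refine mul_left_cancel₀ (mul_ne_zero hqa hE) ?_
    linear_combination -hone - hA q
  have htau := hA (q + τ)
  rw [show q + τ + a = q + a + τ by ring, theta_add_tau, theta_add_tau,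
    show -(B * (q + τ)) = -(B * q) + -(B * τ) by ring, Complex.exp_add,
    show -(Real.pi * I * (τ + 2 * (q + a))) =
      -(Real.pi * I * (τ + 2 * q)) + -(2 * Real.pi * I * a) by ring, Complex.exp_add] at htau
  have h2 : cexp (-(2 * Real.pi * I * a) + -(B * τ)) = 1 := by
    rw [Complex.exp_add]
    refine mul_left_cancel₀ (mul_ne_zero (mul_ne_zero hqa hE)
      (Complex.exp_ne_zero (-(Real.pi * I * (τ + 2 * q))))) ?_
    linear_combination -htau - cexp (-(Real.pi * I * (τ + 2 * q))) * hA q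
  obtain ⟨k, hk⟩ := Complex.exp_eq_one_iff.mp h1
  obtain ⟨m, hm⟩ := Complex.exp_eq_one_iff.mp h2
  refine ⟨-m, k, ?_⟩
  have hpi : (2 * Real.pi * I : ℂ) ≠ 0 := by simp [Real.pi_ne_zero]
  refine mul_left_cancel₀ hpi ?_
  push_cast
  linear_combination -hm + τ * hk

/-! ### Liouville's theorem for elliptic functions -/

theorem eventually_theta_affine_ne_zero {τ : ℂ} (hτ : 0 < τ.im) {a : ℂ} (ha : a ≠ 0) (b z₀ : ℂ) :
    ∀ᶠ z in 𝓝[≠] z₀, theta τ (a * z + b) ≠ 0 := by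
  have hd : Differentiable ℂ fun z => theta τ (a * z + b) :=
    (differentiable_theta hτ).comp (by fun_prop : Differentiable ℂ fun z : ℂ => a * z + b)
  have han : AnalyticOnNhd ℂ (fun z => theta τ (a * z + b)) Set.univ :=
    hd.differentiableOn.analyticOnNhd isOpen_univ
  rcases (han z₀ trivial).eventually_eq_zero_or_eventually_ne_zero with h | h
  · exfalso
    have h0 := han.eq_of_eventuallyEq (g := fun _ => 0) analyticOnNhd_const h
    obtain ⟨u, hu⟩ := exists_theta_ne_zero hτ
    have := congrFun h0 ((u - b) / a)
    simp only [mul_div_cancel₀ _ ha, sub_add_cancel] at this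
    exact hu this
  · exact h

theorem exists_sub_eq_of_periodic {τ : ℂ} (hτ : 0 < τ.im) (z : ℂ) :
    ∃ a b : ℤ, ∃ s ∈ Set.Icc (0 : ℝ) 1, ∃ t ∈ Set.Icc (0 : ℝ) 1,
      z = (s + t * τ) + (a + b * τ) := by
  refine ⟨⌊z.re - z.im / τ.im * τ.re⌋, ⌊z.im / τ.im⌋, Int.fract (z.re - z.im / τ.im * τ.re),
    ⟨Int.fract_nonneg _, (Int.fract_lt_one _).le⟩, Int.fract (z.im / τ.im),
    ⟨Int.fract_nonneg _, (Int.fract_lt_one _).le⟩, ?_⟩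
  have h1 : ∀ r : ℝ, ((Int.fract r : ℝ) : ℂ) + (⌊r⌋ : ℂ) = r := fun r => by
    exact_mod_cast Int.fract_add_floor r
  have h2 : z = ((z.re - z.im / τ.im * τ.re : ℝ) : ℂ) + ((z.im / τ.im : ℝ) : ℂ) * τ := by
    apply Complex.ext
    · simp
    · simp [hτ.ne']
  linear_combination h2 - h1 (z.re - z.im / τ.im * τ.re) - τ * h1 (z.im / τ.im)

theorem periodic_add_lattice {τ : ℂ} {f : ℂ → ℂ} (h1 : ∀ z, f (z + 1) = f z)
    (hτ : ∀ z, f (z + τ) = f z) (z : ℂ) (a b : ℤ) : f (z + (a + b * τ)) = f z := by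
  have p1 : Function.Periodic f 1 := h1
  have p2 : Function.Periodic f τ := hτ
  have := p1.int_mul a
  have h2 := p2.int_mul b
  rw [← add_assoc, h2]
  simpa using this z

/-- The hypothesis on `(z - z₀) f(z)` makes all singularities removable; the extension is entire and
bounded by its values on a period parallelogram. Only continuity points appear in the conclusion,
because `f` may take arbitrary values at the removable singularities. -/
theorem eq_const_of_elliptic {τ : ℂ} (hτ : 0 < τ.im) {f : ℂ → ℂ} (h1 : ∀ z, f (z + 1) = f z)
    (h2 : ∀ z, f (z + τ) = f z) (hd : ∀ z₀, ∀ᶠ z in 𝓝[≠] z₀, DifferentiableAt ℂ f z)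
    (hr : ∀ z₀, Tendsto (fun z => (z - z₀) * f z) (𝓝[≠] z₀) (𝓝 0)) :
    ∃ c, ∀ z, ContinuousAt f z → f z = c := by
  let g : ℂ → ℂ := fun z => limUnder (𝓝[≠] z) f
  have hlo : ∀ z₀, (fun z => f z - f z₀) =o[𝓝[≠] z₀] fun z => (z - z₀)⁻¹ := by
    intro z₀
    rw [Asymptotics.isLittleO_iff_tendsto']
    · have h3 : Tendsto (fun z => (z - z₀) * f z - (z - z₀) * f z₀) (𝓝[≠] z₀) (𝓝 0) := by
        have h4 : Tendsto (fun z => (z - z₀) * f z₀) (𝓝[≠] z₀) (𝓝 0) := by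
          have : Tendsto (fun z => (z - z₀) * f z₀) (𝓝 z₀) (𝓝 ((z₀ - z₀) * f z₀)) :=
            Continuous.tendsto (by fun_prop) _
          rw [sub_self, zero_mul] at this
          exact this.mono_left nhdsWithin_le_nhds
        simpa using (hr z₀).sub h4
      refine h3.congr fun z => ?_
      rw [div_inv_eq_mul]
      ring
    · filter_upwards [self_mem_nhdsWithin] with z hz h
      exact absurd (inv_eq_zero.mp h) (sub_ne_zero.mpr hz)
  have hlim : ∀ z₀, Tendsto f (𝓝[≠] z₀) (𝓝 (g z₀)) := fun z₀ =>
    tendsto_limUnder_of_differentiable_on_punctured_nhds_of_isLittleO (hd z₀) (hlo z₀)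
  have heq : ∀ z, ContinuousAt f z → f z = g z := fun z hz =>
    tendsto_nhds_unique (hz.tendsto.mono_left nhdsWithin_le_nhds) (hlim z)
  have hg : Differentiable ℂ g := by
    intro z₀
    have h3 := differentiableOn_update_limUnder_insert_of_isLittleO
      (s := {z | DifferentiableAt ℂ f z}) (hd z₀)
      (fun z hz => DifferentiableAt.differentiableWithinAt hz) (hlo z₀)
    have hmem : insert z₀ {z | DifferentiableAt ℂ f z} ∈ 𝓝 z₀ := insert_mem_nhds_iff.mpr (hd z₀)
    refine (h3.differentiableAt hmem).congr_of_eventuallyEq ?_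
    filter_upwards [hmem] with z hz
    by_cases hz0 : z = z₀
    · subst hz0
      simp [g]
    · rw [Function.update_of_ne hz0]
      rcases hz with hz | hz
      · exact absurd hz hz0
      · exact (heq z (DifferentiableAt.continuousAt hz)).symm
  have hper : ∀ ω : ℂ, (∀ z, f (z + ω) = f z) → ∀ z, g (z + ω) = g z := by
    intro ω hω z
    refine tendsto_nhds_unique (hlim (z + ω)) ?_
    have hm : Tendsto (fun w => w - ω) (𝓝[≠] (z + ω)) (𝓝[≠] z) := by
      refine tendsto_nhdsWithin_of_tendsto_nhds_of_eventually_within _ ?_ ?_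
      · have : Tendsto (fun w => w - ω) (𝓝 (z + ω)) (𝓝 (z + ω - ω)) :=
          Continuous.tendsto (by fun_prop) _
        rw [add_sub_cancel_right] at this
        exact this.mono_left nhdsWithin_le_nhds
      · filter_upwards [self_mem_nhdsWithin] with w hw h
        exact hw (sub_eq_iff_eq_add.mp h)
    refine ((hlim z).comp hm).congr fun w => ?_
    simp only [Function.comp_apply]
    rw [← hω, sub_add_cancel]
  have hb : Bornology.IsBounded (Set.range g) := by
    have hK : IsCompact ((fun p : ℝ × ℝ => g (p.1 + p.2 * τ)) ''
        (Set.Icc (0 : ℝ) 1 ×ˢ Set.Icc (0 : ℝ) 1)) :=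
      (isCompact_Icc.prod isCompact_Icc).image (hg.continuous.comp (by fun_prop))
    refine hK.isBounded.subset ?_
    rintro _ ⟨z, rfl⟩
    obtain ⟨a, b, s, hs, t, ht, rfl⟩ := exists_sub_eq_of_periodic hτ z
    rw [periodic_add_lattice (hper 1 h1) (hper τ h2)]
    exact ⟨(s, t), ⟨hs, ht⟩, rfl⟩
  obtain ⟨c, hc⟩ := hg.exists_const_forall_eq_of_bounded hb
  exact ⟨c, fun z hz => (heq z hz).trans (hc z)⟩

/-! ### The symmetry of the sums over splittings -/

/-- `∑_{P ⊆ s} w(|P|) ∏_{i ∈ P, k ∈ s \ P} G(λ_k - λ_i)`. -/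
def splitSum {n : ℕ} (G : ℂ → ℂ) (w : ℕ → ℂ) (s : Finset (Fin n)) (l : Fin n → ℂ) : ℂ :=
  ∑ P ∈ s.powerset, w P.card * ∏ i ∈ P, ∏ k ∈ s \ P, G (l k - l i)

/-- Elliptic functions symmetric about `ħ / 2`, with simple poles at `0` and `ħ`. -/
structure IsSplitKernel (τ h ρ : ℂ) (G : ℂ → ℂ) : Prop where
  add_one : ∀ w, G (w + 1) = G w
  add_tau : ∀ w, G (w + τ) = G w
  symm : ∀ w, G (h - w) = G w
  diff : ∀ w, theta τ w ≠ 0 → theta τ (w - h) ≠ 0 → DifferentiableAt ℂ G w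
  residue : Tendsto (fun w => w * G w) (𝓝[≠] 0) (𝓝 ρ)

/-- The points of `λ` with index in `s` differ modulo the lattice and multiples of `ħ`. -/
def IsGeneric {n : ℕ} (τ h : ℂ) (s : Finset (Fin n)) (l : Fin n → ℂ) : Prop :=
  ∀ i ∈ s, ∀ j ∈ s, i ≠ j → ∀ e ∈ Finset.Icc (-2 : ℤ) 2, theta τ (l i - l j - e * h) ≠ 0

section Split

variable {n : ℕ}

/-- Isolates the factors linking `a` and `b`: they occur only in the terms where exactly one of the
two indices lies in the subset, and these terms carry the weight `w (P.card + 1)`. -/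
theorem splitSum_insert_insert (G : ℂ → ℂ) (w : ℕ → ℂ) {s : Finset (Fin n)} {a b : Fin n}
    (hab : a ≠ b) (ha : a ∉ s) (hb : b ∉ s) (l : Fin n → ℂ) :
    splitSum G w (insert a (insert b s)) l =
      ∑ P ∈ s.powerset, (∏ i ∈ P, ∏ k ∈ s \ P, G (l k - l i)) *
        (w P.card * ∏ i ∈ P, (G (l a - l i) * G (l b - l i)) +
          w (P.card + 1) *
            (G (l b - l a) * ((∏ k ∈ s \ P, G (l k - l a)) * ∏ i ∈ P, G (l b - l i)) +
              G (l a - l b) * ((∏ k ∈ s \ P, G (l k - l b)) * ∏ i ∈ P, G (l a - l i))) +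
          w (P.card + 2) * ∏ k ∈ s \ P, (G (l k - l a) * G (l k - l b))) := by
  have ha' : a ∉ insert b s := by simp [hab, ha]
  rw [splitSum, Finset.sum_powerset_insert ha', Finset.sum_powerset_insert hb,
    Finset.sum_powerset_insert hb, ← Finset.sum_add_distrib, ← Finset.sum_add_distrib,
    ← Finset.sum_add_distrib]
  refine Finset.sum_congr rfl fun P hP => ?_
  have hPs := Finset.mem_powerset.mp hP
  have haP : a ∉ P := fun h => ha (hPs h)
  have hbP : b ∉ P := fun h => hb (hPs h)
  have haP' : a ∉ insert b P := by simp [hab, haP]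
  have e0 : insert a (insert b s) \ P = insert a (insert b (s \ P)) := by
    ext x; simp only [Finset.mem_sdiff, Finset.mem_insert]; grind
  have e1 : insert a (insert b s) \ insert b P = insert a (s \ P) := by
    ext x; simp only [Finset.mem_sdiff, Finset.mem_insert]; grind
  have e2 : insert a (insert b s) \ insert a P = insert b (s \ P) := by
    ext x; simp only [Finset.mem_sdiff, Finset.mem_insert]; grind
  have e3 : insert a (insert b s) \ insert a (insert b P) = s \ P := by
    ext x; simp only [Finset.mem_sdiff, Finset.mem_insert]; grind
  have ha0 : a ∉ s \ P := fun h => ha (Finset.mem_sdiff.mp h).1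
  have hb0 : b ∉ s \ P := fun h => hb (Finset.mem_sdiff.mp h).1
  have ha1 : a ∉ insert b (s \ P) := by simp [hab, ha]
  rw [e0, e1, e2, e3, Finset.card_insert_of_notMem haP', Finset.card_insert_of_notMem haP,
    Finset.card_insert_of_notMem hbP]
  simp only [Finset.prod_insert haP', Finset.prod_insert haP, Finset.prod_insert hbP,
    Finset.prod_insert ha0, Finset.prod_insert hb0, Finset.prod_insert ha1, Finset.prod_mul_distrib]
  ring

/-- The numbers `r` and `r'` are the residues of the two factors linking `a` and `b`. All other
factors are continuous at `z₀`, so the terms without a linking factor do not contribute. -/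
theorem tendsto_splitSum_residue (G : ℂ → ℂ) (w : ℕ → ℂ) {s : Finset (Fin n)} {a b : Fin n}
    (hab : a ≠ b) (ha : a ∉ s) (hb : b ∉ s) (l : Fin n → ℂ) {z₀ r r' : ℂ}
    (h1 : ∀ k ∈ s, ContinuousAt G (l k - z₀)) (h2 : ∀ k ∈ s, ContinuousAt G (z₀ - l k))
    (hr : Tendsto (fun z => (z - z₀) * G (l b - z)) (𝓝[≠] z₀) (𝓝 r))
    (hr' : Tendsto (fun z => (z - z₀) * G (z - l b)) (𝓝[≠] z₀) (𝓝 r')) :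
    Tendsto (fun z => (z - z₀) * splitSum G w (insert a (insert b s)) (Function.update l a z))
      (𝓝[≠] z₀)
      (𝓝 (∑ P ∈ s.powerset, (∏ i ∈ P, ∏ k ∈ s \ P, G (l k - l i)) *
        (w (P.card + 1) *
            (r * ((∏ k ∈ s \ P, G (l k - z₀)) * ∏ i ∈ P, G (l b - l i)) +
              r' * ((∏ k ∈ s \ P, G (l k - l b)) * ∏ i ∈ P, G (z₀ - l i)))))) := by
  have hz : Tendsto (fun z : ℂ => z - z₀) (𝓝[≠] z₀) (𝓝 0) := by
    have : Tendsto (fun z : ℂ => z - z₀) (𝓝 z₀) (𝓝 (z₀ - z₀)) :=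
      Continuous.tendsto (by fun_prop) _
    rw [sub_self] at this
    exact this.mono_left nhdsWithin_le_nhds
  have c1 : ∀ k ∈ s, Tendsto (fun z => G (l k - z)) (𝓝[≠] z₀) (𝓝 (G (l k - z₀))) := fun k hk =>
    ((h1 k hk).comp (f := fun z => l k - z) (by fun_prop)).tendsto.mono_left nhdsWithin_le_nhds
  have c2 : ∀ k ∈ s, Tendsto (fun z => G (z - l k)) (𝓝[≠] z₀) (𝓝 (G (z₀ - l k))) := fun k hk =>
    ((h2 k hk).comp (f := fun z => z - l k) (by fun_prop)).tendsto.mono_left nhdsWithin_le_nhds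
  have hne : ∀ k ∈ s, k ≠ a := fun k hk h => ha (h ▸ hk)
  have hfun : (fun z => (z - z₀) * splitSum G w (insert a (insert b s)) (Function.update l a z)) =
      fun z => ∑ P ∈ s.powerset, (∏ i ∈ P, ∏ k ∈ s \ P, G (l k - l i)) *
        ((z - z₀) * (w P.card * ∏ i ∈ P, (G (z - l i) * G (l b - l i))) +
          w (P.card + 1) *
            ((z - z₀) * G (l b - z) * ((∏ k ∈ s \ P, G (l k - z)) * ∏ i ∈ P, G (l b - l i)) +
              (z - z₀) * G (z - l b) * ((∏ k ∈ s \ P, G (l k - l b)) * ∏ i ∈ P, G (z - l i))) +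
          (z - z₀) * (w (P.card + 2) * ∏ k ∈ s \ P, (G (l k - z) * G (l k - l b)))) := by
    funext z
    rw [splitSum_insert_insert G w hab ha hb, Finset.mul_sum]
    refine Finset.sum_congr rfl fun P hP => ?_
    have hPs := Finset.mem_powerset.mp hP
    have u : ∀ k ∈ s, Function.update l a z k = l k := fun k hk =>
      Function.update_of_ne (hne k hk) _ _
    have ub : Function.update l a z b = l b := Function.update_of_ne hab.symm _ _
    have uP : ∀ k ∈ P, Function.update l a z k = l k := fun k hk => u k (hPs hk)
    have uQ : ∀ k ∈ s \ P, Function.update l a z k = l k := fun k hk =>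
      u k (Finset.mem_sdiff.mp hk).1
    have q0 : (∏ i ∈ P, ∏ k ∈ s \ P, G (Function.update l a z k - Function.update l a z i)) =
        ∏ i ∈ P, ∏ k ∈ s \ P, G (l k - l i) :=
      Finset.prod_congr rfl fun i hi => Finset.prod_congr rfl fun k hk => by rw [uP i hi, uQ k hk]
    have q1 : ∏ i ∈ P, (G (z - Function.update l a z i) * G (l b - Function.update l a z i)) =
        ∏ i ∈ P, (G (z - l i) * G (l b - l i)) :=
      Finset.prod_congr rfl fun i hi => by rw [uP i hi]
    have q2 : ∏ k ∈ s \ P, (G (Function.update l a z k - z) * G (Function.update l a z k - l b)) =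
        ∏ k ∈ s \ P, (G (l k - z) * G (l k - l b)) :=
      Finset.prod_congr rfl fun i hi => by rw [uQ i hi]
    have q3 : ∀ y, ∏ k ∈ s \ P, G (Function.update l a z k - y) = ∏ k ∈ s \ P, G (l k - y) :=
      fun y => Finset.prod_congr rfl fun i hi => by rw [uQ i hi]
    have q4 : ∀ y, ∏ k ∈ P, G (y - Function.update l a z k) = ∏ k ∈ P, G (y - l k) :=
      fun y => Finset.prod_congr rfl fun i hi => by rw [uP i hi]
    rw [ub, Function.update_self, q0, q1, q2, q3, q3, q4, q4]
    ring
  rw [hfun]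
  refine tendsto_finsetSum _ fun P hP => ?_
  have hPs := Finset.mem_powerset.mp hP
  have hsP : ∀ k ∈ s \ P, k ∈ s := fun k hk => (Finset.mem_sdiff.mp hk).1
  refine Tendsto.const_mul _ ?_
  have t1 : Tendsto (fun z => (z - z₀) * (w P.card * ∏ i ∈ P, (G (z - l i) * G (l b - l i))))
      (𝓝[≠] z₀) (𝓝 (0 * (w P.card * ∏ i ∈ P, (G (z₀ - l i) * G (l b - l i))))) :=
    hz.mul (Tendsto.const_mul _ (tendsto_finsetProd _ fun i hi => (c2 i (hPs hi)).mul_const _))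
  have t2 : Tendsto (fun z => (z - z₀) *
      (w (P.card + 2) * ∏ k ∈ s \ P, (G (l k - z) * G (l k - l b))))
      (𝓝[≠] z₀) (𝓝 (0 * (w (P.card + 2) * ∏ k ∈ s \ P, (G (l k - z₀) * G (l k - l b))))) :=
    hz.mul (Tendsto.const_mul _ (tendsto_finsetProd _ fun i hi => (c1 i (hsP i hi)).mul_const _))
  have t3 := (hr.mul ((tendsto_finsetProd (s \ P) fun i hi => c1 i (hsP i hi)).mul_const
    (∏ i ∈ P, G (l b - l i)))).add (hr'.mul ((tendsto_finsetProd P fun i hi =>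
      c2 i (hPs hi)).const_mul (∏ k ∈ s \ P, G (l k - l b))))
  have t4 := (t1.add (t3.const_mul (w (P.card + 1)))).add t2
  simpa only [zero_mul, zero_add, add_zero] using t4

theorem splitSum_neg (G : ℂ → ℂ) (w : ℕ → ℂ) (s : Finset (Fin n)) (l : Fin n → ℂ) :
    splitSum G w s (fun i => -l i) = splitSum (fun z => G (-z)) w s l := by
  unfold splitSum
  refine Finset.sum_congr rfl fun P _ => ?_
  congr 1
  refine Finset.prod_congr rfl fun i _ => Finset.prod_congr rfl fun k _ => ?_
  congr 1
  ring

theorem splitSum_congr (G : ℂ → ℂ) (w : ℕ → ℂ) {s : Finset (Fin n)} {l l' : Fin n → ℂ}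
    (h : ∀ i ∈ s, l i = l' i) : splitSum G w s l = splitSum G w s l' := by
  unfold splitSum
  refine Finset.sum_congr rfl fun P hP => ?_
  congr 1
  refine Finset.prod_congr rfl fun i hi => Finset.prod_congr rfl fun k hk => ?_
  rw [h i (Finset.mem_powerset.mp hP hi), h k (Finset.mem_sdiff.mp hk).1]

theorem splitSum_update_add {G : ℂ → ℂ} {ω : ℂ} (hG : ∀ z, G (z + ω) = G z) (w : ℕ → ℂ)
    (s : Finset (Fin n)) (l : Fin n → ℂ) (a : Fin n) (z : ℂ) :
    splitSum G w s (Function.update l a (z + ω)) = splitSum G w s (Function.update l a z) := by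
  have hG' : ∀ z, G (z - ω) = G z := fun z => by rw [← hG, sub_add_cancel]
  unfold splitSum
  refine Finset.sum_congr rfl fun P hP => ?_
  congr 1
  refine Finset.prod_congr rfl fun i hi => Finset.prod_congr rfl fun k hk => ?_
  have hik : k ≠ i := fun h => (Finset.mem_sdiff.mp hk).2 (h ▸ hi)
  by_cases hia : i = a
  · subst hia
    rw [Function.update_self, Function.update_self, Function.update_of_ne hik,
      Function.update_of_ne hik, ← sub_sub, hG']
  · rw [Function.update_of_ne hia, Function.update_of_ne hia]
    by_cases hka : k = a
    · subst hka
      rw [Function.update_self, Function.update_self, add_sub_right_comm, hG]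
    · rw [Function.update_of_ne hka, Function.update_of_ne hka]

theorem IsGeneric.mono {τ h : ℂ} {s t : Finset (Fin n)} {l : Fin n → ℂ} (hl : IsGeneric τ h s l)
    (hts : t ⊆ s) : IsGeneric τ h t l :=
  fun i hi j hj => hl i (hts hi) j (hts hj)

theorem IsGeneric.neg {τ h : ℂ} {s : Finset (Fin n)} {l : Fin n → ℂ} (hl : IsGeneric τ h s l) :
    IsGeneric τ h s (fun i => -l i) := by
  intro i hi j hj hij e he
  have := hl j hj i hi hij.symm e he
  rwa [show -l i - -l j - e * h = l j - l i - e * h by ring]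

theorem IsSplitKernel.differentiableAt_splitSum {τ h ρ : ℂ} {G : ℂ → ℂ}
    (hG : IsSplitKernel τ h ρ G) (w : ℕ → ℂ) {s : Finset (Fin n)} {l : Fin n → ℂ} {a : Fin n}
    {z : ℂ}
    (hz : ∀ k ∈ s.erase a, theta τ (z - l k) ≠ 0 ∧ theta τ (z - l k - h) ≠ 0 ∧
      theta τ (z - l k + h) ≠ 0) :
    DifferentiableAt ℂ (fun z => splitSum G w s (Function.update l a z)) z := by
  unfold splitSum
  refine DifferentiableAt.fun_sum fun P hP => ?_
  refine DifferentiableAt.const_mul ?_ _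
  refine DifferentiableAt.fun_finsetProd fun i hi => DifferentiableAt.fun_finsetProd fun k hk => ?_
  have hPs := Finset.mem_powerset.mp hP hi
  have hks := (Finset.mem_sdiff.mp hk).1
  have hik : k ≠ i := fun h => (Finset.mem_sdiff.mp hk).2 (h ▸ hi)
  by_cases hia : i = a
  · subst hia
    obtain ⟨z1, z2, z3⟩ := hz k (Finset.mem_erase.mpr ⟨hik, hks⟩)
    simp only [Function.update_self, Function.update_of_ne hik]
    refine DifferentiableAt.comp z (hG.diff (l k - z) ?_ ?_)
      (by fun_prop : DifferentiableAt ℂ (fun z : ℂ => l k - z) z)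
    · rwa [← neg_sub, theta_neg, neg_ne_zero]
    · rwa [show l k - z - h = -(z - l k + h) by ring, theta_neg, neg_ne_zero]
  · simp only [Function.update_of_ne hia]
    by_cases hka : k = a
    · subst hka
      obtain ⟨z1, z2, z3⟩ := hz i (Finset.mem_erase.mpr ⟨hia, hPs⟩)
      simp only [Function.update_self]
      exact DifferentiableAt.comp z (hG.diff (z - l i) z1 z2)
        (by fun_prop : DifferentiableAt ℂ (fun z : ℂ => z - l i) z)
    · simp only [Function.update_of_ne hka]
      exact differentiableAt_const _

theorem IsSplitKernel.neg_differentiableAt_splitSum {τ h ρ : ℂ} {G : ℂ → ℂ}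
    (hG : IsSplitKernel τ h ρ G) (w : ℕ → ℂ) {s : Finset (Fin n)} {l : Fin n → ℂ} {a : Fin n}
    {z : ℂ}
    (hz : ∀ k ∈ s.erase a, theta τ (z - l k) ≠ 0 ∧ theta τ (z - l k - h) ≠ 0 ∧
      theta τ (z - l k + h) ≠ 0) :
    DifferentiableAt ℂ (fun z => splitSum (fun y => G (-y)) w s (Function.update l a z)) z := by
  have h1 := hG.differentiableAt_splitSum w (l := fun i => -l i) (a := a) (z := -z) (fun k hk => by
    obtain ⟨z1, z2, z3⟩ := hz k hk
    refine ⟨?_, ?_, ?_⟩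
    · rwa [show -z - -l k = -(z - l k) by ring, theta_neg, neg_ne_zero]
    · rwa [show -z - -l k - h = -(z - l k + h) by ring, theta_neg, neg_ne_zero]
    · rwa [show -z - -l k + h = -(z - l k - h) by ring, theta_neg, neg_ne_zero])
  have h2 := DifferentiableAt.comp z h1 (by fun_prop : DifferentiableAt ℂ (fun z : ℂ => -z) z)
  refine h2.congr_of_eventuallyEq (Eventually.of_forall fun y => ?_)
  simp only [← splitSum_neg]
  congr 1
  funext i
  by_cases hia : i = a
  · subst hia; simp
  · simp [Function.update_of_ne hia]

/-- The difference of the two sides of the symmetry `splitSum_eq`. -/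
def splitDiff (G : ℂ → ℂ) (w : ℕ → ℂ) (s : Finset (Fin n)) (l : Fin n → ℂ) : ℂ :=
  splitSum G w s l - splitSum (fun z => G (-z)) w s l

theorem splitDiff_neg (G : ℂ → ℂ) (w : ℕ → ℂ) (s : Finset (Fin n)) (l : Fin n → ℂ) :
    splitDiff G w s (fun i => -l i) = -splitDiff G w s l := by
  rw [splitDiff, splitDiff, splitSum_neg, splitSum_neg]
  simp only [neg_neg]
  ring

/-- The residues of `splitDiff` vanish, if the symmetry holds for the smaller sets. -/
theorem IsSplitKernel.tendsto_splitDiff {τ h ρ : ℂ} {G : ℂ → ℂ}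
    (hG : IsSplitKernel τ h ρ G) (hh : theta τ h ≠ 0) (hh2 : theta τ (2 * h) ≠ 0)
    (w : ℕ → ℂ) {s : Finset (Fin n)} {a b : Fin n}
    (hab : a ≠ b) (ha : a ∉ s) (hb : b ∉ s) {l : Fin n → ℂ}
    (hl : IsGeneric τ h (insert b s) l)
    (ih : ∀ w, splitSum G w s l = splitSum (fun z => G (-z)) w s l)
    {e : ℤ} (he : e = -1 ∨ e = 0 ∨ e = 1) :
    Tendsto (fun z => (z - (l b + e * h)) *
      splitDiff G w (insert a (insert b s)) (Function.update l a z)) (𝓝[≠] (l b + e * h)) (𝓝 0) := by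
  have hsub : ∀ (z₀ : ℂ), Tendsto (fun z : ℂ => z - z₀) (𝓝[≠] z₀) (𝓝[≠] 0) := by
    intro z₀
    refine tendsto_nhdsWithin_of_tendsto_nhds_of_eventually_within _ ?_ ?_
    · have : Tendsto (fun z : ℂ => z - z₀) (𝓝 z₀) (𝓝 (z₀ - z₀)) :=
        Continuous.tendsto (by fun_prop) _
      rw [sub_self] at this
      exact this.mono_left nhdsWithin_le_nhds
    · filter_upwards [self_mem_nhdsWithin] with z hz h
      exact hz (sub_eq_zero.mp h)
  have hsub' : ∀ (z₀ : ℂ), Tendsto (fun z : ℂ => z₀ - z) (𝓝[≠] z₀) (𝓝[≠] 0) := by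
    intro z₀
    refine tendsto_nhdsWithin_of_tendsto_nhds_of_eventually_within _ ?_ ?_
    · have : Tendsto (fun z : ℂ => z₀ - z) (𝓝 z₀) (𝓝 (z₀ - z₀)) :=
        Continuous.tendsto (by fun_prop) _
      rw [sub_self] at this
      exact this.mono_left nhdsWithin_le_nhds
    · filter_upwards [self_mem_nhdsWithin] with z hz h
      exact hz (sub_eq_zero.mp h).symm
  have res1 : ∀ z₀, Tendsto (fun z => (z - z₀) * G (z - z₀)) (𝓝[≠] z₀) (𝓝 ρ) := fun z₀ =>
    hG.residue.comp (hsub z₀)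
  have res2 : ∀ z₀, Tendsto (fun z => (z - z₀) * G (z₀ - z)) (𝓝[≠] z₀) (𝓝 (-ρ)) := fun z₀ => by
    refine (hG.residue.comp (hsub' z₀)).neg.congr fun z => ?_
    simp only [Function.comp_apply]
    ring
  have reg : ∀ (z₀ : ℂ) (F : ℂ → ℂ), ContinuousAt F z₀ →
      Tendsto (fun z => (z - z₀) * F z) (𝓝[≠] z₀) (𝓝 0) := fun z₀ F hF => by
    have := ((hsub z₀).mono_right nhdsWithin_le_nhds).mul
      (hF.tendsto.mono_left (nhdsWithin_le_nhds (s := {z₀}ᶜ)))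
    rwa [zero_mul] at this
  have cont : ∀ y, theta τ y ≠ 0 → theta τ (y - h) ≠ 0 → ContinuousAt G y := fun y h1 h2 =>
    (hG.diff y h1 h2).continuousAt
  have hmem : ∀ e : ℤ, -2 ≤ e → e ≤ 2 → e ∈ Finset.Icc (-2 : ℤ) 2 := fun e h1 h2 =>
    Finset.mem_Icc.mpr ⟨h1, h2⟩
  have he1 : -1 ≤ e ∧ e ≤ 1 := by omega
  -- The poles in question are at `l b + e * h` with `|e| ≤ 1`, and `G` is singular at `0` and `h`;
  -- hence multiples of `h` up to `±2` must be avoided.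
  have gen : ∀ k ∈ s, ∀ e' : ℤ, -2 ≤ e' → e' ≤ 2 → theta τ (l k - l b - e' * h) ≠ 0 :=
    fun k hk e' h1 h2 => hl k (Finset.mem_insert_of_mem hk) b (Finset.mem_insert_self _ _)
      (fun h => hb (h ▸ hk)) e' (hmem e' h1 h2)
  have genneg : ∀ k ∈ s, ∀ e' : ℤ, -2 ≤ e' → e' ≤ 2 → theta τ (l b - l k + e' * h) ≠ 0 :=
    fun k hk e' h1 h2 => by
      have := gen k hk e' h1 h2
      rwa [show l b - l k + e' * h = -(l k - l b - e' * h) by ring, theta_neg, neg_ne_zero]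
  have h1 : ∀ k ∈ s, ContinuousAt G (l k - (l b + e * h)) := fun k hk => by
    refine cont _ ?_ ?_
    · have := gen k hk e (by omega) (by omega)
      rwa [← sub_sub]
    · have := gen k hk (e + 1) (by omega) (by omega)
      rwa [show l k - (l b + e * h) - h = l k - l b - ((e + 1 : ℤ) : ℂ) * h by push_cast; ring]
  have h2 : ∀ k ∈ s, ContinuousAt G (l b + e * h - l k) := fun k hk => by
    refine cont _ ?_ ?_
    · have := genneg k hk e (by omega) (by omega)
      rwa [add_sub_right_comm]
    · have := genneg k hk (e - 1) (by omega) (by omega)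
      rwa [show l b + e * h - l k - h = l b - l k + ((e - 1 : ℤ) : ℂ) * h by push_cast; ring]
  have hneg : ∀ y, ContinuousAt G (-y) → ContinuousAt (fun z => G (-z)) y := fun y hy =>
    ContinuousAt.comp (f := fun z : ℂ => -z) hy (by fun_prop)
  have h1' : ∀ k ∈ s, ContinuousAt (fun z => G (-z)) (l k - (l b + e * h)) := fun k hk =>
    hneg _ (by rw [neg_sub]; exact h2 k hk)
  have h2' : ∀ k ∈ s, ContinuousAt (fun z => G (-z)) (l b + e * h - l k) := fun k hk =>
    hneg _ (by rw [neg_sub]; exact h1 k hk)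
  have hnh2 : theta τ (-h - h) ≠ 0 := by
    rwa [show -h - h = -(2 * h) by ring, theta_neg, neg_ne_zero]
  have hnh : theta τ (-h) ≠ 0 := by rwa [theta_neg, neg_ne_zero]
  have hcnh : ContinuousAt G (-h) := cont _ hnh hnh2
  -- Near `l b - h` only `G (l b - z)` is singular, near `l b + h` only `G (z - l b)`; at `l b` both
  -- are, with opposite residues. The conditions on `θ(h)` and `θ(2h)` keep `-h` away from the
  -- poles.
  obtain ⟨r, r', hr, hr', hzero⟩ : ∃ r r' : ℂ,
      Tendsto (fun z => (z - (l b + e * h)) * G (l b - z)) (𝓝[≠] (l b + e * h)) (𝓝 r) ∧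
      Tendsto (fun z => (z - (l b + e * h)) * G (z - l b)) (𝓝[≠] (l b + e * h)) (𝓝 r') ∧
      (e = -1 ∧ r' = 0 ∨ e = 0 ∧ r' = -r ∨ e = 1 ∧ r = 0) := by
    rcases he with rfl | rfl | rfl
    · refine ⟨ρ, 0, ?_, ?_, Or.inl ⟨rfl, rfl⟩⟩
      · refine (res1 (l b + (-1 : ℤ) * h)).congr fun z => ?_
        rw [← hG.symm (l b - z)]
        congr 2
        push_cast
        ring
      · refine reg _ (fun z => G (z - l b)) (ContinuousAt.comp (f := fun z => z - l b) ?_ (by fun_prop))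
        rwa [show l b + ((-1 : ℤ) : ℂ) * h - l b = -h by push_cast; ring]
    · refine ⟨-ρ, ρ, ?_, ?_, Or.inr (Or.inl ⟨rfl, (neg_neg ρ).symm⟩)⟩
      · simpa using res2 (l b)
      · simpa using res1 (l b)
    · refine ⟨0, -ρ, ?_, ?_, Or.inr (Or.inr ⟨rfl, rfl⟩)⟩
      · refine reg _ (fun z => G (l b - z)) (ContinuousAt.comp (f := fun z => l b - z) ?_ (by fun_prop))
        rwa [show l b - (l b + ((1 : ℤ) : ℂ) * h) = -h by push_cast; ring]
      · refine (res2 (l b + (1 : ℤ) * h)).congr fun z => ?_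
        rw [← hG.symm (z - l b)]
        congr 2
        push_cast
        ring
  have T1 := tendsto_splitSum_residue G w hab ha hb l h1 h2 hr hr'
  have T2 := tendsto_splitSum_residue (fun z => G (-z)) w hab ha hb l h1' h2' (r := r') (r' := r)
    (by simpa only [neg_sub] using hr') (by simpa only [neg_sub] using hr)
  have T := T1.sub T2
  have hlim : ∀ z, (z - (l b + e * h)) * splitDiff G w (insert a (insert b s)) (Function.update l a z) =
      (z - (l b + e * h)) * splitSum G w (insert a (insert b s)) (Function.update l a z) -
      (z - (l b + e * h)) * splitSum (fun z => G (-z)) w (insert a (insert b s))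
        (Function.update l a z) := fun z => by rw [splitDiff]; ring
  simp only [hlim]
  convert T using 2
  have hprod : ∀ (P : Finset (Fin n)) (F : Fin n → ℂ), P ∈ s.powerset →
      (∏ k ∈ s \ P, F k) * ∏ i ∈ P, F i = ∏ i ∈ s, F i := fun P F hP =>
    Finset.prod_sdiff (Finset.mem_powerset.mp hP)
  rcases hzero with ⟨rfl, rfl⟩ | ⟨rfl, rfl⟩ | ⟨rfl, rfl⟩
  -- By the reflection symmetry of `G` the products over `P` and `s \ P` merge into one over `s`,
  -- independent of `P`. What remains is the symmetry for `s` with the weight shifted by one.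
  · have hs1 : ∀ k, G (l k - (l b + ((-1 : ℤ) : ℂ) * h)) = G (l b - l k) := fun k => by
      rw [← hG.symm (l b - l k)]
      congr 1
      push_cast
      ring
    have ihw := ih (fun m => w (m + 1))
    unfold splitSum at ihw
    simp only [neg_sub, hs1, zero_mul, add_zero, zero_add]
    rw [eq_comm, sub_eq_zero]
    have e1 : ∀ P ∈ s.powerset, (∏ i ∈ P, ∏ k ∈ s \ P, G (l k - l i)) * (w (P.card + 1) *
        (r * ((∏ k ∈ s \ P, G (l b - l k)) * ∏ i ∈ P, G (l b - l i)))) =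
        r * (∏ i ∈ s, G (l b - l i)) * (w (P.card + 1) * ∏ i ∈ P, ∏ k ∈ s \ P, G (l k - l i)) :=
      fun P hP => by rw [hprod P _ hP]; ring
    have e2 : ∀ P ∈ s.powerset, (∏ i ∈ P, ∏ k ∈ s \ P, G (l i - l k)) * (w (P.card + 1) *
        (r * ((∏ k ∈ s \ P, G (l b - l k)) * ∏ i ∈ P, G (l i - (l b + ((-1 : ℤ) : ℂ) * h))))) =
        r * (∏ i ∈ s, G (l b - l i)) * (w (P.card + 1) * ∏ i ∈ P, ∏ k ∈ s \ P, G (l i - l k)) :=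
      fun P hP => by simp only [hs1]; rw [hprod P _ hP]; ring
    simp only [neg_sub, hs1] at ihw e2
    rw [Finset.sum_congr rfl e1, Finset.sum_congr rfl e2, ← Finset.mul_sum, ← Finset.mul_sum, ihw]
  -- At `z = l b` the two residues cancel within each term, without the induction hypothesis.
  · simp only [neg_sub, Int.cast_zero, zero_mul, add_zero]
    rw [eq_comm, sub_eq_zero]
    trans 0
    · exact Finset.sum_eq_zero fun P _ => by ring
    · exact (Finset.sum_eq_zero fun P _ => by ring).symm
  · have hs1 : ∀ k, G (l b + ((1 : ℤ) : ℂ) * h - l k) = G (l k - l b) := fun k => by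
      rw [← hG.symm (l k - l b)]
      congr 1
      push_cast
      ring
    have ihw := ih (fun m => w (m + 1))
    unfold splitSum at ihw
    simp only [neg_sub, hs1, zero_mul, add_zero, zero_add]
    rw [eq_comm, sub_eq_zero]
    have e1 : ∀ P ∈ s.powerset, (∏ i ∈ P, ∏ k ∈ s \ P, G (l k - l i)) * (w (P.card + 1) *
        (r' * ((∏ k ∈ s \ P, G (l k - l b)) * ∏ i ∈ P, G (l i - l b)))) =
        r' * (∏ i ∈ s, G (l i - l b)) * (w (P.card + 1) * ∏ i ∈ P, ∏ k ∈ s \ P, G (l k - l i)) :=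
      fun P hP => by rw [hprod P _ hP]; ring
    have e2 : ∀ P ∈ s.powerset, (∏ i ∈ P, ∏ k ∈ s \ P, G (l i - l k)) * (w (P.card + 1) *
        (r' * ((∏ k ∈ s \ P, G (l k - l b)) * ∏ i ∈ P, G (l i - l b)))) =
        r' * (∏ i ∈ s, G (l i - l b)) * (w (P.card + 1) * ∏ i ∈ P, ∏ k ∈ s \ P, G (l i - l k)) :=
      fun P hP => by rw [hprod P _ hP]; ring
    simp only [neg_sub] at ihw
    rw [Finset.sum_congr rfl e1, Finset.sum_congr rfl e2, ← Finset.mul_sum, ← Finset.mul_sum, ihw]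

theorem IsGeneric.ne_zero {τ h : ℂ} {s : Finset (Fin n)} {l : Fin n → ℂ} (hl : IsGeneric τ h s l)
    {a k : Fin n} (ha : a ∈ s) (hk : k ∈ s.erase a) :
    theta τ (l a - l k) ≠ 0 ∧ theta τ (l a - l k - h) ≠ 0 ∧ theta τ (l a - l k + h) ≠ 0 := by
  obtain ⟨hka, hks⟩ := Finset.mem_erase.mp hk
  have h0 := hl a ha k hks hka.symm
  refine ⟨?_, ?_, ?_⟩
  · simpa using h0 0 (by simp)
  · simpa using h0 1 (by simp)
  · simpa using h0 (-1) (by simp)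

/-- As a function of one coordinate the difference is elliptic with at most simple poles, whose
residues vanish by `tendsto_splitDiff`; so it is constant. -/
theorem IsSplitKernel.splitDiff_update {τ h ρ : ℂ} (hτ : 0 < τ.im) {G : ℂ → ℂ}
    (hG : IsSplitKernel τ h ρ G) (hh : theta τ h ≠ 0) (hh2 : theta τ (2 * h) ≠ 0)
    (w : ℕ → ℂ) {s : Finset (Fin n)} {l : Fin n → ℂ} (hl : IsGeneric τ h s l)
    (ih : ∀ t ⊂ s, ∀ w, splitSum G w t l = splitSum (fun z => G (-z)) w t l)
    {a : Fin n} (ha : a ∈ s) {z : ℂ} (hz : IsGeneric τ h s (Function.update l a z)) :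
    splitDiff G w s (Function.update l a z) = splitDiff G w s l := by
  have per : ∀ ω, (∀ z, G (z + ω) = G z) → ∀ z, splitDiff G w s (Function.update l a (z + ω)) =
      splitDiff G w s (Function.update l a z) := by
    intro ω hω z
    have hneg : ∀ z, G (-(z + ω)) = G (-z) := fun z => by
      rw [← hω, neg_add, neg_add_cancel_right]
    rw [splitDiff, splitDiff, splitSum_update_add hω,
      splitSum_update_add (G := fun z => G (-z)) hneg]
  have p1 := per 1 hG.add_one
  have p2 := per τ hG.add_tau
  have hdiff : ∀ z, (∀ k ∈ s.erase a, theta τ (z - l k) ≠ 0 ∧ theta τ (z - l k - h) ≠ 0 ∧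
      theta τ (z - l k + h) ≠ 0) →
      DifferentiableAt ℂ (fun z => splitDiff G w s (Function.update l a z)) z := fun z hz =>
    (hG.differentiableAt_splitSum w hz).sub (hG.neg_differentiableAt_splitSum w hz)
  have hev : ∀ z₀ c : ℂ, ∀ᶠ z in 𝓝[≠] z₀, theta τ (z + c) ≠ 0 := fun z₀ c => by
    simpa using eventually_theta_affine_ne_zero hτ one_ne_zero c z₀
  obtain ⟨c, hc⟩ := eq_const_of_elliptic hτ p1 p2
    (fun z₀ => by
      have : ∀ᶠ z in 𝓝[≠] z₀, ∀ k ∈ s.erase a, theta τ (z - l k) ≠ 0 ∧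
          theta τ (z - l k - h) ≠ 0 ∧ theta τ (z - l k + h) ≠ 0 := by
        rw [Filter.eventually_all_finset]
        intro k _
        filter_upwards [hev z₀ (-l k), hev z₀ (-l k - h), hev z₀ (-l k + h)] with z h1 h2 h3
        refine ⟨by rwa [sub_eq_add_neg], ?_, ?_⟩
        · rwa [show z - l k - h = z + (-l k - h) by ring]
        · rwa [show z - l k + h = z + (-l k + h) by ring]
      exact this.mono fun z hz => hdiff z hz)
    (fun z₀ => by
      -- Any possible singularity is congruent modulo the lattice to some `l b + e * h`; periodicity
      -- carries the residue statement over to `z₀`.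
      by_cases hp : ∃ b ∈ s.erase a, ∃ e : ℤ, (e = -1 ∨ e = 0 ∨ e = 1) ∧
          theta τ (z₀ - (l b + e * h)) = 0
      · obtain ⟨b, hb, e, he, h0⟩ := hp
        obtain ⟨hba, hbs⟩ := Finset.mem_erase.mp hb
        have hmem : z₀ - (l b + e * h) ∈ lattice τ := by
          by_contra hn
          exact theta_ne_zero hτ hn h0
        obtain ⟨p, q, hpq⟩ := hmem
        set t := (s.erase a).erase b with ht
        have hs : s = insert a (insert b t) := by
          rw [ht, Finset.insert_erase hb, Finset.insert_erase ha]
        have hat : a ∉ t := by simp [ht]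
        have hbt : b ∉ t := by simp [ht]
        have hts : t ⊂ s := by
          refine Finset.ssubset_iff_subset_ne.mpr ⟨?_, fun h => hat (h ▸ ha)⟩
          exact (Finset.erase_subset _ _).trans (Finset.erase_subset _ _)
        have T := hG.tendsto_splitDiff hh hh2 w hba.symm hat hbt
          (hl.mono (by rw [hs]; exact Finset.subset_insert _ _)) (ih t hts) he
        rw [← hs] at T
        have hm : Tendsto (fun w => w - (p + q * τ)) (𝓝[≠] z₀) (𝓝[≠] (l b + e * h)) := by
          refine tendsto_nhdsWithin_of_tendsto_nhds_of_eventually_within _ ?_ ?_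
          · have : Tendsto (fun w => w - (p + q * τ)) (𝓝 z₀) (𝓝 (z₀ - (p + q * τ))) :=
              Continuous.tendsto (by fun_prop) _
            rw [show z₀ - (p + q * τ) = l b + e * h by linear_combination hpq] at this
            exact this.mono_left (nhdsWithin_le_nhds)
          · filter_upwards [self_mem_nhdsWithin] with w hw h
            refine hw ?_
            simp only [Set.mem_singleton_iff] at h ⊢
            linear_combination h - hpq
        refine (T.comp hm).congr fun y => ?_
        simp only [Function.comp_apply]
        rw [← periodic_add_lattice (f := fun z => splitDiff G w s (Function.update l a z)) p1 p2 (y - (p + q * τ)) p q, sub_add_cancel]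
        congr 1
        linear_combination hpq
      · push Not at hp
        have hd := hdiff z₀ fun k hk => by
          refine ⟨?_, ?_, ?_⟩
          · simpa using hp k hk 0 (by simp)
          · simpa [sub_sub] using hp k hk 1 (by simp)
          · have := hp k hk (-1) (by simp)
            rwa [show z₀ - (l k + ((-1 : ℤ) : ℂ) * h) = z₀ - l k + h by push_cast; ring] at this
        have h1 : Tendsto (fun z : ℂ => (z - z₀) * splitDiff G w s (Function.update l a z)) (𝓝 z₀)
            (𝓝 ((z₀ - z₀) * splitDiff G w s (Function.update l a z₀))) :=
          Tendsto.mul (Continuous.tendsto (by fun_prop) _) hd.continuousAt.tendsto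
        rw [sub_self, zero_mul] at h1
        exact h1.mono_left nhdsWithin_le_nhds)
  have e1 := hc z (hdiff z fun k hk => by
    have h1 := hz.ne_zero ha hk
    rwa [Function.update_self, Function.update_of_ne (Finset.ne_of_mem_erase hk)] at h1).continuousAt
  have e2 := hc (l a) (hdiff (l a) fun k hk => hl.ne_zero ha hk).continuousAt
  rw [Function.update_eq_self] at e2
  rw [e1, e2]

theorem IsSplitKernel.splitDiff_piecewise {τ h ρ : ℂ} (hτ : 0 < τ.im) {G : ℂ → ℂ}
    (hG : IsSplitKernel τ h ρ G) (hh : theta τ h ≠ 0) (hh2 : theta τ (2 * h) ≠ 0)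
    (w : ℕ → ℂ) {s : Finset (Fin n)}
    (ih : ∀ t ⊂ s, ∀ l, IsGeneric τ h t l → ∀ w, splitSum G w t l = splitSum (fun z => G (-z)) w t l)
    {l ν : Fin n → ℂ} (hl : ∀ t ⊆ s, IsGeneric τ h s (t.piecewise ν l)) :
    ∀ t ⊆ s, splitDiff G w s (t.piecewise ν l) = splitDiff G w s l := by
  intro t
  induction t using Finset.induction_on with
  | empty => intro _; simp
  | insert a t hat iht =>
    intro hts
    have hta := (Finset.subset_insert a t).trans hts
    have h1 := hl t hta
    rw [← iht hta, Finset.piecewise_insert]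
    refine hG.splitDiff_update hτ hh hh2 w h1 (fun t' ht' => ih t' ht' _ (h1.mono ht'.1))
      (hts (Finset.mem_insert_self _ _)) ?_
    rw [← Finset.piecewise_insert]
    exact hl _ hts

/-- Take `ν_i = (i + 1) y`. Each condition on a mixed configuration either is already known or
excludes the zeros in `y` of a theta function with nonconstant affine argument, and such zeros are
isolated. The summand `1` keeps the slope nonzero for the index `0`. -/
theorem exists_isGeneric_piecewise {τ : ℂ} (hτ : 0 < τ.im) (h : ℂ) {s : Finset (Fin n)}
    {l l' : Fin n → ℂ} (hl : IsGeneric τ h s l) (hl' : IsGeneric τ h s l') :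
    ∃ ν : Fin n → ℂ, (∀ t ⊆ s, IsGeneric τ h s (t.piecewise ν l)) ∧
      ∀ t ⊆ s, IsGeneric τ h s (t.piecewise ν l') := by
  have key : ∀ l : Fin n → ℂ, IsGeneric τ h s l → ∀ᶠ y in 𝓝[≠] (0 : ℂ), ∀ t : Finset (Fin n),
      IsGeneric τ h s (t.piecewise (fun i => ((i : ℂ) + 1) * y) l) := by
    intro l hl
    rw [Filter.eventually_all]
    intro t
    unfold IsGeneric
    simp only [Filter.eventually_all_finset, Filter.eventually_all]
    intro i hi j hj hij e he
    have hne : ∀ i : Fin n, ((i : ℂ) + 1) ≠ 0 := fun i => Nat.cast_add_one_ne_zero _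
    by_cases hit : i ∈ t <;> by_cases hjt : j ∈ t
    · have hij' : ((i : ℂ) - j) ≠ 0 := by
        rw [sub_ne_zero]
        exact_mod_cast fun h => hij (Fin.ext h)
      filter_upwards [eventually_theta_affine_ne_zero hτ hij' (-(e * h)) 0] with y hy
      rw [Finset.piecewise_eq_of_mem _ _ _ hit, Finset.piecewise_eq_of_mem _ _ _ hjt]
      rwa [show ((i : ℂ) + 1) * y - (j + 1) * y - e * h = (i - j) * y + -(e * h) by ring]
    · filter_upwards [eventually_theta_affine_ne_zero hτ (hne i) (-l j - e * h) 0] with y hy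
      rw [Finset.piecewise_eq_of_mem _ _ _ hit, Finset.piecewise_eq_of_notMem _ _ _ hjt]
      rwa [show ((i : ℂ) + 1) * y - l j - e * h = (i + 1) * y + (-l j - e * h) by ring]
    · filter_upwards [eventually_theta_affine_ne_zero hτ (neg_ne_zero.mpr (hne j)) (l i - e * h) 0]
        with y hy
      rw [Finset.piecewise_eq_of_notMem _ _ _ hit, Finset.piecewise_eq_of_mem _ _ _ hjt]
      rwa [show l i - ((j : ℂ) + 1) * y - e * h = -(j + 1) * y + (l i - e * h) by ring]
    · refine Eventually.of_forall fun y => ?_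
      rw [Finset.piecewise_eq_of_notMem _ _ _ hit, Finset.piecewise_eq_of_notMem _ _ _ hjt]
      exact hl i hi j hj hij e he
  obtain ⟨y, h1, h2⟩ := ((key l hl).and (key l' hl')).exists
  exact ⟨_, fun t _ => h1 t, fun t _ => h2 t⟩

/-- Both `l` and `-l` can be moved to the same `ν`, one coordinate at a time, without changing
`splitDiff`. As `splitDiff` is odd, it equals its own negative. All weights are treated together
because taking residues shifts the weight. -/
theorem IsSplitKernel.splitSum_eq {τ h ρ : ℂ} (hτ : 0 < τ.im) {G : ℂ → ℂ}
    (hG : IsSplitKernel τ h ρ G) (hh : theta τ h ≠ 0) (hh2 : theta τ (2 * h) ≠ 0)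
    (s : Finset (Fin n)) : ∀ l, IsGeneric τ h s l → ∀ w : ℕ → ℂ,
    splitSum G w s l = splitSum (fun z => G (-z)) w s l := by
  induction s using Finset.strongInduction with
  | H s ih =>
    intro l hl w
    obtain ⟨ν, h1, h2⟩ := exists_isGeneric_piecewise hτ h hl hl.neg
    have e1 := hG.splitDiff_piecewise hτ hh hh2 w ih h1 s subset_rfl
    have e2 := hG.splitDiff_piecewise hτ hh hh2 w ih h2 s subset_rfl
    have e3 : splitDiff G w s (s.piecewise ν l) = splitDiff G w s (s.piecewise ν fun i => -l i) := by
      unfold splitDiff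
      have : ∀ i ∈ s, s.piecewise ν l i = s.piecewise ν (fun i => -l i) i := fun i hi => by
        rw [Finset.piecewise_eq_of_mem _ _ _ hi, Finset.piecewise_eq_of_mem _ _ _ hi]
      rw [splitSum_congr G w this, splitSum_congr _ w this]
    rw [e1, e2, splitDiff_neg] at e3
    exact sub_eq_zero.mp (self_eq_neg.mp e3)

end Split

/-! ### Commuting difference operators -/

/-- The product `g(w) g(ħ - w)`, with `g(w) = θ(γ + w) / θ(w)`. -/
def splitKernel (τ γ h w : ℂ) : ℂ :=
  theta τ (γ + w) / theta τ w * (theta τ (γ + (h - w)) / theta τ (h - w))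

theorem theta_div_theta_add_one (τ γ w : ℂ) :
    theta τ (γ + (w + 1)) / theta τ (w + 1) = theta τ (γ + w) / theta τ w := by
  rw [← add_assoc, theta_add_one, theta_add_one, neg_div_neg_eq]

theorem theta_div_theta_add_tau (τ γ w : ℂ) :
    theta τ (γ + (w + τ)) / theta τ (w + τ) =
      cexp (-(2 * Real.pi * I * γ)) * (theta τ (γ + w) / theta τ w) := by
  rw [← add_assoc, theta_add_tau, theta_add_tau,
    show -(Real.pi * I * (τ + 2 * (γ + w))) =
      -(2 * Real.pi * I * γ) + -(Real.pi * I * (τ + 2 * w)) by ring, Complex.exp_add,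
    neg_mul, neg_mul, neg_div_neg_eq, mul_assoc, mul_div_assoc,
    mul_div_mul_left _ _ (Complex.exp_ne_zero _)]

/-- Under `w ↦ w + τ` the two factors acquire inverse multipliers `exp(∓2πiγ)`, so the product is
elliptic although neither factor is. -/
theorem isSplitKernel_splitKernel {τ : ℂ} (hτ : 0 < τ.im) (γ h : ℂ) (hh : theta τ h ≠ 0) :
    IsSplitKernel τ h ((deriv (theta τ) 0)⁻¹ * (theta τ (γ + 0) *
      (theta τ (γ + (h - 0)) / theta τ (h - 0)))) (splitKernel τ γ h) where
  add_one w := by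
    have h1 := theta_div_theta_add_one τ γ w
    have h2 := theta_div_theta_add_one τ γ (h - (w + 1))
    rw [show h - (w + 1) + 1 = h - w by ring] at h2
    rw [splitKernel, splitKernel, h1, h2]
  add_tau w := by
    have h1 := theta_div_theta_add_tau τ γ w
    have h2 := theta_div_theta_add_tau τ γ (h - (w + τ))
    rw [show h - (w + τ) + τ = h - w by ring] at h2
    rw [splitKernel, splitKernel, h1, h2]
    ring
  symm w := by
    rw [splitKernel, splitKernel, sub_sub_cancel, mul_comm]
  diff w h1 h2 := by
    have hd := differentiable_theta hτ
    have h3 : theta τ (h - w) ≠ 0 := by rwa [← neg_sub, theta_neg, neg_ne_zero]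
    have d : ∀ (c s : ℂ), DifferentiableAt ℂ (fun w => theta τ (c + s * w)) w := fun c s =>
      DifferentiableAt.comp w (hd _) (by fun_prop : DifferentiableAt ℂ (fun w => c + s * w) w)
    have d1 := d γ 1
    have d2 := d 0 1
    have d3 := d (γ + h) (-1)
    have d4 := d h (-1)
    simp only [one_mul, zero_add, neg_mul, ← sub_eq_add_neg, add_sub_assoc] at d1 d2 d3 d4
    exact (d1.div d2 h1).mul (d3.div d4 h3)
  residue := by
    have hd := differentiable_theta hτ
    have h0 := deriv_theta_zero_ne_zero hτ
    have s1 : Tendsto (fun w => w⁻¹ * theta τ w) (𝓝[≠] 0) (𝓝 (deriv (theta τ) 0)) := by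
      have := (hd 0).hasDerivAt.tendsto_slope_zero
      simpa [theta_zero] using this
    have c : ∀ (c s : ℂ), Tendsto (fun w => theta τ (c + s * w)) (𝓝[≠] 0)
        (𝓝 (theta τ (c + s * 0))) := fun c s =>
      ((hd.continuous.comp (by fun_prop : Continuous fun w => c + s * w)).tendsto 0).mono_left
        nhdsWithin_le_nhds
    have c1 := c γ 1
    have c3 := c (γ + h) (-1)
    have c4 := c h (-1)
    simp only [one_mul, neg_mul, ← sub_eq_add_neg, add_sub_assoc] at c1 c3 c4
    have := (s1.inv₀ h0).mul (c1.mul (c3.div c4 (by simpa using hh)))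
    refine this.congr fun w => ?_
    rw [splitKernel, mul_inv, inv_inv]
    simp only [Pi.div_apply]
    ring

theorem splitSum_compl {n : ℕ} (G : ℂ → ℂ) (w : ℕ → ℂ) (s : Finset (Fin n)) (l : Fin n → ℂ) :
    splitSum G (fun m => w (s.card - m)) s l = splitSum (fun z => G (-z)) w s l := by
  unfold splitSum
  refine Finset.sum_nbij' (fun P => s \ P) (fun P => s \ P) ?_ ?_ ?_ ?_ ?_
  · intro P _; simp
  · intro P _; simp
  · intro P hP; simp [Finset.inter_eq_right.mpr (Finset.mem_powerset.mp hP)]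
  · intro P hP; simp [Finset.inter_eq_right.mpr (Finset.mem_powerset.mp hP)]
  · intro P hP
    have hPs := Finset.mem_powerset.mp hP
    simp only [Finset.card_sdiff_of_subset hPs, Finset.sdiff_sdiff_eq_self hPs, neg_sub]
    rw [Finset.prod_comm]

section Shift

variable {n : ℕ} {S : Submodule ℂ (Fin n → ℂ)}

/-- The directions behave under differences of coordinates like the standard basis. -/
def IsDirections (e : Fin n → S) : Prop :=
  ∀ i k l, (e i).1 k - (e i).1 l = (if i = k then 1 else 0) - if i = l then 1 else 0

theorem Realization.isDirections_dir (r : Realization) : IsDirections (r.dir n) := by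
  intro i k l
  cases r <;> simp [Realization.dir, Pi.single_apply, eq_comm]

theorem IsDirections.sum_sub {e : Fin n → S} (he : IsDirections e) (I : Finset (Fin n))
    (k l : Fin n) : (∑ i ∈ I, e i).1 k - (∑ i ∈ I, e i).1 l =
      (if k ∈ I then 1 else 0) - if l ∈ I then 1 else 0 := by
  have h1 : ∀ k, (∑ i ∈ I, e i).1 k = ∑ i ∈ I, (e i).1 k := fun k => by
    rw [Submodule.coe_sum, Finset.sum_apply]
  rw [h1, h1, ← Finset.sum_sub_distrib, Finset.sum_congr rfl fun i _ => he i k l,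
    Finset.sum_sub_distrib]
  simp

/-- The coefficient `∏_{i ∈ I, k ∉ I} θ(γ + λ_k - λ_i) / θ(λ_k - λ_i)`. -/
def shiftCoeff (τ γ : ℂ) (I : Finset (Fin n)) (x : S) : ℂ :=
  ∏ i ∈ I, ∏ k ∈ Iᶜ, theta τ (γ + (x.1 k - x.1 i)) / theta τ (x.1 k - x.1 i)

/-- The weighted sum over all `I` of the difference operators with coefficients
`shiftCoeff` and shifts `∏_{i ∈ I} T_i`. -/
def shiftSum (e : Fin n → S) (τ γ h : ℂ) (w : ℕ → ℂ) (f : S → ℂ) (x : S) : ℂ :=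
  ∑ I : Finset (Fin n), w I.card * shiftCoeff τ γ I x * f (x + h • ∑ i ∈ I, e i)

/-- For two index sets with intersection `C` and symmetric difference `K`, only the last product
depends on how `K` is distributed. Its second factor arises because the first shift moves the
coordinates in `P` but not those in `K \ P`; between `C` and `K` the shifts cancel. -/
theorem IsDirections.shiftCoeff_mul {e : Fin n → S} (he : IsDirections e) (τ γ h : ℂ) (x : S)
    {C K P : Finset (Fin n)} (hCK : Disjoint C K) (hP : P ⊆ K) :
    shiftCoeff τ γ (C ∪ P) x *
      shiftCoeff τ γ (C ∪ (K \ P)) (x + h • ∑ i ∈ C ∪ P, e i) =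
    (∏ i ∈ C, ∏ k ∈ K, theta τ (γ + (x.1 k - x.1 i)) / theta τ (x.1 k - x.1 i)) *
      (∏ i ∈ C, ∏ k ∈ (C ∪ K)ᶜ, (theta τ (γ + (x.1 k - x.1 i)) / theta τ (x.1 k - x.1 i) *
        (theta τ (γ + (x.1 k - x.1 i - h)) / theta τ (x.1 k - x.1 i - h)))) *
      (∏ i ∈ K, ∏ k ∈ (C ∪ K)ᶜ, theta τ (γ + (x.1 k - x.1 i)) / theta τ (x.1 k - x.1 i)) *
      ∏ i ∈ P, ∏ k ∈ K \ P, splitKernel τ γ h (x.1 k - x.1 i) := by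
  set g : ℂ → ℂ := fun w => theta τ (γ + w) / theta τ w with hg
  set D := (C ∪ K)ᶜ with hD
  have hCP : Disjoint C P := hCK.mono_right hP
  have hCQ : Disjoint C (K \ P) := hCK.mono_right Finset.sdiff_subset
  have hPQ : Disjoint P (K \ P) := Finset.disjoint_sdiff
  have hPD : Disjoint P D :=
    disjoint_compl_right.mono_left (hP.trans Finset.subset_union_right)
  have hQD : Disjoint (K \ P) D :=
    disjoint_compl_right.mono_left (Finset.sdiff_subset.trans Finset.subset_union_right)
  have c1 : (C ∪ P)ᶜ = (K \ P) ∪ D := by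
    ext i
    have := @hP i
    have := fun hi => Finset.disjoint_left.mp hCK (show i ∈ C from hi)
    simp only [hD, Finset.mem_compl, Finset.mem_union, Finset.mem_sdiff]
    tauto
  have c2 : (C ∪ (K \ P))ᶜ = P ∪ D := by
    ext i
    have := @hP i
    have := fun hi => Finset.disjoint_left.mp hCK (show i ∈ C from hi)
    simp only [hD, Finset.mem_compl, Finset.mem_union, Finset.mem_sdiff]
    tauto
  have hy : ∀ k i, (x + h • ∑ i ∈ C ∪ P, e i).1 k - (x + h • ∑ i ∈ C ∪ P, e i).1 i =
      x.1 k - x.1 i + h * ((if k ∈ C ∪ P then 1 else 0) - if i ∈ C ∪ P then 1 else 0) := by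
    intro k i
    rw [← he.sum_sub]
    simp only [Submodule.coe_add, Submodule.coe_smul, Pi.add_apply, Pi.smul_apply, smul_eq_mul]
    ring
  have mC : ∀ i ∈ C, (if i ∈ C ∪ P then (1 : ℂ) else 0) = 1 := fun i hi =>
    if_pos (Finset.mem_union_left _ hi)
  have mP : ∀ i ∈ P, (if i ∈ C ∪ P then (1 : ℂ) else 0) = 1 := fun i hi =>
    if_pos (Finset.mem_union_right _ hi)
  have mQ : ∀ i ∈ K \ P, (if i ∈ C ∪ P then (1 : ℂ) else 0) = 0 := fun i hi => by
    rw [if_neg]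
    rw [← Finset.mem_compl, c1]
    exact Finset.mem_union_left _ hi
  have mD : ∀ i ∈ D, (if i ∈ C ∪ P then (1 : ℂ) else 0) = 0 := fun i hi => by
    rw [if_neg]
    rw [← Finset.mem_compl, c1]
    exact Finset.mem_union_right _ hi
  have hA : shiftCoeff τ γ (C ∪ P) x =
      ((∏ i ∈ C, ∏ k ∈ K \ P, g (x.1 k - x.1 i)) * ∏ i ∈ C, ∏ k ∈ D, g (x.1 k - x.1 i)) *
      ((∏ i ∈ P, ∏ k ∈ K \ P, g (x.1 k - x.1 i)) * ∏ i ∈ P, ∏ k ∈ D, g (x.1 k - x.1 i)) := by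
    rw [shiftCoeff, c1, Finset.prod_union hCP]
    simp only [Finset.prod_union hQD, Finset.prod_mul_distrib, hg]
  have hB : shiftCoeff τ γ (C ∪ (K \ P)) (x + h • ∑ i ∈ C ∪ P, e i) =
      ((∏ i ∈ C, ∏ k ∈ P, g (x.1 k - x.1 i)) * ∏ i ∈ C, ∏ k ∈ D, g (x.1 k - x.1 i - h)) *
      ((∏ i ∈ K \ P, ∏ k ∈ P, g (h - (x.1 i - x.1 k))) *
        ∏ i ∈ K \ P, ∏ k ∈ D, g (x.1 k - x.1 i)) := by
    rw [shiftCoeff, c2, Finset.prod_union hCQ]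
    simp only [Finset.prod_union hPD, Finset.prod_mul_distrib, hy]
    have e1 : ∏ i ∈ C, ∏ k ∈ P, theta τ (γ + (x.1 k - x.1 i + h * ((if k ∈ C ∪ P then 1 else 0) -
        if i ∈ C ∪ P then 1 else 0))) / theta τ (x.1 k - x.1 i + h * ((if k ∈ C ∪ P then 1 else 0) -
        if i ∈ C ∪ P then 1 else 0)) = ∏ i ∈ C, ∏ k ∈ P, g (x.1 k - x.1 i) :=
      Finset.prod_congr rfl fun i hi => Finset.prod_congr rfl fun k hk => by
        rw [mC i hi, mP k hk, hg, sub_self, mul_zero, add_zero]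
    have e2 : ∏ i ∈ C, ∏ k ∈ D, theta τ (γ + (x.1 k - x.1 i + h * ((if k ∈ C ∪ P then 1 else 0) -
        if i ∈ C ∪ P then 1 else 0))) / theta τ (x.1 k - x.1 i + h * ((if k ∈ C ∪ P then 1 else 0) -
        if i ∈ C ∪ P then 1 else 0)) = ∏ i ∈ C, ∏ k ∈ D, g (x.1 k - x.1 i - h) :=
      Finset.prod_congr rfl fun i hi => Finset.prod_congr rfl fun k hk => by
        rw [mC i hi, mD k hk, hg, zero_sub, mul_neg, mul_one, ← sub_eq_add_neg]
    have e3 : ∏ i ∈ K \ P, ∏ k ∈ P, theta τ (γ + (x.1 k - x.1 i + h * ((if k ∈ C ∪ P then 1 else 0) -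
        if i ∈ C ∪ P then 1 else 0))) / theta τ (x.1 k - x.1 i + h * ((if k ∈ C ∪ P then 1 else 0) -
        if i ∈ C ∪ P then 1 else 0)) = ∏ i ∈ K \ P, ∏ k ∈ P, g (h - (x.1 i - x.1 k)) :=
      Finset.prod_congr rfl fun i hi => Finset.prod_congr rfl fun k hk => by
        rw [mQ i hi, mP k hk, hg, sub_zero, mul_one,
          show x.1 k - x.1 i + h = h - (x.1 i - x.1 k) by ring]
    have e4 : ∏ i ∈ K \ P, ∏ k ∈ D, theta τ (γ + (x.1 k - x.1 i + h * ((if k ∈ C ∪ P then 1 else 0) -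
        if i ∈ C ∪ P then 1 else 0))) / theta τ (x.1 k - x.1 i + h * ((if k ∈ C ∪ P then 1 else 0) -
        if i ∈ C ∪ P then 1 else 0)) = ∏ i ∈ K \ P, ∏ k ∈ D, g (x.1 k - x.1 i) :=
      Finset.prod_congr rfl fun i hi => Finset.prod_congr rfl fun k hk => by
        rw [mQ i hi, mD k hk, hg, sub_zero, mul_zero, add_zero]
    rw [e1, e2, e3, e4]
  have hK1 : ∏ i ∈ C, ∏ k ∈ K, g (x.1 k - x.1 i) =
      (∏ i ∈ C, ∏ k ∈ K \ P, g (x.1 k - x.1 i)) * ∏ i ∈ C, ∏ k ∈ P, g (x.1 k - x.1 i) := by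
    rw [← Finset.prod_mul_distrib]
    exact Finset.prod_congr rfl fun i _ => (Finset.prod_sdiff hP).symm
  have hK2 : ∏ i ∈ K, ∏ k ∈ D, g (x.1 k - x.1 i) =
      (∏ i ∈ K \ P, ∏ k ∈ D, g (x.1 k - x.1 i)) * ∏ i ∈ P, ∏ k ∈ D, g (x.1 k - x.1 i) :=
    (Finset.prod_sdiff hP).symm
  have hG : ∏ i ∈ P, ∏ k ∈ K \ P, splitKernel τ γ h (x.1 k - x.1 i) =
      (∏ i ∈ P, ∏ k ∈ K \ P, g (x.1 k - x.1 i)) *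
        ∏ i ∈ K \ P, ∏ k ∈ P, g (h - (x.1 i - x.1 k)) := by
    rw [Finset.prod_comm (s := K \ P), ← Finset.prod_mul_distrib]
    refine Finset.prod_congr rfl fun i _ => ?_
    rw [← Finset.prod_mul_distrib]
    rfl
  rw [hA, hB, hG]
  change _ = (∏ i ∈ C, ∏ k ∈ K, g (x.1 k - x.1 i)) *
      (∏ i ∈ C, ∏ k ∈ D, (g (x.1 k - x.1 i) * g (x.1 k - x.1 i - h))) *
      (∏ i ∈ K, ∏ k ∈ D, g (x.1 k - x.1 i)) * _
  rw [hK1, hK2]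
  simp only [Finset.prod_mul_distrib]
  ring

theorem sum_pair_eq_sum_split (F : Finset (Fin n) → Finset (Fin n) → ℂ) :
    ∑ I, ∑ J, F I J = ∑ y : Finset (Fin n) × Finset (Fin n),
      if Disjoint y.1 y.2 then ∑ P ∈ y.2.powerset, F (y.1 ∪ P) (y.1 ∪ (y.2 \ P)) else 0 := by
  rw [← Finset.sum_product', Finset.univ_product_univ,
    ← Finset.sum_fiberwise (s := Finset.univ)
      (g := fun p : Finset (Fin n) × Finset (Fin n) => (p.1 ∩ p.2, (p.1 \ p.2) ∪ (p.2 \ p.1)))]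
  refine Finset.sum_congr rfl fun y _ => ?_
  obtain ⟨C, K⟩ := y
  split_ifs with hCK
  · have hCK : Disjoint C K := hCK
    refine Finset.sum_nbij' (fun p => p.1 \ p.2) (fun P => (C ∪ P, C ∪ (K \ P))) ?_ ?_ ?_ ?_ ?_
    · rintro ⟨I, J⟩ h
      simp only [Finset.mem_filter, Finset.mem_univ, true_and, Prod.mk.injEq] at h
      obtain ⟨rfl, rfl⟩ := h
      exact Finset.mem_powerset.mpr Finset.subset_union_left
    · intro P hP
      have hPK := Finset.mem_powerset.mp hP
      simp only [Finset.mem_filter, Finset.mem_univ, true_and, Prod.mk.injEq]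
      constructor <;>
      · ext i
        have := @hPK i
        have := fun hi => Finset.disjoint_left.mp hCK (show i ∈ C from hi)
        simp only [Finset.mem_union, Finset.mem_sdiff, Finset.mem_inter]
        tauto
    · rintro ⟨I, J⟩ h
      simp only [Finset.mem_filter, Finset.mem_univ, true_and, Prod.mk.injEq] at h
      obtain ⟨rfl, rfl⟩ := h
      simp only [Prod.mk.injEq]
      constructor <;>
      · ext i
        simp only [Finset.mem_union, Finset.mem_sdiff, Finset.mem_inter]
        tauto
    · intro P hP
      have hPK := Finset.mem_powerset.mp hP
      ext i
      have := @hPK i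
      have := fun hi => Finset.disjoint_left.mp hCK (show i ∈ C from hi)
      simp only [Finset.mem_union, Finset.mem_sdiff]
      tauto
    · rintro ⟨I, J⟩ h
      simp only [Finset.mem_filter, Finset.mem_univ, true_and, Prod.mk.injEq] at h
      obtain ⟨rfl, rfl⟩ := h
      congr 1
      · ext i
        simp only [Finset.mem_union, Finset.mem_sdiff, Finset.mem_inter]
        tauto
      · ext i
        simp only [Finset.mem_union, Finset.mem_sdiff, Finset.mem_inter]
        tauto
  · refine Finset.sum_eq_zero ?_
    rintro ⟨I, J⟩ h
    simp only [Finset.mem_filter, Finset.mem_univ, true_and, Prod.mk.injEq] at h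
    obtain ⟨rfl, rfl⟩ := h
    refine absurd ?_ hCK
    rw [Finset.disjoint_left]
    intro i
    simp only [Finset.mem_union, Finset.mem_sdiff, Finset.mem_inter]
    tauto

/-- For fixed intersection and symmetric difference, exchanging the two operators replaces the
subset by its complement in the symmetric difference, which reflects the kernel. The symmetry
`splitSum_eq` applies with the product of both weights as its weight. -/
theorem IsDirections.shiftSum_comm {e : Fin n → S} (he : IsDirections e) {τ : ℂ} (hτ : 0 < τ.im)
    (γ : ℂ) {h : ℂ} (hh : theta τ h ≠ 0) (hh2 : theta τ (2 * h) ≠ 0) (w w' : ℕ → ℂ) (f : S → ℂ)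
    {x : S} (hx : IsGeneric τ h Finset.univ x.1) :
    shiftSum e τ γ h w (shiftSum e τ γ h w' f) x = shiftSum e τ γ h w' (shiftSum e τ γ h w f) x := by
  have key : ∀ w w' : ℕ → ℂ, shiftSum e τ γ h w (shiftSum e τ γ h w' f) x =
      ∑ y : Finset (Fin n) × Finset (Fin n),
      if Disjoint y.1 y.2 then
        (∏ i ∈ y.1, ∏ k ∈ y.2, theta τ (γ + (x.1 k - x.1 i)) / theta τ (x.1 k - x.1 i)) *
      (∏ i ∈ y.1, ∏ k ∈ (y.1 ∪ y.2)ᶜ, (theta τ (γ + (x.1 k - x.1 i)) / theta τ (x.1 k - x.1 i) *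
        (theta τ (γ + (x.1 k - x.1 i - h)) / theta τ (x.1 k - x.1 i - h)))) *
      (∏ i ∈ y.2, ∏ k ∈ (y.1 ∪ y.2)ᶜ, theta τ (γ + (x.1 k - x.1 i)) / theta τ (x.1 k - x.1 i)) *
      f (x + h • (2 • ∑ i ∈ y.1, e i + ∑ i ∈ y.2, e i)) *
      splitSum (splitKernel τ γ h) (fun m => w (y.1.card + m) * w' (y.1.card + (y.2.card - m)))
        y.2 x.1 else 0 := by
    intro w w'
    have h1 : shiftSum e τ γ h w (shiftSum e τ γ h w' f) x = ∑ I, ∑ J,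
        (w I.card * w' J.card * (shiftCoeff τ γ I x *
          shiftCoeff τ γ J (x + h • ∑ i ∈ I, e i)) *
          f (x + h • (∑ i ∈ I, e i + ∑ i ∈ J, e i))) := by
      unfold shiftSum
      refine Finset.sum_congr rfl fun I _ => ?_
      rw [Finset.mul_sum]
      refine Finset.sum_congr rfl fun J _ => ?_
      rw [smul_add, add_assoc]
      ring
    rw [h1, sum_pair_eq_sum_split]
    refine Finset.sum_congr rfl fun y _ => ?_
    split_ifs with hCK
    · rw [splitSum, Finset.mul_sum]
      refine Finset.sum_congr rfl fun P hP => ?_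
      have hPK := Finset.mem_powerset.mp hP
      have hsum : ∑ i ∈ y.1 ∪ P, e i + ∑ i ∈ y.1 ∪ (y.2 \ P), e i =
          2 • ∑ i ∈ y.1, e i + ∑ i ∈ y.2, e i := by
        rw [Finset.sum_union (hCK.mono_right hPK),
          Finset.sum_union (hCK.mono_right Finset.sdiff_subset), ← Finset.sum_sdiff hPK]
        abel
      rw [hsum, he.shiftCoeff_mul τ γ h x hCK hPK,
        Finset.card_union_of_disjoint (hCK.mono_right hPK),
        Finset.card_union_of_disjoint (hCK.mono_right Finset.sdiff_subset),
        Finset.card_sdiff_of_subset hPK]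
      ring
    · rfl
  rw [key, key]
  refine Finset.sum_congr rfl fun y _ => ?_
  split_ifs with hCK
  · congr 1
    rw [(isSplitKernel_splitKernel hτ γ h hh).splitSum_eq hτ hh hh2 y.2 x.1
      (hx.mono (Finset.subset_univ _)), ← splitSum_compl]
    unfold splitSum
    refine Finset.sum_congr rfl fun P hP => ?_
    have := Finset.card_le_card (Finset.mem_powerset.mp hP)
    simp only [Nat.sub_sub_self this, mul_comm (w' _)]
  · rfl

end Shift

/-! ### The Frobenius determinant -/

section Frobenius

variable {n : ℕ}

/-- The theta function of degree `n` with value `1` at `λ_j` and `0` at the other `λ_k`. -/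
def lagrange (τ u : ℂ) (l : Fin n → ℂ) (j : Fin n) (z : ℂ) : ℂ :=
  theta τ (u + (l j - z)) / theta τ u *
    ∏ k ∈ Finset.univ.erase j, theta τ (l k - z) / theta τ (l k - l j)

/-- The product `∏_{i<j} θ(λ_i - λ_j)`. -/
def thetaVandermonde (τ : ℂ) (l : Fin n → ℂ) : ℂ :=
  ∏ i, ∏ j ∈ Finset.Ioi i, theta τ (l i - l j)

theorem prod_Ioi_eq_prod_ite (F : Fin n → Fin n → ℂ) :
    ∏ i, ∏ j ∈ Finset.Ioi i, F i j = ∏ i, ∏ j, if i < j then F i j else 1 := by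
  refine Finset.prod_congr rfl fun i _ => ?_
  rw [← Finset.prod_filter]
  refine Finset.prod_congr ?_ fun _ _ => rfl
  ext j
  simp

theorem thetaVandermonde_update (τ : ℂ) (l : Fin n → ℂ) (a : Fin n) :
    ∃ C : ℂ, ∀ y, thetaVandermonde τ (Function.update l a y) =
      C * ∏ k ∈ Finset.univ.erase a, theta τ (l k - y) := by
  refine ⟨(∏ i ∈ Finset.univ.erase a, ∏ j ∈ Finset.univ.erase a,
    if i < j then theta τ (l i - l j) else 1) *
      ∏ j ∈ Finset.univ.erase a, if a < j then -1 else 1, fun y => ?_⟩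
  rw [thetaVandermonde, prod_Ioi_eq_prod_ite, ← Finset.mul_prod_erase _ _ (Finset.mem_univ a),
    ← Finset.mul_prod_erase _ _ (Finset.mem_univ a)]
  have h1 : ∀ i ∈ Finset.univ.erase a, (∏ j, if i < j then
      theta τ (Function.update l a y i - Function.update l a y j) else 1) =
      (if i < a then theta τ (l i - y) else 1) *
        ∏ j ∈ Finset.univ.erase a, if i < j then theta τ (l i - l j) else 1 := by
    intro i hi
    rw [← Finset.mul_prod_erase _ _ (Finset.mem_univ a), Function.update_self,
      Function.update_of_ne (Finset.ne_of_mem_erase hi)]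
    congr 1
    refine Finset.prod_congr rfl fun j hj => ?_
    rw [Function.update_of_ne (Finset.ne_of_mem_erase hj)]
  have h2 : (∏ j ∈ Finset.univ.erase a, if a < j then
      theta τ (Function.update l a y a - Function.update l a y j) else 1) =
      ∏ j ∈ Finset.univ.erase a, if a < j then -theta τ (l j - y) else 1 := by
    refine Finset.prod_congr rfl fun j hj => ?_
    rw [Function.update_self, Function.update_of_ne (Finset.ne_of_mem_erase hj), ← theta_neg, neg_sub]
  rw [Finset.prod_congr rfl h1, h2, Finset.prod_mul_distrib, if_neg (lt_irrefl a), one_mul,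
    mul_comm (∏ i ∈ Finset.univ.erase a, if i < a then _ else _), mul_left_comm, mul_assoc]
  congr 1
  rw [← Finset.prod_mul_distrib, ← Finset.prod_mul_distrib]
  refine Finset.prod_congr rfl fun j hj => ?_
  rcases lt_or_gt_of_ne (Finset.ne_of_mem_erase hj) with h | h
  · simp [h, h.not_gt]
  · simp [h, h.not_gt]

theorem thetaVandermonde_ne_zero {τ : ℂ} {l : Fin n → ℂ}
    (hl : ∀ i j, i ≠ j → theta τ (l i - l j) ≠ 0) : thetaVandermonde τ l ≠ 0 :=
  Finset.prod_ne_zero_iff.mpr fun i _ => Finset.prod_ne_zero_iff.mpr fun j hj =>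
    hl i j (Finset.mem_Ioi.mp hj).ne

theorem thetaVandermonde_update_div {τ : ℂ} {l : Fin n → ℂ}
    (hl : ∀ i j, i ≠ j → theta τ (l i - l j) ≠ 0) (a : Fin n) (y : ℂ) :
    thetaVandermonde τ (Function.update l a y) / thetaVandermonde τ l =
      ∏ k ∈ Finset.univ.erase a, theta τ (l k - y) / theta τ (l k - l a) := by
  obtain ⟨C, hC⟩ := thetaVandermonde_update τ l a
  have h1 := hC (l a)
  rw [Function.update_eq_self] at h1
  have h0 := thetaVandermonde_ne_zero hl
  rw [h1] at h0
  rw [h1, hC, mul_div_mul_left _ _ (left_ne_zero_of_mul h0), Finset.prod_div_distrib]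

theorem lagrange_node {τ u : ℂ} (hu : theta τ u ≠ 0) {l : Fin n → ℂ}
    (hl : ∀ i j, i ≠ j → theta τ (l i - l j) ≠ 0) (i j : Fin n) :
    lagrange τ u l j (l i) = if i = j then 1 else 0 := by
  rw [lagrange]
  split_ifs with h
  · subst h
    rw [sub_self, add_zero, div_self hu, one_mul]
    exact Finset.prod_eq_one fun k hk => div_self (hl k i (Finset.ne_of_mem_erase hk))
  · rw [Finset.prod_eq_zero (Finset.mem_erase.mpr ⟨h, Finset.mem_univ i⟩), mul_zero]
    rw [sub_self, theta_zero, zero_div]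

theorem prod_erase_update (τ : ℂ) (l : Fin n → ℂ) {a j : Fin n} (haj : a ≠ j) (y z z' : ℂ) :
    ∏ k ∈ Finset.univ.erase j,
      theta τ (Function.update l a y k - z) / theta τ (Function.update l a y k - z') =
    theta τ (y - z) / theta τ (y - z') *
      ∏ k ∈ (Finset.univ.erase j).erase a, theta τ (l k - z) / theta τ (l k - z') := by
  rw [← Finset.mul_prod_erase _ _ (Finset.mem_erase.mpr ⟨haj, Finset.mem_univ a⟩),
    Function.update_self]
  congr 1
  refine Finset.prod_congr rfl fun k hk => ?_
  rw [Function.update_of_ne (Finset.ne_of_mem_erase hk)]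

/-- Changing one interpolation point. -/
theorem lagrange_update {τ : ℂ} (hτ : 0 < τ.im) {u : ℂ} (hu : theta τ u ≠ 0) {l : Fin n → ℂ}
    (hl : ∀ i j, i ≠ j → theta τ (l i - l j) ≠ 0) {a : Fin n} {y : ℂ}
    (hy : ∀ i, i ≠ a → theta τ (l i - y) ≠ 0) (hu' : theta τ (u + (l a - y)) ≠ 0)
    (j : Fin n) (z : ℂ) :
    lagrange τ u l j z =
      lagrange τ (u + (l a - y)) (Function.update l a y) a z * lagrange τ u l j y +
        if j = a then 0 else lagrange τ (u + (l a - y)) (Function.update l a y) j z := by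
  have hpa : ∀ z z' : ℂ, ∏ k ∈ Finset.univ.erase a,
      theta τ (Function.update l a y k - z) / theta τ (Function.update l a y k - z') =
      ∏ k ∈ Finset.univ.erase a, theta τ (l k - z) / theta τ (l k - z') := fun z z' =>
    Finset.prod_congr rfl fun k hk => by
      rw [Function.update_of_ne (Finset.ne_of_mem_erase hk)]
  -- Replacing the node `l a` by `y` and `u` by `u + l a - y` preserves the multipliers of theta
  -- functions of degree `n`, so the old basis function expands in the new basis. Its values at the
  -- nodes other than `a` are `0` or `1`.
  by_cases hja : j = a
  · subst hja
    rw [if_pos rfl, add_zero, lagrange, lagrange, lagrange, Function.update_self, hpa,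
      show u + (l j - y) + (y - z) = u + (l j - z) by ring]
    have h1 : (∏ k ∈ Finset.univ.erase j, theta τ (l k - z) / theta τ (l k - y)) *
        ∏ k ∈ Finset.univ.erase j, theta τ (l k - y) / theta τ (l k - l j) =
        ∏ k ∈ Finset.univ.erase j, theta τ (l k - z) / theta τ (l k - l j) := by
      rw [← Finset.prod_mul_distrib]
      refine Finset.prod_congr rfl fun k hk => ?_
      rw [div_mul_div_cancel₀ (hy k (Finset.ne_of_mem_erase hk))]
    rw [← h1]
    field_simp
  · rw [if_neg hja]
    have haj : a ≠ j := fun h => hja h.symm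
    have hp1 : ∀ z z' : ℂ, ∏ k ∈ Finset.univ.erase j, theta τ (l k - z) / theta τ (l k - z') =
        theta τ (l a - z) / theta τ (l a - z') *
          ∏ k ∈ (Finset.univ.erase j).erase a, theta τ (l k - z) / theta τ (l k - z') := fun z z' =>
      (Finset.mul_prod_erase _ _ (Finset.mem_erase.mpr ⟨haj, Finset.mem_univ a⟩)).symm
    have hp2 : ∀ z z' : ℂ, ∏ k ∈ Finset.univ.erase a, theta τ (l k - z) / theta τ (l k - z') =
        theta τ (l j - z) / theta τ (l j - z') *
          ∏ k ∈ (Finset.univ.erase j).erase a, theta τ (l k - z) / theta τ (l k - z') :=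
      fun z z' => by
        rw [Finset.erase_right_comm]
        exact (Finset.mul_prod_erase _ _ (Finset.mem_erase.mpr ⟨hja, Finset.mem_univ j⟩)).symm
    rw [lagrange, lagrange, lagrange, lagrange, Function.update_self, Function.update_of_ne hja,
      hpa, prod_erase_update τ l haj, hp1, hp1, hp2]
    have hq : (∏ k ∈ (Finset.univ.erase j).erase a, theta τ (l k - z) / theta τ (l k - y)) *
        (∏ k ∈ (Finset.univ.erase j).erase a, theta τ (l k - y) / theta τ (l k - l j)) =
        ∏ k ∈ (Finset.univ.erase j).erase a, theta τ (l k - z) / theta τ (l k - l j) := by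
      rw [← Finset.prod_mul_distrib]
      refine Finset.prod_congr rfl fun k hk => ?_
      rw [div_mul_div_cancel₀ (hy k (Finset.ne_of_mem_erase hk))]
    rw [← hq]
    set Q1 := ∏ k ∈ (Finset.univ.erase j).erase a, theta τ (l k - z) / theta τ (l k - y)
    set Q2 := ∏ k ∈ (Finset.univ.erase j).erase a, theta τ (l k - y) / theta τ (l k - l j)
    have n1 := hl a j haj
    have n2 := hy j hja
    have n3 : theta τ (y - l j) = -theta τ (l j - y) := by rw [← theta_neg, neg_sub]
    rw [n3, show u + (l a - y) + (y - z) = u + (l a - z) by ring]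
    -- Half sums and differences are chosen so that the sums and differences in the identity are
    -- exactly the arguments left after clearing denominators.
    have T := theta_three_term hτ (u + (l a + l j - y - z) / 2) ((l a + l j - y - z) / 2)
      ((l a - l j + y - z) / 2) ((l a - l j - y + z) / 2)
    rw [show u + (l a + l j - y - z) / 2 + (l a + l j - y - z) / 2 = u + (l a - y) + (l j - z) by ring,
      show u + (l a + l j - y - z) / 2 - (l a + l j - y - z) / 2 = u by ring,
      show (l a - l j + y - z) / 2 + (l a - l j - y + z) / 2 = l a - l j by ring,
      show (l a - l j + y - z) / 2 - (l a - l j - y + z) / 2 = y - z by ring,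
      show u + (l a + l j - y - z) / 2 + (l a - l j + y - z) / 2 = u + (l a - z) by ring,
      show u + (l a + l j - y - z) / 2 - (l a - l j + y - z) / 2 = u + (l j - y) by ring,
      show (l a - l j - y + z) / 2 + (l a + l j - y - z) / 2 = l a - y by ring,
      show (l a - l j - y + z) / 2 - (l a + l j - y - z) / 2 = -(l j - z) by ring,
      show u + (l a + l j - y - z) / 2 + (l a - l j - y + z) / 2 = u + (l a - y) by ring,
      show u + (l a + l j - y - z) / 2 - (l a - l j - y + z) / 2 = u + (l j - z) by ring,
      show (l a + l j - y - z) / 2 + (l a - l j + y - z) / 2 = l a - z by ring,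
      show (l a + l j - y - z) / 2 - (l a - l j + y - z) / 2 = l j - y by ring, theta_neg] at T
    field_simp
    linear_combination Q1 * Q2 * T

/-- The nodes are moved to the evaluation points one by one. Each move multiplies the determinant by
one entry, and the theta and Vandermonde ratios telescope. The conditions over all subsets keep
every intermediate parameter away from the zeros of theta. -/
theorem det_lagrange {τ : ℂ} (hτ : 0 < τ.im) (μ : Fin n → ℂ)
    (hμ : ∀ i j, i ≠ j → theta τ (μ i - μ j) ≠ 0) (I : Finset (Fin n)) :
    ∀ (u : ℂ) (l : Fin n → ℂ), (∀ t ⊆ I, theta τ (u + ∑ i ∈ t, (l i - μ i)) ≠ 0) →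
      (∀ i j, i ≠ j → theta τ (l i - l j) ≠ 0) → (∀ i j, i ≠ j → theta τ (l i - μ j) ≠ 0) →
      (Matrix.of fun i j => lagrange τ u l j (I.piecewise μ l i)).det =
        theta τ (u + ∑ i ∈ I, (l i - μ i)) / theta τ u *
          (thetaVandermonde τ (I.piecewise μ l) / thetaVandermonde τ l) := by
  induction I using Finset.induction_on with
  | empty =>
    intro u l hu hl _
    have hu0 : theta τ u ≠ 0 := by simpa using hu ∅ subset_rfl
    have : (Matrix.of fun i j => lagrange τ u l j ((∅ : Finset (Fin n)).piecewise μ l i)) = 1 := by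
      ext i j
      rw [Matrix.of_apply, Finset.piecewise_empty, lagrange_node hu0 hl, Matrix.one_apply]
    rw [this, Matrix.det_one, Finset.piecewise_empty, Finset.sum_empty, add_zero, div_self hu0,
      div_self (thetaVandermonde_ne_zero hl), one_mul]
  | insert a I haI ih =>
    intro u l hu hl hlμ
    have hu0 : theta τ u ≠ 0 := by simpa using hu ∅ (Finset.empty_subset _)
    have hu' : theta τ (u + (l a - μ a)) ≠ 0 := by
      simpa using hu {a} (by simp)
    set l' := Function.update l a (μ a) with hl'
    have hla : l' a = μ a := Function.update_self _ _ _
    have hlne : ∀ i, i ≠ a → l' i = l i := fun i hi => Function.update_of_ne hi _ _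
    have hν : (insert a I).piecewise μ l = I.piecewise μ l' := by
      funext i
      by_cases hia : i = a
      · subst hia
        rw [Finset.piecewise_eq_of_mem _ _ _ (Finset.mem_insert_self _ _),
          Finset.piecewise_eq_of_notMem _ _ _ haI, hla]
      · by_cases hiI : i ∈ I
        · rw [Finset.piecewise_eq_of_mem _ _ _ (Finset.mem_insert_of_mem hiI),
            Finset.piecewise_eq_of_mem _ _ _ hiI]
        · rw [Finset.piecewise_eq_of_notMem _ _ _ (by simp [hia, hiI]),
            Finset.piecewise_eq_of_notMem _ _ _ hiI, hlne i hia]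
    have hdist : ∀ i j, i ≠ j → theta τ (l' i - l' j) ≠ 0 := by
      intro i j hij
      by_cases hia : i = a
      · subst hia
        rw [hla, hlne j hij.symm, ← neg_sub, theta_neg, neg_ne_zero]
        exact hlμ j i hij.symm
      · rw [hlne i hia]
        by_cases hja : j = a
        · subst hja
          rw [hla]
          exact hlμ i j hij
        · rw [hlne j hja]
          exact hl i j hij
    have hdist' : ∀ i j, i ≠ j → theta τ (l' i - μ j) ≠ 0 := by
      intro i j hij
      by_cases hia : i = a
      · subst hia
        rw [hla]
        exact hμ i j hij
      · rw [hlne i hia]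
        exact hlμ i j hij
    have hsum : ∀ t ⊆ I, u + (l a - μ a) + ∑ i ∈ t, (l' i - μ i) =
        u + ∑ i ∈ insert a t, (l i - μ i) := by
      intro t ht
      rw [Finset.sum_insert fun h => haI (ht h), ← add_assoc]
      congr 1
      refine Finset.sum_congr rfl fun i hi => ?_
      rw [hlne i fun h => haI (h ▸ ht hi)]
    have IH := ih (u + (l a - μ a)) l' (fun t ht => by
      rw [hsum t ht]
      exact hu _ (Finset.insert_subset_insert a ht)) hdist hdist'
    -- The transition matrix differs from the identity only in row `a`, so its determinant is its
    -- diagonal entry there.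
    have hfac : (Matrix.of fun i j => lagrange τ u l j (I.piecewise μ l' i)) =
        (Matrix.of fun i j => lagrange τ (u + (l a - μ a)) l' j (I.piecewise μ l' i)) *
          (1 : Matrix (Fin n) (Fin n) ℂ).updateRow a (fun j => lagrange τ u l j (μ a)) := by
      ext i j
      rw [Matrix.mul_apply, Matrix.of_apply,
        lagrange_update hτ hu0 hl (fun i hi => hlμ i a hi) hu' j,
        ← Finset.add_sum_erase _ _ (Finset.mem_univ a), Matrix.updateRow_self, Matrix.of_apply]
      congr 1
      have h1 : ∀ k ∈ Finset.univ.erase a, (Matrix.of fun i j => lagrange τ (u + (l a - μ a)) l' j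
          (I.piecewise μ l' i)) i k *
          (1 : Matrix (Fin n) (Fin n) ℂ).updateRow a (fun j => lagrange τ u l j (μ a)) k j =
          if k = j then lagrange τ (u + (l a - μ a)) l' j (I.piecewise μ l' i) else 0 := by
        intro k hk
        rw [Matrix.updateRow_ne (Finset.ne_of_mem_erase hk), Matrix.one_apply, Matrix.of_apply]
        split_ifs with hkj
        · rw [hkj, mul_one]
        · rw [mul_zero]
      rw [Finset.sum_congr rfl h1, Finset.sum_ite_eq']
      by_cases hja : j = a
      · simp [hja]
      · simp [hja, hl']
    have hdet : ((1 : Matrix (Fin n) (Fin n) ℂ).updateRow a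
        (fun j => lagrange τ u l j (μ a))).det = lagrange τ u l a (μ a) := by
      rw [← Matrix.cramer_transpose_apply, Matrix.transpose_one, Matrix.cramer_one]
      rfl
    rw [hν, hfac, Matrix.det_mul, hdet, IH, hsum I subset_rfl, lagrange,
      ← thetaVandermonde_update_div hl a (μ a), ← hl']
    have v1 := thetaVandermonde_ne_zero hl
    have v2 := thetaVandermonde_ne_zero hdist
    field_simp

/-- A pair of indices with both or neither in `I` keeps its difference. For a pair with exactly one
in `I` the ratio does not depend on the order, because theta is odd. -/
theorem prod_div_eq_shiftCoeff {S : Submodule ℂ (Fin n → ℂ)} (τ γ : ℂ) (I : Finset (Fin n)) {x : S}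
    (hx : ∀ i j, i ≠ j → theta τ (x.1 i - x.1 j) ≠ 0) :
    thetaVandermonde τ (I.piecewise (fun i => x.1 i - γ) x.1) / thetaVandermonde τ x.1 =
      shiftCoeff τ γ I x := by
  set μ := I.piecewise (fun i => x.1 i - γ) x.1 with hμ
  have hin : ∀ i ∈ I, μ i = x.1 i - γ := fun i hi => Finset.piecewise_eq_of_mem _ _ _ hi
  have hout : ∀ i ∉ I, μ i = x.1 i := fun i hi => Finset.piecewise_eq_of_notMem _ _ _ hi
  set q : Fin n → Fin n → ℂ := fun i j => theta τ (μ i - μ j) / theta τ (x.1 i - x.1 j) with hq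
  have hsymm : ∀ i j, q j i = q i j := fun i j => by
    simp only [hq]
    rw [← neg_sub (μ i), ← neg_sub (x.1 i), theta_neg, theta_neg, neg_div_neg_eq]
  have h1 : thetaVandermonde τ μ / thetaVandermonde τ x.1 = ∏ i, ∏ j, if i < j then q i j else 1 := by
    rw [thetaVandermonde, thetaVandermonde, ← Finset.prod_div_distrib, ← prod_Ioi_eq_prod_ite]
    exact Finset.prod_congr rfl fun i _ => (Finset.prod_div_distrib _ _).symm
  have h2 : shiftCoeff τ γ I x = ∏ i, ∏ j, if i ∈ I ∧ j ∉ I then q i j else 1 := by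
    rw [shiftCoeff, ← Finset.prod_subset (Finset.subset_univ I)]
    · refine Finset.prod_congr rfl fun i hi => ?_
      rw [← Finset.prod_subset (Finset.subset_univ Iᶜ)]
      · refine Finset.prod_congr rfl fun k hk => ?_
        have hk' := Finset.mem_compl.mp hk
        rw [if_pos ⟨hi, hk'⟩, ← hsymm]
        simp only [hq]
        rw [hin i hi, hout k hk', show x.1 k - (x.1 i - γ) = γ + (x.1 k - x.1 i) by ring]
      · intro k _ hk
        rw [if_neg fun h => hk (Finset.mem_compl.mpr h.2)]
    · intro i _ hi
      exact Finset.prod_eq_one fun k _ => if_neg fun h => hi h.1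
  have h3 : shiftCoeff τ γ I x =
      (∏ i, ∏ j, if i < j ∧ i ∈ I ∧ j ∉ I then q i j else 1) *
        ∏ i, ∏ j, if i < j ∧ j ∈ I ∧ i ∉ I then q i j else 1 := by
    rw [h2, Finset.prod_comm (f := fun i j => if i < j ∧ j ∈ I ∧ i ∉ I then q i j else 1),
      ← Finset.prod_mul_distrib]
    refine Finset.prod_congr rfl fun i _ => ?_
    rw [← Finset.prod_mul_distrib]
    refine Finset.prod_congr rfl fun j _ => ?_
    rw [hsymm i j]
    by_cases h : i ∈ I ∧ j ∉ I
    · have hij : i ≠ j := fun e => h.2 (e ▸ h.1)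
      rcases lt_or_gt_of_ne hij with hlt | hlt
      · simp [h, hlt, hlt.not_gt]
      · simp [h, hlt, hlt.not_gt]
    · simp [h]
  rw [h1, h3, ← Finset.prod_mul_distrib]
  refine Finset.prod_congr rfl fun i _ => ?_
  rw [← Finset.prod_mul_distrib]
  refine Finset.prod_congr rfl fun j _ => ?_
  by_cases hij : i < j
  · have hne := hx i j hij.ne
    by_cases hi : i ∈ I <;> by_cases hj : j ∈ I
    · simp [hij, hi, hj, hq, hin, hne]
    · simp [hij, hi, hj]
    · simp [hij, hi, hj]
    · simp [hij, hi, hj, hq, hout, hne]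
  · simp [hij]

end Frobenius

/-! ### Holomorphic germs and divided differences -/

section Holomorphic

variable {E : Type*} [NormedAddCommGroup E] [NormedSpace ℂ E]

/-- Cauchy's estimate on complex lines; it supplies the dominating bound for differentiating under
the contour integral. -/
theorem norm_fderiv_le_of_bound {f : E → ℂ} {p : E} {r C : ℝ} (hr : 0 < r)
    (hf : ∀ y ∈ Metric.closedBall p r, DifferentiableAt ℂ f y)
    (hC : ∀ y ∈ Metric.closedBall p r, ‖f y‖ ≤ C) : ‖fderiv ℂ f p‖ ≤ C / r := by
  have hC0 : 0 ≤ C := (norm_nonneg _).trans (hC p (Metric.mem_closedBall_self hr.le))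
  refine ContinuousLinearMap.opNorm_le_bound _ (by positivity) fun v => ?_
  by_cases hv : v = 0
  · simp [hv]
  have hv0 : 0 < ‖v‖ := norm_pos_iff.mpr hv
  have hmem : ∀ z ∈ Metric.closedBall (0 : ℂ) (r / ‖v‖), p + z • v ∈ Metric.closedBall p r := by
    intro z hz
    rw [mem_closedBall_zero_iff] at hz
    rw [mem_closedBall_iff_norm, add_sub_cancel_left, norm_smul]
    calc ‖z‖ * ‖v‖ ≤ r / ‖v‖ * ‖v‖ := by gcongr
      _ = r := div_mul_cancel₀ _ hv0.ne'
  have hd : ∀ z ∈ Metric.closedBall (0 : ℂ) (r / ‖v‖),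
      DifferentiableAt ℂ (fun z : ℂ => f (p + z • v)) z := fun z hz =>
    DifferentiableAt.comp z (hf _ (hmem z hz))
      (by fun_prop : DifferentiableAt ℂ (fun z : ℂ => p + z • v) z)
  have h1 := norm_deriv_le_of_forall_mem_sphere_norm_le (c := (0 : ℂ)) (R := r / ‖v‖) (C := C)
    (f := fun z : ℂ => f (p + z • v)) (by positivity)
    (DifferentiableOn.diffContOnCl_ball
      (U := Metric.closedBall (0 : ℂ) (r / ‖v‖))
      (fun z hz => (hd z hz).differentiableWithinAt) subset_rfl)
    (fun z hz => hC _ (hmem z (Metric.sphere_subset_closedBall hz)))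
  have h2 : deriv (fun z : ℂ => f (p + z • v)) 0 = fderiv ℂ f p v := by
    have := (hf p (Metric.mem_closedBall_self hr.le)).lineDeriv_eq_fderiv (v := v)
    rw [← this]
    rfl
  rw [h2] at h1
  calc ‖fderiv ℂ f p v‖ ≤ C / (r / ‖v‖) := h1
    _ = C / r * ‖v‖ := by field_simp

theorem differentiableAt_circleIntegral [FiniteDimensional ℂ E] {Ψ : E × ℂ → ℂ} {r : ℝ}
    (hr : 0 < r) {p₀ : E} {ε : ℝ} (hε : 0 < ε)
    (h : ∀ p ∈ Metric.ball p₀ ε, ∀ ζ ∈ Metric.sphere (0 : ℂ) r, DifferentiableAt ℂ Ψ (p, ζ)) :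
    DifferentiableAt ℂ (fun p => ∮ ζ in C(0, r), Ψ (p, ζ)) p₀ := by
  have : ProperSpace E := FiniteDimensional.proper ℂ E
  borelize E
  have hsub : Metric.closedBall p₀ (ε / 2) ⊆ Metric.ball p₀ ε :=
    Metric.closedBall_subset_ball (by linarith)
  have hK : IsCompact (Metric.closedBall p₀ (ε / 2) ×ˢ Metric.sphere (0 : ℂ) r) :=
    (isCompact_closedBall _ _).prod (isCompact_sphere _ _)
  obtain ⟨C, hC⟩ := hK.exists_bound_of_continuousOn (f := Ψ) fun q hq =>
    (h q.1 (hsub hq.1) q.2 hq.2).continuousAt.continuousWithinAt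
  have hcirc : ∀ t : ℝ, circleMap 0 r t ∈ Metric.sphere (0 : ℂ) r := fun t =>
    circleMap_mem_sphere 0 hr.le t
  have hcont : ∀ p ∈ Metric.ball p₀ ε, Continuous fun t : ℝ =>
      deriv (circleMap 0 r) t • Ψ (p, circleMap 0 r t) := by
    intro p hp
    have c1 : Continuous fun t : ℝ => Ψ (p, circleMap 0 r t) := by
      rw [continuous_iff_continuousAt]
      intro t
      exact ContinuousAt.comp (f := fun t : ℝ => (p, circleMap 0 r t))
        (h p hp _ (hcirc t)).continuousAt (by fun_prop)
    simp only [deriv_circleMap]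
    exact ((continuous_circleMap 0 r).mul continuous_const).smul c1
  have hdp : ∀ p ∈ Metric.ball p₀ ε, ∀ ζ ∈ Metric.sphere (0 : ℂ) r,
      HasFDerivAt (fun p => Ψ (p, ζ)) ((fderiv ℂ Ψ (p, ζ)).comp (ContinuousLinearMap.inl ℂ E ℂ)) p :=
    fun p hp ζ hζ => (h p hp ζ hζ).hasFDerivAt.comp p (hasFDerivAt_prodMk_left p ζ)
  have key := intervalIntegral.hasFDerivAt_integral_of_dominated_of_fderiv_le
    (𝕜 := ℂ) (μ := MeasureTheory.volume) (a := 0) (b := 2 * Real.pi) (x₀ := p₀)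
    (s := Metric.ball p₀ (ε / 4)) (bound := fun _ => r * (C / (ε / 4)))
    (F := fun p t => deriv (circleMap 0 r) t • Ψ (p, circleMap 0 r t))
    (F' := fun p t => deriv (circleMap 0 r) t •
      (fderiv ℂ Ψ (p, circleMap 0 r t)).comp (ContinuousLinearMap.inl ℂ E ℂ))
    (Metric.ball_mem_nhds _ (by positivity))
    (by
      filter_upwards [Metric.ball_mem_nhds p₀ hε] with p hp
      exact (hcont p hp).aestronglyMeasurable)
    ((hcont p₀ (Metric.mem_ball_self hε)).intervalIntegrable _ _)
    (by
      have m1 : Measurable fun t : ℝ => fderiv ℂ Ψ (p₀, circleMap 0 r t) :=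
        (measurable_fderiv ℂ Ψ).comp
          (by fun_prop : Continuous fun t : ℝ => (p₀, circleMap 0 r t)).measurable
      have m2 : MeasureTheory.AEStronglyMeasurable (fun t : ℝ => fderiv ℂ Ψ (p₀, circleMap 0 r t))
          (MeasureTheory.volume.restrict (Set.uIoc 0 (2 * Real.pi))) := by
        have : ProperSpace (E × ℂ →L[ℂ] ℂ) := FiniteDimensional.proper ℂ _
        exact m1.aestronglyMeasurable
      have m3 : Continuous fun A : E × ℂ →L[ℂ] ℂ => A.comp (ContinuousLinearMap.inl ℂ E ℂ) := by
        fun_prop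
      have m4 : Continuous fun t : ℝ => deriv (circleMap 0 r) t := by
        simp only [deriv_circleMap]
        fun_prop
      exact m4.aestronglyMeasurable.smul (m3.comp_aestronglyMeasurable m2))
    (by
      refine Eventually.of_forall fun t _ p hp => ?_
      have hp' : Metric.closedBall p (ε / 4) ⊆ Metric.closedBall p₀ (ε / 2) := by
        refine Metric.closedBall_subset_closedBall' ?_
        have := Metric.mem_ball.mp hp
        linarith
      have hpε : p ∈ Metric.ball p₀ ε := hsub (hp' (Metric.mem_closedBall_self (by positivity)))
      rw [norm_smul]
      have e1 : ‖deriv (circleMap 0 r) t‖ = r := by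
        simp [deriv_circleMap, abs_of_pos hr]
      rw [e1, ← (hdp p hpε _ (hcirc t)).fderiv]
      refine mul_le_mul_of_nonneg_left ?_ hr.le
      refine norm_fderiv_le_of_bound (by positivity) ?_ ?_
      · intro y hy
        exact (hdp y (hsub (hp' hy)) _ (hcirc t)).differentiableAt
      · intro y hy
        exact hC (y, circleMap 0 r t) ⟨hp' hy, hcirc t⟩)
    (by simp)
    (by
      refine Eventually.of_forall fun t _ p hp => ?_
      have hpε : p ∈ Metric.ball p₀ ε :=
        Metric.ball_subset_ball (by linarith) hp
      exact (hdp p hpε _ (hcirc t)).fun_const_smul _)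
  exact key.differentiableAt

/-- The function is holomorphic in a neighbourhood of the point. -/
def HolAt (f : E → ℂ) (x : E) : Prop := ∀ᶠ y in 𝓝 x, DifferentiableAt ℂ f y

/-- The divided difference `(G(ħ, y + ħ v) - G(ħ, y)) / ħ` of a family of functions, extended
by the derivative in the direction `v` to `ħ = 0`. -/
def divDiff (v : E) (G : ℂ × E → ℂ) (p : ℂ × E) : ℂ :=
  if p.1 = 0 then lineDeriv ℂ (fun y => G (0, y)) p.2 v
  else (G (p.1, p.2 + p.1 • v) - G p) / p.1

/-- For `h ≠ 0` this is Cauchy's formula after partial fractions, and for `h = 0` it is Cauchy's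
formula for the derivative. One integral thus covers both cases of `divDiff`. -/
theorem circleIntegral_divDiff {φ : ℂ → ℂ} {R : ℝ} {U : Set ℂ} (hU : IsOpen U)
    (hRU : Metric.closedBall 0 R ⊆ U) (hφ : DifferentiableOn ℂ φ U) {h : ℂ}
    (hh : h ∈ Metric.ball (0 : ℂ) R) :
    (2 * Real.pi * I : ℂ)⁻¹ * (∮ ζ in C(0, R), (ζ * (ζ - h))⁻¹ * φ ζ) =
      if h = 0 then deriv φ 0 else (φ h - φ 0) / h := by
  have hR : 0 < R := Metric.pos_of_mem_ball hh
  split_ifs with h0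
  · subst h0
    have := two_pi_I_inv_smul_circleIntegral_sub_sq_inv_smul_of_differentiable hU hRU hφ
      (Metric.mem_ball_self hR)
    rw [← this]
    simp [sq]
  · have hd := hφ.mono hRU
    have i1 := hd.circleIntegral_sub_inv_smul hh
    have i2 := hd.circleIntegral_sub_inv_smul (Metric.mem_ball_self hR)
    have hcφ : ContinuousOn φ (Metric.sphere 0 R) :=
      hd.continuousOn.mono Metric.sphere_subset_closedBall
    have hne : ∀ w ∈ Metric.ball (0 : ℂ) R, ∀ ζ ∈ Metric.sphere (0 : ℂ) R, ζ - w ≠ 0 :=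
      fun w hw ζ hζ => sub_ne_zero.mpr (Metric.sphere_disjoint_ball.ne_of_mem hζ hw)
    have int : ∀ w ∈ Metric.ball (0 : ℂ) R, CircleIntegrable (fun ζ => (ζ - w)⁻¹ • φ ζ) 0 R :=
      fun w hw => ContinuousOn.circleIntegrable hR.le
        (((by fun_prop : ContinuousOn (fun ζ : ℂ => ζ - w) _).inv₀ (hne w hw)).smul hcφ)
    have e1 : (∮ ζ in C(0, R), (ζ * (ζ - h))⁻¹ * φ ζ) =
        ∮ ζ in C(0, R), h⁻¹ * ((ζ - h)⁻¹ • φ ζ - (ζ - 0)⁻¹ • φ ζ) := by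
      refine circleIntegral.integral_congr hR.le fun ζ hζ => ?_
      have n1 := hne h hh ζ hζ
      have n2 := hne 0 (Metric.mem_ball_self hR) ζ hζ
      rw [sub_zero] at n2
      simp only [smul_eq_mul, sub_zero]
      field_simp
      ring
    rw [e1, circleIntegral.integral_const_mul,
      circleIntegral.integral_sub (int h hh) (int 0 (Metric.mem_ball_self hR)), i1, i2]
    simp only [smul_eq_mul]
    have : (2 * Real.pi * I : ℂ) ≠ 0 := by simp [Real.pi_ne_zero]
    field_simp

/-- The integrand in the contour formula is holomorphic in `(ħ, y)` as long as `ħ` stays inside the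
circle, so the division by `ħ` causes no singularity. -/
theorem HolAt.divDiff [FiniteDimensional ℂ E] {G : ℂ × E → ℂ} {x : E} (hG : HolAt G (0, x))
    (v : E) : HolAt (divDiff v G) (0, x) := by
  obtain ⟨ε, hε, hball⟩ := Metric.eventually_nhds_iff_ball.mp hG
  obtain ⟨R, hR, hRv⟩ : ∃ R : ℝ, 0 < R ∧ R * ‖v‖ < ε / 2 := by
    refine ⟨ε / 4 / (‖v‖ + 1), by positivity, ?_⟩
    have : ε / 4 / (‖v‖ + 1) * ‖v‖ ≤ ε / 4 := by
      rw [div_mul_eq_mul_div, div_le_iff₀ (by positivity)]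
      nlinarith [norm_nonneg v]
    linarith
  set δ := min R (ε / 2) with hδ
  have hδ0 : 0 < δ := by positivity
  have hδR : δ ≤ R := min_le_left _ _
  have hδε : δ ≤ ε / 2 := min_le_right _ _
  have hG' : ∀ p ∈ Metric.ball ((0 : ℂ), x) δ, ∀ ζ : ℂ, ‖ζ‖ * ‖v‖ < ε / 2 →
      DifferentiableAt ℂ G (p.1, p.2 + ζ • v) := by
    intro p hp ζ hζ
    rw [← ball_prod_same] at hp
    refine hball _ ?_
    rw [← ball_prod_same]
    refine ⟨Metric.ball_subset_ball (by linarith) hp.1, ?_⟩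
    have h2 := Metric.mem_ball.mp hp.2
    simp only [Metric.mem_ball]
    calc dist (p.2 + ζ • v) x ≤ dist (p.2 + ζ • v) p.2 + dist p.2 x := dist_triangle _ _ _
      _ = ‖ζ‖ * ‖v‖ + dist p.2 x := by rw [dist_eq_norm, add_sub_cancel_left, norm_smul]
      _ < ε := by linarith
  have hRlt : ∀ ζ ∈ Metric.closedBall (0 : ℂ) R, ‖ζ‖ * ‖v‖ < ε / 2 := fun ζ hζ =>
    (mul_le_mul_of_nonneg_right (mem_closedBall_zero_iff.mp hζ) (norm_nonneg v)).trans_lt hRv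
  have hform : ∀ p ∈ Metric.ball ((0 : ℂ), x) δ, EllipticCM.divDiff v G p =
      (2 * Real.pi * I : ℂ)⁻¹ * ∮ ζ in C(0, R), (ζ * (ζ - p.1))⁻¹ * G (p.1, p.2 + ζ • v) := by
    intro p hp
    have hp1 : p.1 ∈ Metric.ball (0 : ℂ) R := by
      have hp' := hp
      rw [← ball_prod_same] at hp'
      exact Metric.ball_subset_ball hδR hp'.1
    rw [circleIntegral_divDiff (φ := fun ζ => G (p.1, p.2 + ζ • v)) (U := {ζ | ‖ζ‖ * ‖v‖ < ε / 2})
      (isOpen_lt (by fun_prop) (by fun_prop)) hRlt ?_ hp1]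
    · rw [EllipticCM.divDiff]
      split_ifs with h0
      · rw [h0]
        rfl
      · rw [zero_smul, add_zero]
    · intro ζ hζ
      have := DifferentiableAt.comp ζ (hG' p hp ζ hζ)
        (by fun_prop : DifferentiableAt ℂ (fun ζ : ℂ => (p.1, p.2 + ζ • v)) ζ)
      exact this.differentiableWithinAt
  have hopen : ∀ᶠ p in 𝓝 ((0 : ℂ), x), p ∈ Metric.ball ((0 : ℂ), x) δ := Metric.ball_mem_nhds _ hδ0
  filter_upwards [hopen] with p hp
  obtain ⟨η, hη, hηsub⟩ := Metric.isOpen_ball.mem_nhds hp |> Metric.mem_nhds_iff.mp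
  have hdiff : DifferentiableAt ℂ (fun p : ℂ × E => (2 * Real.pi * I : ℂ)⁻¹ *
      ∮ ζ in C(0, R), (fun q : (ℂ × E) × ℂ => (q.2 * (q.2 - q.1.1))⁻¹ *
        G (q.1.1, q.1.2 + q.2 • v)) (p, ζ)) p := by
    refine DifferentiableAt.const_mul ?_ _
    refine differentiableAt_circleIntegral (E := ℂ × E) (Ψ := fun q : (ℂ × E) × ℂ =>
      (q.2 * (q.2 - q.1.1))⁻¹ * G (q.1.1, q.1.2 + q.2 • v)) hR hη ?_
    intro q hq ζ hζ
    have hq' := hηsub hq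
    have hq1 : q.1 ∈ Metric.ball (0 : ℂ) R := by
      rw [← ball_prod_same] at hq'
      exact Metric.ball_subset_ball hδR hq'.1
    have n1 : ζ - q.1 ≠ 0 := sub_ne_zero.mpr (Metric.sphere_disjoint_ball.ne_of_mem hζ hq1)
    have n2 : ζ ≠ 0 := Metric.sphere_disjoint_ball.ne_of_mem hζ (Metric.mem_ball_self hR)
    refine DifferentiableAt.mul ?_ ?_
    · exact DifferentiableAt.inv (by fun_prop) (mul_ne_zero n2 n1)
    · exact DifferentiableAt.comp (q, ζ)
        (hG' q hq' ζ (hRlt ζ (Metric.sphere_subset_closedBall hζ)))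
        (by fun_prop : DifferentiableAt ℂ
          (fun q : (ℂ × E) × ℂ => (q.1.1, q.1.2 + q.2 • v)) (q, ζ))
  refine hdiff.congr_of_eventuallyEq ?_
  filter_upwards [Metric.isOpen_ball.mem_nhds hp] with q hq using hform q hq

end Holomorphic

/-! ### Iterated operators and normally ordered symbols -/

section OpList

variable {n : ℕ} {E : Type*}

/-- The product of the operators `A_i`, `i ∈ J`, in the order of the list. -/
def opList (A : Fin n → (E → ℂ) → E → ℂ) (l : List (Fin n)) (J : Finset (Fin n)) (f : E → ℂ) :
    E → ℂ :=
  l.foldr (fun i g => if i ∈ J then A i g else g) f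

theorem opList_nil (A : Fin n → (E → ℂ) → E → ℂ) (J : Finset (Fin n)) (f : E → ℂ) :
    opList A [] J f = f := rfl

theorem opList_cons (A : Fin n → (E → ℂ) → E → ℂ) (i : Fin n) (l : List (Fin n))
    (J : Finset (Fin n)) (f : E → ℂ) :
    opList A (i :: l) J f = if i ∈ J then A i (opList A l J f) else opList A l J f := rfl

theorem opList_congr (A : Fin n → (E → ℂ) → E → ℂ) (l : List (Fin n)) {J J' : Finset (Fin n)}
    (h : ∀ i ∈ l, i ∈ J ↔ i ∈ J') (f : E → ℂ) : opList A l J f = opList A l J' f := by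
  induction l with
  | nil => rfl
  | cons i l ih =>
    rw [opList_cons, opList_cons, ih fun j hj => h j (List.mem_cons_of_mem _ hj)]
    simp only [h i List.mem_cons_self]

theorem opProd_eq_opList {S : Submodule ℂ (Fin n → ℂ)} (A : Fin n → (S → ℂ) → S → ℂ)
    (J : Finset (Fin n)) (f : S → ℂ) : opProd A J f = opList A (List.finRange n) J f := by
  unfold opProd opMonomial opList
  congr 1
  funext i g
  split_ifs with h <;> simp [h]

/-- The linear functional on polynomials with given values at the monomials. -/
def monomialFun (a : (Fin n →₀ ℕ) → ℂ) : MvPolynomial (Fin n) ℂ →ₗ[ℂ] ℂ :=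
  (MvPolynomial.basisMonomials (Fin n) ℂ).constr ℂ a

theorem monomialFun_monomial (a : (Fin n →₀ ℕ) → ℂ) (m : Fin n →₀ ℕ) (c : ℂ) :
    monomialFun a (MvPolynomial.monomial m c) = c * a m := by
  have h : MvPolynomial.monomial m c = c • MvPolynomial.basisMonomials (Fin n) ℂ m := by
    rw [MvPolynomial.coe_basisMonomials, MvPolynomial.smul_monomial, smul_eq_mul, mul_one]
  rw [h, map_smul, monomialFun, Module.Basis.constr_basis, smul_eq_mul]

theorem monomialFun_apply (a : (Fin n →₀ ℕ) → ℂ) (p : MvPolynomial (Fin n) ℂ) :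
    monomialFun a p = ∑ m ∈ p.support, p.coeff m * a m := by
  conv_lhs => rw [p.as_sum]
  rw [map_sum]
  exact Finset.sum_congr rfl fun m _ => monomialFun_monomial a m _

/-- With `f` and `x` fixed, a normally ordered operator is a linear functional of its symbol
evaluated at `x`. Identities between operators thereby become identities of commutative polynomials
over `ℂ`. -/
theorem normalOp_eq_monomialFun {S : Submodule ℂ (Fin n → ℂ)} (A : Fin n → (S → ℂ) → S → ℂ)
    (p : OpSymbol S) (f : S → ℂ) (x : S) :
    normalOp A p f x = monomialFun (fun m => opMonomial A m f x)
      (MvPolynomial.map (Pi.evalRingHom (fun _ : S => ℂ) x) p) := by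
  rw [normalOp, monomialFun_apply]
  refine (Finset.sum_subset_zero_on_sdiff (MvPolynomial.support_map_subset _ _) ?_ ?_).symm
  · intro m hm
    have := (Finset.mem_sdiff.mp hm).2
    rw [MvPolynomial.notMem_support_iff, MvPolynomial.coeff_map] at this
    rw [show p.coeff m x = 0 from this, zero_mul]
  · intro m _
    rw [MvPolynomial.coeff_map]
    rfl

theorem prod_X_eq_monomial (J : Finset (Fin n)) :
    (∏ i ∈ J, MvPolynomial.X i : MvPolynomial (Fin n) ℂ) =
      MvPolynomial.monomial (∑ i ∈ J, Finsupp.single i 1) 1 := by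
  rw [MvPolynomial.monomial_sum_one]
  rfl

theorem sum_single_apply (J : Finset (Fin n)) (i : Fin n) :
    (∑ j ∈ J, Finsupp.single j 1 : Fin n →₀ ℕ) i = if i ∈ J then 1 else 0 := by
  rw [Finsupp.finsetSum_apply]
  simp [Finsupp.single_apply]

theorem monomialFun_prod_X (a : (Fin n → ℕ) → ℂ) (J : Finset (Fin n)) :
    monomialFun (fun m => a m) (∏ i ∈ J, MvPolynomial.X i) = a fun i => if i ∈ J then 1 else 0 := by
  rw [prod_X_eq_monomial, monomialFun_monomial, one_mul]
  congr 1
  funext i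
  exact sum_single_apply J i

/-- The values of a function at the points `p + ħ ∑ m_i v_i`. -/
def shiftValues [AddCommGroup E] [Module ℂ E] (f : E → ℂ) (h : ℂ) (v : Fin n → E) (p : E)
    (m : Fin n → ℕ) : ℂ :=
  f (p + h • ∑ i, m i • v i)

theorem opMonomial_shift {S : Submodule ℂ (Fin n → ℂ)} (e : Fin n → S) (h : ℂ) (m : Fin n → ℕ)
    (f : S → ℂ) (x : S) : opMonomial (shift e h) m f x = shiftValues f h e x m := by
  have hit : ∀ (i : Fin n) (k : ℕ) (g : S → ℂ) (x : S),
      (shift e h i)^[k] g x = g (x + h • (k • e i)) := by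
    intro i k
    induction k with
    | zero => intro g x; simp
    | succ k ih =>
      intro g x
      rw [Function.iterate_succ_apply, ih, shift, succ_nsmul, smul_add, add_assoc]
  have hl : ∀ (l : List (Fin n)) (x : S), l.foldr (fun i g => (shift e h i)^[m i] g) f x =
      f (x + h • (l.map fun i => m i • e i).sum) := by
    intro l
    induction l with
    | nil => intro x; simp
    | cons i l ih =>
      intro x
      rw [List.foldr_cons, hit, ih, List.map_cons, List.sum_cons, smul_add, add_assoc]
  rw [opMonomial, hl, shiftValues]
  rw [← List.ofFn_eq_map, List.sum_ofFn]

theorem shiftValues_indicator [AddCommGroup E] [Module ℂ E] (f : E → ℂ) (h : ℂ) (v : Fin n → E)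
    (p : E) (J : Finset (Fin n)) :
    shiftValues f h v p (fun i => if i ∈ J then 1 else 0) = f (p + h • ∑ i ∈ J, v i) := by
  rw [shiftValues]
  simp

/-! ### Iterated divided differences and derivatives. -/

variable [NormedAddCommGroup E] [NormedSpace ℂ E]

theorem monomialFun_X_mul (f : E → ℂ) (h : ℂ) (v : Fin n → E) (p : E) (i : Fin n)
    (q : MvPolynomial (Fin n) ℂ) :
    monomialFun (fun m => shiftValues f h v p m) (MvPolynomial.X i * q) =
      monomialFun (fun m => shiftValues f h v (p + h • v i) m) q := by
  induction q using MvPolynomial.induction_on' with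
  | monomial m c =>
    rw [MvPolynomial.X, MvPolynomial.monomial_mul, one_mul, monomialFun_monomial,
      monomialFun_monomial, shiftValues, shiftValues]
    congr 2
    rw [add_assoc, ← smul_add]
    congr 2
    simp only [Finsupp.coe_add, Pi.add_apply, add_smul, Finset.sum_add_distrib]
    congr 1
    simp [Finsupp.single_apply, ite_smul]
  | add p q hp hq => rw [mul_add, map_add, map_add, hp, hq]

/-- The symbol of the divided difference. -/
def divDiffSymbol (h : ℂ) (i : Fin n) : MvPolynomial (Fin n) ℂ :=
  MvPolynomial.C h⁻¹ * (MvPolynomial.X i - 1)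

theorem opList_divDiff_eq_monomialFun {h : ℂ} (hh : h ≠ 0) (v : Fin n → E) (G : ℂ × E → ℂ)
    (l : List (Fin n)) (J : Finset (Fin n)) (p : E) :
    opList (fun i => divDiff (v i)) l J G (h, p) =
      monomialFun (fun m => shiftValues (fun y => G (h, y)) h v p m)
        (l.map fun i => if i ∈ J then divDiffSymbol h i else 1).prod := by
  induction l generalizing p with
  | nil =>
    rw [opList_nil, List.map_nil, List.prod_nil, ← MvPolynomial.C_1, MvPolynomial.C_apply,
      monomialFun_monomial]
    simp [shiftValues]
  | cons i l ih =>
    rw [opList_cons, List.map_cons, List.prod_cons]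
    split_ifs with hi
    · rw [divDiff, if_neg hh, ih, ih, divDiffSymbol, mul_assoc, ← MvPolynomial.smul_eq_C_mul,
        map_smul, sub_mul, one_mul, map_sub, monomialFun_X_mul, smul_eq_mul, inv_mul_eq_div]
    · rw [ih, one_mul]

/-- The iterated divided difference in the directions `v_i`, `i ∈ J`. -/
def divDiffs (v : Fin n → E) (J : Finset (Fin n)) (G : ℂ × E → ℂ) : ℂ × E → ℂ :=
  opList (fun i => divDiff (v i)) (List.finRange n) J G

/-- The iterated derivative in the directions `v_i`, `i ∈ J`, in the order of the list. -/
def dirDerivs (v : Fin n → E) (l : List (Fin n)) (J : Finset (Fin n)) (f : E → ℂ) : E → ℂ :=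
  opList (fun i g y => lineDeriv ℂ g y (v i)) l J f

theorem divDiffs_eq_monomialFun {h : ℂ} (hh : h ≠ 0) (v : Fin n → E) (G : ℂ × E → ℂ)
    (J : Finset (Fin n)) (p : E) :
    divDiffs v J G (h, p) = monomialFun (fun m => shiftValues (fun y => G (h, y)) h v p m)
      (∏ i ∈ J, divDiffSymbol h i) := by
  rw [divDiffs, opList_divDiff_eq_monomialFun hh, ← List.ofFn_eq_map, List.prod_ofFn]
  congr 1
  rw [Finset.prod_ite_mem, Finset.univ_inter]

theorem divDiffs_zero (v : Fin n → E) (J : Finset (Fin n)) (G : ℂ × E → ℂ) (y : E) :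
    divDiffs v J G (0, y) = dirDerivs v (List.finRange n) J (fun y => G (0, y)) y := by
  unfold divDiffs dirDerivs
  generalize List.finRange n = l
  induction l generalizing y with
  | nil => rfl
  | cons i l ih =>
    rw [opList_cons, opList_cons]
    split_ifs with hi
    · rw [divDiff, if_pos rfl]
      simp only [ih]
    · exact ih y

theorem HolAt.divDiffs [FiniteDimensional ℂ E] {G : ℂ × E → ℂ} {x : E} (hG : HolAt G (0, x))
    (v : Fin n → E) (J : Finset (Fin n)) : HolAt (divDiffs v J G) (0, x) := by
  unfold EllipticCM.divDiffs
  generalize List.finRange n = l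
  induction l with
  | nil => exact hG
  | cons i l ih =>
    rw [opList_cons]
    split_ifs with hi
    · exact ih.divDiff _
    · exact ih

theorem HolAt.comp {E' : Type*} [NormedAddCommGroup E'] [NormedSpace ℂ E'] {f : E' → ℂ} {g : E → E'}
    {x : E} (hf : HolAt f (g x)) (hg : Differentiable ℂ g) : HolAt (fun y => f (g y)) x := by
  filter_upwards [hg.continuous.continuousAt.eventually hf] with y hy
  exact DifferentiableAt.comp y hy (hg y)

theorem HolAt.mul {f g : E → ℂ} {x : E} (hf : HolAt f x) (hg : HolAt g x) :
    HolAt (fun y => f y * g y) x := by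
  filter_upwards [hf, hg] with y h1 h2 using h1.mul h2

theorem HolAt.div {f g : E → ℂ} {x : E} (hf : HolAt f x) (hg : HolAt g x) (h0 : g x ≠ 0) :
    HolAt (fun y => f y / g y) x := by
  have hc : ContinuousAt g x := (hg.self_of_nhds).continuousAt
  filter_upwards [hf, hg, hc.eventually_ne h0] with y h1 h2 h3
  simp only [div_eq_mul_inv]
  exact h1.mul (h2.inv h3)

theorem HolAt.sum {ι : Type*} {s : Finset ι} {f : ι → E → ℂ} {x : E}
    (hf : ∀ i ∈ s, HolAt (f i) x) : HolAt (fun y => ∑ i ∈ s, f i y) x := by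
  have : ∀ᶠ y in 𝓝 x, ∀ i ∈ s, DifferentiableAt ℂ (f i) y :=
    (Filter.eventually_all_finset s).mpr hf
  filter_upwards [this] with y hy
  exact DifferentiableAt.fun_sum hy

theorem HolAt.const (c : ℂ) (x : E) : HolAt (fun _ => c) x :=
  Eventually.of_forall fun _ => differentiableAt_const c

theorem HolAt.congr {f g : E → ℂ} {x : E} (hf : HolAt f x) (h : g =ᶠ[𝓝 x] f) : HolAt g x := by
  filter_upwards [hf, h.eventuallyEq_nhds] with y h1 h2 using h1.congr_of_eventuallyEq h2

/-- The derivatives of a holomorphic function are holomorphic. -/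
theorem HolAt.dirDerivs [FiniteDimensional ℂ E] {f : E → ℂ} {x : E} (hf : HolAt f x)
    (v : Fin n → E) (l : List (Fin n)) (J : Finset (Fin n)) : HolAt (dirDerivs v l J f) x := by
  unfold EllipticCM.dirDerivs
  induction l with
  | nil => exact hf
  | cons i l ih =>
    rw [opList_cons]
    split_ifs with hi
    -- The directional derivative is the slice `ħ = 0` of the divided difference of a family
    -- constant in `ħ`.
    · have h1 : HolAt (fun p : ℂ × E => opList (fun i g y => lineDeriv ℂ g y (v i)) l J f p.2) (0, x) :=
        HolAt.comp (g := Prod.snd) ih differentiable_snd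
      have h2 := h1.divDiff (v i)
      have h3 := HolAt.comp (g := fun y : E => ((0 : ℂ), y)) h2 (by fun_prop)
      refine h3.congr (Eventually.of_forall fun y => ?_)
      simp only [EllipticCM.divDiff, if_true]
    · exact ih

theorem dirDerivs_congr {f g : E → ℂ} {x : E} (h : f =ᶠ[𝓝 x] g) (v : Fin n → E)
    (l : List (Fin n)) (J : Finset (Fin n)) : dirDerivs v l J f =ᶠ[𝓝 x] dirDerivs v l J g := by
  unfold dirDerivs
  induction l with
  | nil => exact h
  | cons i l ih =>
    rw [opList_cons, opList_cons]
    split_ifs with hi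
    · filter_upwards [ih.eventuallyEq_nhds] with y hy
      exact hy.lineDeriv_eq
    · exact ih

theorem tendsto_divDiffs [FiniteDimensional ℂ E] {f : E → ℂ} {x : E} (hf : HolAt f x)
    (v : Fin n → E) (J : Finset (Fin n)) :
    Tendsto (fun h : ℂ => divDiffs v J (fun p => f p.2) (h, x)) (𝓝 0)
      (𝓝 (dirDerivs v (List.finRange n) J f x)) := by
  have h1 : HolAt (fun p : ℂ × E => f p.2) (0, x) :=
    HolAt.comp (g := Prod.snd) hf differentiable_snd
  have h2 := (h1.divDiffs v J).self_of_nhds.continuousAt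
  have h3 : ContinuousAt (fun h : ℂ => (h, x)) 0 := by fun_prop
  have h4 := ContinuousAt.comp (f := fun h : ℂ => (h, x)) h2 h3
  have h5 := h4.tendsto
  simp only [Function.comp_apply] at h5
  rwa [divDiffs_zero] at h5

end OpList

/-! ### The Leibniz rule -/

section Leibniz

variable {n : ℕ} {E E' : Type*} [NormedAddCommGroup E] [NormedSpace ℂ E]
  [NormedAddCommGroup E'] [NormedSpace ℂ E']

theorem differentiableAt_comp_line {f : E → ℂ} {p : E} (hf : DifferentiableAt ℂ f p) (v : E) :
    DifferentiableAt ℂ (fun t : ℂ => f (p + t • v)) 0 := by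
  refine DifferentiableAt.comp (g := f) (f := fun t : ℂ => p + t • v) 0 ?_ (by fun_prop)
  simpa using hf

theorem lineDeriv_mul_prod {a : E → ℂ} {b : E' → ℂ} {p : E × E'} (ha : DifferentiableAt ℂ a p.1)
    (hb : DifferentiableAt ℂ b p.2) (v : E) (w : E') :
    lineDeriv ℂ (fun p : E × E' => a p.1 * b p.2) p (v, w) =
      lineDeriv ℂ a p.1 v * b p.2 + a p.1 * lineDeriv ℂ b p.2 w := by
  have := deriv_fun_mul (differentiableAt_comp_line ha v) (differentiableAt_comp_line hb w)
  simp only [zero_smul, add_zero] at this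
  exact this

theorem lineDeriv_sum {ι : Type*} {s : Finset ι} {f : ι → E → ℂ} {p : E}
    (hf : ∀ i ∈ s, DifferentiableAt ℂ (f i) p) (v : E) :
    lineDeriv ℂ (fun p => ∑ i ∈ s, f i p) p v = ∑ i ∈ s, lineDeriv ℂ (f i) p v :=
  deriv_fun_sum fun i hi => differentiableAt_comp_line (hf i hi) v

theorem dirDerivs_cons_of_mem {v : Fin n → E} {i : Fin n} {l : List (Fin n)}
    {J : Finset (Fin n)} (hi : i ∈ J) (f : E → ℂ) :
    dirDerivs v (i :: l) J f = fun y => lineDeriv ℂ (dirDerivs v l J f) y (v i) := by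
  rw [dirDerivs, opList_cons, if_pos hi]
  rfl

theorem dirDerivs_cons_of_notMem {v : Fin n → E} {i : Fin n} {l : List (Fin n)}
    {J : Finset (Fin n)} (hi : i ∉ J) (f : E → ℂ) :
    dirDerivs v (i :: l) J f = dirDerivs v l J f := by
  rw [dirDerivs, opList_cons, if_neg hi]
  rfl

theorem dirDerivs_insert_of_notMem {v : Fin n → E} {i : Fin n} {l : List (Fin n)}
    (hi : i ∉ l) (J : Finset (Fin n)) (f : E → ℂ) :
    dirDerivs v l (insert i J) f = dirDerivs v l J f :=
  opList_congr _ _ (fun j hj => by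
    rw [Finset.mem_insert, or_iff_right]
    exact fun h => hi (h ▸ hj)) f

/-- The factors are kept in separate variables so that each may be differentiated in its own
direction; the rule is later evaluated at points whose variables in `S` coincide. -/
theorem dirDerivs_mul [FiniteDimensional ℂ E] [FiniteDimensional ℂ E'] {a : E → ℂ} {b : E' → ℂ}
    {x : E} {y : E'} (ha : HolAt a x) (hb : HolAt b y) (v : Fin n → E) (w : Fin n → E')
    (l : List (Fin n)) (hl : l.Nodup) : ∀ J : Finset (Fin n), J ⊆ l.toFinset →
    dirDerivs (fun i => (v i, w i)) l J (fun p : E × E' => a p.1 * b p.2) =ᶠ[𝓝 (x, y)]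
      fun p => ∑ K ∈ J.powerset, dirDerivs v l K a p.1 * dirDerivs w l (J \ K) b p.2 := by
  induction l with
  | nil =>
    intro J hJ
    have : J = ∅ := Finset.subset_empty.mp (by simpa using hJ)
    subst this
    refine Eventually.of_forall fun p => ?_
    simp [dirDerivs, opList]
  | cons i l ih =>
    obtain ⟨hil, hl⟩ := List.nodup_cons.mp hl
    intro J hJ
    by_cases hi : i ∈ J
    · obtain ⟨J, hiJ, rfl⟩ : ∃ J', i ∉ J' ∧ J = insert i J' :=
        ⟨J.erase i, by simp, (Finset.insert_erase hi).symm⟩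
      have hJl : J ⊆ l.toFinset := fun j hj => by
        have := hJ (Finset.mem_insert_of_mem hj)
        rw [List.toFinset_cons, Finset.mem_insert] at this
        exact this.resolve_left fun h => hiJ (h ▸ hj)
      have hev1 : ∀ᶠ p : E × E' in 𝓝 (x, y), ∀ K ∈ J.powerset,
          DifferentiableAt ℂ (dirDerivs v l K a) p.1 :=
        (Filter.eventually_all_finset _).mpr fun K _ =>
          continuous_fst.continuousAt.eventually (ha.dirDerivs v l K)
      have hev2 : ∀ᶠ p : E × E' in 𝓝 (x, y), ∀ K ∈ J.powerset,
          DifferentiableAt ℂ (dirDerivs w l (J \ K) b) p.2 :=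
        (Filter.eventually_all_finset _).mpr fun K _ =>
          continuous_snd.continuousAt.eventually (hb.dirDerivs w l (J \ K))
      filter_upwards [(ih hl J hJl).eventuallyEq_nhds, hev1, hev2] with p hp h1 h2
      rw [dirDerivs_cons_of_mem hi, dirDerivs_insert_of_notMem hil]
      simp only
      rw [hp.lineDeriv_eq, lineDeriv_sum fun K hK => ?_, Finset.sum_powerset_insert hiJ,
        ← Finset.sum_add_distrib]
      · refine Finset.sum_congr rfl fun K hK => ?_
        have hiK : i ∉ K := fun h => hiJ (Finset.mem_powerset.mp hK h)
        have e1 : insert i J \ K = insert i (J \ K) := Finset.insert_sdiff_of_notMem _ hiK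
        have e2 : insert i J \ insert i K = J \ K := by
          ext j
          simp only [Finset.mem_sdiff, Finset.mem_insert]
          grind
        have hiJK : i ∉ J \ K := fun h => hiJ (Finset.mem_sdiff.mp h).1
        rw [lineDeriv_mul_prod (h1 K hK) (h2 K hK), e1, e2,
          dirDerivs_cons_of_notMem hiK, dirDerivs_cons_of_notMem hiJK,
          dirDerivs_cons_of_mem (Finset.mem_insert_self i K),
          dirDerivs_cons_of_mem (Finset.mem_insert_self i (J \ K)),
          dirDerivs_insert_of_notMem hil, dirDerivs_insert_of_notMem hil]
        ring
      · exact (DifferentiableAt.comp p (h1 K hK) differentiableAt_fst).mul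
          (DifferentiableAt.comp p (h2 K hK) differentiableAt_snd)
    · have hJl : J ⊆ l.toFinset := fun j hj => by
        have := hJ hj
        rw [List.toFinset_cons, Finset.mem_insert] at this
        exact this.resolve_left fun h => hi (h ▸ hj)
      filter_upwards [ih hl J hJl] with p hp
      rw [dirDerivs_cons_of_notMem hi, hp]
      refine Finset.sum_congr rfl fun K hK => ?_
      rw [dirDerivs_cons_of_notMem fun h => hi (Finset.mem_powerset.mp hK h),
        dirDerivs_cons_of_notMem fun h => hi (Finset.mem_sdiff.mp h).1]

theorem dirDerivs_finRange_mul [FiniteDimensional ℂ E] [FiniteDimensional ℂ E'] {a : E → ℂ}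
    {b : E' → ℂ} {x : E} {y : E'} (ha : HolAt a x) (hb : HolAt b y) (v : Fin n → E)
    (w : Fin n → E') (J : Finset (Fin n)) :
    dirDerivs (fun i => (v i, w i)) (List.finRange n) J (fun p : E × E' => a p.1 * b p.2)
      =ᶠ[𝓝 (x, y)] fun p => ∑ K ∈ J.powerset,
        dirDerivs v (List.finRange n) K a p.1 * dirDerivs w (List.finRange n) (J \ K) b p.2 :=
  dirDerivs_mul ha hb v w _ (List.nodup_finRange n) J (by simp)

theorem countP_finRange (J : Finset (Fin n)) : (List.finRange n).countP (· ∈ J) = J.card := by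
  rw [List.countP_eq_length_filter, ← List.toFinset_card_of_nodup ((List.nodup_finRange n).filter _)]
  congr 1
  ext i
  simp

theorem dirDerivs_smul (v : Fin n → E) (c : ℂ) (J : Finset (Fin n)) (f : E → ℂ) :
    dirDerivs (fun i => c • v i) (List.finRange n) J f =
      fun y => c ^ J.card * dirDerivs v (List.finRange n) J f y := by
  rw [← countP_finRange]
  generalize List.finRange n = l
  induction l with
  | nil => funext y; simp [dirDerivs, opList]
  | cons i l ih =>
    by_cases hi : i ∈ J
    · rw [dirDerivs_cons_of_mem hi, dirDerivs_cons_of_mem hi, ih,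
        List.countP_cons_of_pos (by simpa using hi)]
      funext y
      rw [lineDeriv_smul, smul_eq_mul, pow_succ']
      unfold lineDeriv
      rw [deriv_const_mul_field]
      ring
    · rw [dirDerivs_cons_of_notMem hi, dirDerivs_cons_of_notMem hi, ih,
        List.countP_cons_of_neg (by simpa using hi)]

theorem dirDerivs_one (J : Finset (Fin n)) (f : ℂ → ℂ) :
    dirDerivs (fun _ : Fin n => (1 : ℂ)) (List.finRange n) J f = iteratedDeriv J.card f := by
  rw [← countP_finRange]
  generalize List.finRange n = l
  induction l with
  | nil => simp [dirDerivs, opList]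
  | cons i l ih =>
    by_cases hi : i ∈ J
    · rw [dirDerivs_cons_of_mem hi, ih, List.countP_cons_of_pos (by simpa using hi),
        iteratedDeriv_succ]
      funext y
      unfold lineDeriv
      simp only [smul_eq_mul, mul_one]
      rw [deriv_comp_const_add, add_zero]
    · rw [dirDerivs_cons_of_notMem hi, ih, List.countP_cons_of_neg (by simpa using hi)]

end Leibniz

/-! ### Sums over subsets -/

section Counting

variable {n : ℕ}

/-- The number of sets with `m` elements that contain a given set with `k` elements. -/
def supersetCount (n m k : ℕ) : ℕ := if k ≤ m then (n - k).choose (m - k) else 0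

theorem card_filter_superset (m : ℕ) (K : Finset (Fin n)) :
    ((Finset.univ.powersetCard m).filter fun I => K ⊆ I).card = supersetCount n m K.card := by
  rw [supersetCount]
  split_ifs with h
  · have hc : n - K.card = Kᶜ.card := by rw [Finset.card_compl, Fintype.card_fin]
    rw [hc, ← Finset.card_powersetCard]
    refine Finset.card_nbij' (fun I => I \ K) (fun I => I ∪ K) ?_ ?_ ?_ ?_
    · intro I hI
      simp only [Finset.coe_filter, Finset.mem_powersetCard, Finset.subset_univ, true_and,
        Set.mem_ofPred_eq] at hI
      simp only [Finset.mem_coe, Finset.mem_powersetCard]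
      refine ⟨fun i hi => Finset.mem_compl.mpr (Finset.mem_sdiff.mp hi).2, ?_⟩
      rw [Finset.card_sdiff_of_subset hI.2, hI.1]
    · intro I hI
      simp only [Finset.mem_coe, Finset.mem_powersetCard] at hI
      simp only [Finset.coe_filter, Finset.mem_powersetCard, Finset.subset_univ, true_and,
        Set.mem_ofPred_eq]
      have hd : Disjoint I K := Finset.disjoint_left.mpr fun i hi => Finset.mem_compl.mp (hI.1 hi)
      refine ⟨?_, Finset.subset_union_right⟩
      rw [Finset.card_union_of_disjoint hd, hI.2]
      omega
    · intro I hI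
      simp only [Finset.coe_filter, Finset.mem_powersetCard, Finset.subset_univ, true_and,
        Set.mem_ofPred_eq] at hI
      exact Finset.sdiff_union_of_subset hI.2
    · intro I hI
      simp only [Finset.mem_coe, Finset.mem_powersetCard] at hI
      have hd : Disjoint I K := Finset.disjoint_left.mpr fun i hi => Finset.mem_compl.mp (hI.1 hi)
      exact Finset.union_sdiff_cancel_right hd
  · rw [Finset.card_eq_zero, Finset.filter_eq_empty_iff]
    intro I hI hK
    have := Finset.card_le_card hK
    rw [(Finset.mem_powersetCard.mp hI).2] at this
    exact h this

theorem sum_powersetCard_sum_powerset (m : ℕ) (F : Finset (Fin n) → ℂ) :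
    ∑ I ∈ Finset.univ.powersetCard m, ∑ K ∈ I.powerset, F K =
      ∑ K, (supersetCount n m K.card : ℂ) * F K := by
  rw [Finset.sum_comm' (t' := Finset.univ)
    (s' := fun K => (Finset.univ.powersetCard m).filter fun I => K ⊆ I)]
  · refine Finset.sum_congr rfl fun K _ => ?_
    rw [Finset.sum_const, card_filter_superset, nsmul_eq_mul]
  · intro I K
    simp

theorem sum_supersetCount {d : ℕ} (hd : d ≤ n) (F : Finset (Fin n) → ℂ) :
    ∑ K, (supersetCount n d K.card : ℂ) * F K =
      ∑ k ∈ Finset.range (d + 1), ((n - d + k).choose k : ℂ) *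
        ∑ K ∈ Finset.univ.powersetCard (d - k), F K := by
  rw [← Finset.powerset_univ, Finset.sum_powerset, Finset.card_univ, Fintype.card_fin,
    ← Finset.sum_subset (Finset.range_subset_range.mpr (show d + 1 ≤ n + 1 by omega)),
    ← Finset.sum_range_reflect]
  · refine Finset.sum_congr rfl fun k hk => ?_
    have hk' := Finset.mem_range.mp hk
    rw [Finset.mul_sum, show d + 1 - 1 - k = d - k by omega]
    refine Finset.sum_congr rfl fun K hK => ?_
    rw [(Finset.mem_powersetCard.mp hK).2, supersetCount, if_pos (by omega),
      show n - (d - k) = n - d + k by omega, show d - (d - k) = k by omega]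
  · intro j _ hj
    refine Finset.sum_eq_zero fun K hK => ?_
    rw [(Finset.mem_powersetCard.mp hK).2, supersetCount, if_neg, Nat.cast_zero, zero_mul]
    rw [Finset.mem_range] at hj
    omega

end Counting

/-! ### The commuting differential operators -/

section Commuting

variable {n : ℕ} {S : Submodule ℂ (Fin n → ℂ)}

theorem differentiable_Delta {τ : ℂ} (hτ : 0 < τ.im) : Differentiable ℂ (Delta S τ) := by
  have hc : ∀ k, Differentiable ℂ fun x : S => x.1 k := fun k =>
    ((ContinuousLinearMap.proj (R := ℂ) (φ := fun _ : Fin n => ℂ) k).comp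
      S.subtypeL).differentiable
  have ht : ∀ i j, Differentiable ℂ fun x : S => theta τ (x.1 i - x.1 j) := fun i j =>
    (differentiable_theta hτ).comp ((hc i).sub (hc j))
  have hprod : ∀ {ι : Type} (s : Finset ι) (g : ι → S → ℂ), (∀ i, Differentiable ℂ (g i)) →
      Differentiable ℂ fun x => ∏ i ∈ s, g i x := by
    classical
    intro ι s g hg
    induction s using Finset.induction_on with
    | empty => simp
    | insert i s hi ih =>
      simp only [Finset.prod_insert hi]
      exact (hg i).mul ih
  exact hprod _ _ fun i => hprod _ _ fun j => ht i j

theorem holAt_Delta {τ : ℂ} (hτ : 0 < τ.im) (x : S) : HolAt (Delta S τ) x :=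
  Eventually.of_forall (differentiable_Delta hτ)

theorem Delta_ne_zero {τ : ℂ} {x : S} (hx : ∀ i j, i ≠ j → theta τ (x.1 i - x.1 j) ≠ 0) :
    Delta S τ x ≠ 0 :=
  thetaVandermonde_ne_zero hx

theorem IsDirections.Delta_shift {e : Fin n → S} (he : IsDirections e) (τ b h : ℂ) (x : S)
    (I : Finset (Fin n)) :
    Delta S τ (x + h • ∑ i ∈ I, b • e i) =
      thetaVandermonde τ (I.piecewise (fun i => x.1 i - -(b * h)) x.1) := by
  unfold Delta thetaVandermonde
  refine Finset.prod_congr rfl fun i _ => Finset.prod_congr rfl fun j _ => ?_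
  congr 1
  have h1 := he.sum_sub I i j
  have h2 : ∀ i, I.piecewise (fun i => x.1 i - -(b * h)) x.1 i =
      x.1 i + b * h * if i ∈ I then 1 else 0 := by
    intro i
    by_cases hi : i ∈ I
    · rw [Finset.piecewise_eq_of_mem _ _ _ hi, if_pos hi]
      ring
    · rw [Finset.piecewise_eq_of_notMem _ _ _ hi, if_neg hi]
      ring
  rw [h2, h2, ← Finset.smul_sum]
  simp only [Submodule.coe_add, Submodule.coe_smul, Pi.add_apply, Pi.smul_apply, smul_eq_mul]
  linear_combination h * b * h1

/-- The coefficients of the commuting difference operators are ratios of shifted values of `Δ`, so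
these operators are pure shifts of a product with `Δ`, divided by `Δ`. -/
theorem IsDirections.Delta_shift_div {e : Fin n → S} (he : IsDirections e) (τ b h : ℂ) {x : S}
    (hx : ∀ i j, i ≠ j → theta τ (x.1 i - x.1 j) ≠ 0) (I : Finset (Fin n)) :
    Delta S τ (x + h • ∑ i ∈ I, b • e i) / Delta S τ x = shiftCoeff τ (-(b * h)) I x := by
  rw [he.Delta_shift, ← prod_div_eq_shiftCoeff τ (-(b * h)) I hx]
  rfl

/-- The operator `∑_{|I| = m} ∑_{J ⊆ I} b^{|J|} (∂^J Δ / Δ) ∂^{I \ J}`. -/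
def cmOp (e : Fin n → S) (τ b : ℂ) (m : ℕ) (f : S → ℂ) (x : S) : ℂ :=
  (∑ I ∈ Finset.univ.powersetCard m, ∑ J ∈ I.powerset,
    dirDerivs (fun i => b • e i) (List.finRange n) J (Delta S τ) x *
      dirDerivs e (List.finRange n) (I \ J) f x) / Delta S τ x

/-- The family of difference operators, parametrized by `ħ`, that extends `cmOp`. -/
def cmFamily (e : Fin n → S) (τ b : ℂ) (m : ℕ) (F : ℂ × S → ℂ) (p : ℂ × S) : ℂ :=
  (∑ I ∈ Finset.univ.powersetCard m, divDiffs (fun i => (b • e i, e i)) I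
    (fun q : ℂ × (S × S) => Delta S τ q.2.1 * F (q.1, q.2.2)) (p.1, (p.2, p.2))) / Delta S τ p.2

theorem cmOp_congr (e : Fin n → S) (τ b : ℂ) (m : ℕ) {f g : S → ℂ} {x : S} (h : f =ᶠ[𝓝 x] g) :
    cmOp e τ b m f x = cmOp e τ b m g x := by
  unfold cmOp
  congr 1
  refine Finset.sum_congr rfl fun I _ => Finset.sum_congr rfl fun J _ => ?_
  rw [(dirDerivs_congr h e _ (I \ J)).self_of_nhds]

theorem HolAt.cmOp {τ : ℂ} (hτ : 0 < τ.im) (e : Fin n → S) (b : ℂ) (m : ℕ) {f : S → ℂ}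
    {x : S} (hf : HolAt f x) (hx : Delta S τ x ≠ 0) : HolAt (cmOp e τ b m f) x := by
  unfold EllipticCM.cmOp
  refine HolAt.div (HolAt.sum fun I _ => HolAt.sum fun J _ => ?_) (holAt_Delta hτ x) hx
  exact ((holAt_Delta hτ x).dirDerivs _ _ _).mul (hf.dirDerivs _ _ _)

theorem HolAt.cmFamily {τ : ℂ} (hτ : 0 < τ.im) (e : Fin n → S) (b : ℂ) (m : ℕ) {F : ℂ × S → ℂ}
    {x : S} (hF : HolAt F (0, x)) (hx : Delta S τ x ≠ 0) : HolAt (cmFamily e τ b m F) (0, x) := by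
  unfold EllipticCM.cmFamily
  have h1 : HolAt (fun q : ℂ × (S × S) => Delta S τ q.2.1 * F (q.1, q.2.2)) (0, (x, x)) := by
    refine HolAt.mul (HolAt.comp (g := fun q : ℂ × (S × S) => q.2.1) (holAt_Delta hτ _) (by fun_prop)) ?_
    exact HolAt.comp (g := fun q : ℂ × (S × S) => (q.1, q.2.2)) (x := (0, (x, x))) hF (by fun_prop)
  refine HolAt.div (HolAt.sum fun I _ => ?_)
    (HolAt.comp (g := fun p : ℂ × S => p.2) (holAt_Delta hτ _) (by fun_prop)) hx
  exact HolAt.comp (g := fun p : ℂ × S => (p.1, (p.2, p.2))) (x := (0, x)) (h1.divDiffs _ I)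
    (by fun_prop)

theorem cmFamily_zero {τ : ℂ} (hτ : 0 < τ.im) (e : Fin n → S) (b : ℂ) (m : ℕ) {F : ℂ × S → ℂ}
    {x : S} (hF : HolAt (fun y => F (0, y)) x) :
    (fun y => cmFamily e τ b m F (0, y)) =ᶠ[𝓝 x] cmOp e τ b m fun y => F (0, y) := by
  have hL : ∀ᶠ y : S in 𝓝 x, ∀ I ∈ (Finset.univ : Finset (Fin n)).powersetCard m,
      dirDerivs (fun i => (b • e i, e i)) (List.finRange n) I
        (fun q : S × S => Delta S τ q.1 * F (0, q.2)) (y, y) =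
      ∑ J ∈ I.powerset, dirDerivs (fun i => b • e i) (List.finRange n) J (Delta S τ) y *
        dirDerivs e (List.finRange n) (I \ J) (fun y => F (0, y)) y := by
    rw [Filter.eventually_all_finset]
    intro I _
    have h1 := dirDerivs_finRange_mul (holAt_Delta hτ x) hF (fun i => b • e i) e I
    have hc : ContinuousAt (fun y : S => (y, y)) x := by fun_prop
    exact hc.eventually h1
  filter_upwards [hL] with y hy
  rw [cmFamily, cmOp]
  congr 1
  refine Finset.sum_congr rfl fun I hI => ?_
  rw [divDiffs_zero, hy I hI]

/-- Inclusion–exclusion: the expansion of `∏ h⁻¹(X_i - 1)`. -/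
theorem divDiffs_eq_sum {E : Type*} [NormedAddCommGroup E] [NormedSpace ℂ E] {h : ℂ} (hh : h ≠ 0)
    (v : Fin n → E) (G : ℂ × E → ℂ) (I : Finset (Fin n)) (p : E) :
    divDiffs v I G (h, p) = ∑ K ∈ I.powerset,
      h⁻¹ ^ I.card * (-1) ^ (I.card - K.card) * G (h, p + h • ∑ i ∈ K, v i) := by
  rw [divDiffs_eq_monomialFun hh]
  have h1 : (∏ i ∈ I, divDiffSymbol h i : MvPolynomial (Fin n) ℂ) =
      ∑ K ∈ I.powerset, (h⁻¹ ^ I.card * (-1) ^ (I.card - K.card)) •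
        ∏ i ∈ K, MvPolynomial.X i := by
    simp only [divDiffSymbol]
    rw [Finset.prod_mul_distrib, Finset.prod_const, ← map_pow]
    simp only [sub_eq_add_neg]
    rw [Finset.prod_add, Finset.mul_sum]
    refine Finset.sum_congr rfl fun K hK => ?_
    rw [Finset.prod_const, Finset.card_sdiff_of_subset (Finset.mem_powerset.mp hK),
      MvPolynomial.smul_eq_C_mul, map_mul, map_pow _ (-1 : ℂ), map_neg, MvPolynomial.C_1]
    ring
  rw [h1, map_sum]
  refine Finset.sum_congr rfl fun K _ => ?_
  rw [map_smul, monomialFun_prod_X, shiftValues_indicator, smul_eq_mul]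

/-- The link between both kinds of operators. The weight of `K` combines the inclusion–exclusion
sign with the number of `m`-element sets containing `K`, so it depends only on the size of `K`, as
`shiftSum` requires. -/
theorem IsDirections.cmFamily_eq_shiftSum {e : Fin n → S} (he : IsDirections e) (τ b : ℂ) (m : ℕ)
    (F : ℂ × S → ℂ) {h : ℂ} (hh : h ≠ 0) {x : S}
    (hx : ∀ i j, i ≠ j → theta τ (x.1 i - x.1 j) ≠ 0) :
    cmFamily e τ b m F (h, x) = shiftSum e τ (-(b * h)) h
      (fun k => h⁻¹ ^ m * (-1) ^ (m - k) * supersetCount n m k) (fun y => F (h, y)) x := by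
  have h1 : ∀ I ∈ (Finset.univ : Finset (Fin n)).powersetCard m,
      divDiffs (fun i => (b • e i, e i)) I
        (fun q : ℂ × (S × S) => Delta S τ q.2.1 * F (q.1, q.2.2)) (h, (x, x)) =
      ∑ K ∈ I.powerset, h⁻¹ ^ m * (-1) ^ (m - K.card) *
        (Delta S τ (x + h • ∑ i ∈ K, b • e i) * F (h, x + h • ∑ i ∈ K, e i)) := by
    intro I hI
    rw [divDiffs_eq_sum hh, (Finset.mem_powersetCard.mp hI).2]
    refine Finset.sum_congr rfl fun K _ => ?_
    have : (∑ i ∈ K, (b • e i, e i) : S × S) = (∑ i ∈ K, b • e i, ∑ i ∈ K, e i) := by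
      rw [Prod.ext_iff, Prod.fst_sum, Prod.snd_sum]
      exact ⟨rfl, rfl⟩
    rw [this]
    rfl
  rw [cmFamily]
  simp only
  rw [Finset.sum_congr rfl h1, sum_powersetCard_sum_powerset, Finset.sum_div, shiftSum]
  refine Finset.sum_congr rfl fun K _ => ?_
  rw [← he.Delta_shift_div τ b h hx K]
  ring

theorem eventually_isGeneric {τ : ℂ} (hτ : 0 < τ.im) {l : Fin n → ℂ}
    (hl : ∀ i j, i ≠ j → theta τ (l i - l j) ≠ 0) :
    ∀ᶠ h in 𝓝 (0 : ℂ), IsGeneric τ h Finset.univ l := by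
  unfold IsGeneric
  simp only [Filter.eventually_all_finset, Filter.eventually_all]
  intro i _ j _ hij e _
  have hc : ContinuousAt (fun h : ℂ => theta τ (l i - l j - e * h)) 0 :=
    ((differentiable_theta hτ).continuous.comp (by fun_prop)).continuousAt
  exact hc.eventually_ne (by simpa using hl i j hij)

/-- For small `ħ ≠ 0` the composed families agree in either order by `shiftSum_comm`. Both are
continuous at `ħ = 0`, where they become the composed differential operators. -/
theorem IsDirections.cmOp_comm {e : Fin n → S} (he : IsDirections e) {τ : ℂ} (hτ : 0 < τ.im)
    (b : ℂ) (m k : ℕ) {f : S → ℂ} {x : S} (hf : HolAt f x)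
    (hx : ∀ i j, i ≠ j → theta τ (x.1 i - x.1 j) ≠ 0) :
    cmOp e τ b m (cmOp e τ b k f) x = cmOp e τ b k (cmOp e τ b m f) x := by
  set F : ℂ × S → ℂ := fun p => f p.2 with hFdef
  have hF : HolAt F (0, x) := HolAt.comp (g := Prod.snd) hf differentiable_snd
  have hΔ := Delta_ne_zero hx
  have hlim : ∀ m k, cmFamily e τ b m (cmFamily e τ b k F) (0, x) =
      cmOp e τ b m (cmOp e τ b k f) x := by
    intro m k
    have h1 := hF.cmFamily hτ e b k hΔ
    have h2 : HolAt (fun y => EllipticCM.cmFamily e τ b k F (0, y)) x :=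
      HolAt.comp (g := fun y : S => ((0 : ℂ), y)) h1 (by fun_prop)
    have h3 := (cmFamily_zero hτ e b m h2).self_of_nhds
    simp only at h3
    rw [h3]
    exact cmOp_congr e τ b m (cmFamily_zero hτ e b k (F := F) hf)
  have hcont : ∀ m k, Tendsto (fun h : ℂ => cmFamily e τ b m (cmFamily e τ b k F) (h, x)) (𝓝[≠] 0)
      (𝓝 (cmOp e τ b m (cmOp e τ b k f) x)) := by
    intro m k
    have h1 := ((hF.cmFamily hτ e b k hΔ).cmFamily hτ e b m hΔ).self_of_nhds.continuousAt
    have h2 := ContinuousAt.comp (f := fun h : ℂ => (h, x)) h1 (by fun_prop)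
    have h3 := h2.tendsto
    simp only [Function.comp_apply, hlim] at h3
    exact h3.mono_left nhdsWithin_le_nhds
  refine tendsto_nhds_unique (hcont m k) ((hcont k m).congr' ?_)
  have g1 : ∀ᶠ h in 𝓝[≠] (0 : ℂ), IsGeneric τ h Finset.univ x.1 :=
    (eventually_isGeneric hτ hx).filter_mono nhdsWithin_le_nhds
  have g2 : ∀ᶠ h in 𝓝[≠] (0 : ℂ), theta τ h ≠ 0 := by
    simpa using eventually_theta_affine_ne_zero hτ one_ne_zero 0 0
  have g3 : ∀ᶠ h in 𝓝[≠] (0 : ℂ), theta τ (2 * h) ≠ 0 := by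
    simpa using eventually_theta_affine_ne_zero hτ two_ne_zero 0 0
  filter_upwards [g1, g2, g3, self_mem_nhdsWithin] with h h1 h2 h3 h0
  have hh : h ≠ 0 := h0
  -- The inner family is evaluated at shifted points, so its difference form is needed there too;
  -- such shifts change coordinate differences by `0` or `±h`.
  have hsh : ∀ (I : Finset (Fin n)) (i j : Fin n), i ≠ j →
      theta τ ((x + h • ∑ i ∈ I, e i).1 i - (x + h • ∑ i ∈ I, e i).1 j) ≠ 0 := by
    intro I i j hij
    have e1 : (x + h • ∑ i ∈ I, e i).1 i - (x + h • ∑ i ∈ I, e i).1 j = x.1 i - x.1 j -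
        (((if j ∈ I then 1 else 0) - if i ∈ I then 1 else 0 : ℤ) : ℂ) * h := by
      have := he.sum_sub I i j
      generalize ∑ i ∈ I, e i = y at this ⊢
      simp only [Submodule.coe_add, Submodule.coe_smul, Pi.add_apply, Pi.smul_apply, smul_eq_mul]
      push_cast
      linear_combination h * this
    rw [e1]
    refine h1 i (Finset.mem_univ _) j (Finset.mem_univ _) hij _ ?_
    rw [Finset.mem_Icc]
    split_ifs <;> omega
  have key : ∀ m k, cmFamily e τ b m (cmFamily e τ b k F) (h, x) = shiftSum e τ (-(b * h)) h
      (fun j => h⁻¹ ^ m * (-1) ^ (m - j) * supersetCount n m j)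
      (shiftSum e τ (-(b * h)) h
        (fun j => h⁻¹ ^ k * (-1) ^ (k - j) * supersetCount n k j) f) x := by
    intro m k
    rw [he.cmFamily_eq_shiftSum τ b m _ hh hx, shiftSum, shiftSum]
    refine Finset.sum_congr rfl fun I _ => ?_
    rw [he.cmFamily_eq_shiftSum τ b k F hh (hsh I)]
  rw [key, key]
  exact he.shiftSum_comm hτ _ h2 h3 _ _ f h1

end Commuting

/-! ### Normally ordered determinants -/

section NormalDet

variable {n : ℕ}

/-- The determinant of the matrix whose rows in `J` are those of `A`, and the others those of
`B`. -/
def rowMix {R : Type*} [CommRing R] (J : Finset (Fin n)) (A B : Fin n → Fin n → R) : R :=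
  Matrix.det (Matrix.of (J.piecewise A B))

theorem det_row_mul_add {R : Type*} [CommRing R] (Y : Fin n → R) (A B : Fin n → Fin n → R) :
    (Matrix.of fun i j => Y i * A i j + B i j).det = ∑ J, rowMix J A B * ∏ i ∈ J, Y i := by
  have h1 : (Matrix.of fun i j => Y i * A i j + B i j).det =
      Matrix.detRowAlternating.toMultilinearMap ((fun i => Y i • A i) + B) := rfl
  rw [h1, MultilinearMap.map_add_univ]
  refine Finset.sum_congr rfl fun J _ => ?_
  have h2 : J.piecewise (fun i => Y i • A i) B =
      J.piecewise (fun i => Y i • J.piecewise A B i) (J.piecewise A B) := by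
    funext i
    by_cases hi : i ∈ J <;> simp [hi]
  rw [h2, MultilinearMap.map_piecewise_smul, smul_eq_mul, mul_comm]
  rfl

theorem rowMix_map {R R' : Type*} [CommRing R] [CommRing R'] (φ : R →+* R') (J : Finset (Fin n))
    (A B : Fin n → Fin n → R) :
    rowMix J (fun i j => φ (A i j)) (fun i j => φ (B i j)) = φ (rowMix J A B) := by
  rw [rowMix, rowMix, RingHom.map_det]
  congr 1
  ext i j
  by_cases hi : i ∈ J <;> simp [hi]

theorem rowMix_mul {R : Type*} [CommRing R] (J : Finset (Fin n)) (a b : R)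
    (A B : Fin n → Fin n → R) :
    rowMix J (fun i j => a * A i j) (fun i j => b * B i j) =
      a ^ J.card * b ^ (n - J.card) * rowMix J A B := by
  have h1 : rowMix J (fun i j => a * A i j) (fun i j => b * B i j) =
      (Matrix.of fun i j => J.piecewise (fun _ => a) (fun _ => b) i *
        Matrix.of (J.piecewise A B) i j).det := by
    rw [rowMix]
    congr 1
    ext i j
    by_cases hi : i ∈ J <;> simp [hi]
  rw [h1, Matrix.det_mul_column, ← rowMix, Finset.prod_piecewise, Finset.prod_const,
    Finset.prod_const, Finset.univ_inter, ← Finset.compl_eq_univ_sdiff, Finset.card_compl,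
    Fintype.card_fin]

theorem tendsto_rowMix {α : Type*} {F : Filter α} (J : Finset (Fin n))
    {A B : α → Fin n → Fin n → ℂ} {A' B' : Fin n → Fin n → ℂ}
    (hA : ∀ i j, Tendsto (fun a => A a i j) F (𝓝 (A' i j)))
    (hB : ∀ i j, Tendsto (fun a => B a i j) F (𝓝 (B' i j))) :
    Tendsto (fun a => rowMix J (A a) (B a)) F (𝓝 (rowMix J A' B')) := by
  have hd : Continuous fun M : Matrix (Fin n) (Fin n) ℂ => M.det :=
    Continuous.matrix_det continuous_id
  refine (hd.tendsto _).comp (tendsto_pi_nhds.mpr fun i => tendsto_pi_nhds.mpr fun j => ?_)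
  by_cases hi : i ∈ J
  · simpa [hi] using hA i j
  · simpa [hi] using hB i j

variable {S : Submodule ℂ (Fin n → ℂ)}

/-- The value at a point of the coefficients of a normally ordered expression. -/
def symbolAt (x : S) : OpSymbol S →+* MvPolynomial (Fin n) ℂ :=
  MvPolynomial.map (Pi.evalRingHom (fun _ : S => ℂ) x)

theorem symbolAt_C (x : S) (a : S → ℂ) :
    symbolAt x (MvPolynomial.C a) = MvPolynomial.C (a x) := by
  rw [symbolAt, MvPolynomial.map_C]
  rfl

theorem symbolAt_X (x : S) (i : Fin n) :
    symbolAt x (MvPolynomial.X i) = MvPolynomial.X i := by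
  rw [symbolAt, MvPolynomial.map_X]

theorem smul_symbol (t : ℂ) (p : OpSymbol S) :
    t • p = MvPolynomial.C (fun _ : S => t) * p := by
  rw [← MvPolynomial.smul_eq_C_mul]
  ext m
  simp only [MvPolynomial.coeff_smul]
  rfl

theorem symbolAt_smul (x : S) (t : ℂ) (p : OpSymbol S) :
    symbolAt x (t • p) = MvPolynomial.C t * symbolAt x p := by
  rw [smul_symbol, map_mul, symbolAt_C]

theorem symbolAt_one_apply (x : S) (i j : Fin n) :
    symbolAt x ((1 : Matrix (Fin n) (Fin n) (OpSymbol S)) i j) =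
      MvPolynomial.C (if i = j then 1 else 0) := by
  rw [Matrix.one_apply]
  split_ifs <;> simp

/-- Row `i` involves only the one symbol `Y i`, so multilinearity in the rows gives a sum over
subsets. Leaving `Y` free allows expansion both in shifts and in divided differences. -/
theorem normalDet_eq_sum (A : Fin n → (S → ℂ) → S → ℂ) (N : Matrix (Fin n) (Fin n) (OpSymbol S))
    (f : S → ℂ) (x : S) (Y : Fin n → MvPolynomial (Fin n) ℂ) (a b : Fin n → Fin n → ℂ)
    (h : ∀ i j, symbolAt x (N i j) = Y i * MvPolynomial.C (a i j) + MvPolynomial.C (b i j)) :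
    normalDet A N f x =
      ∑ J, rowMix J a b * monomialFun (fun m => opMonomial A m f x) (∏ i ∈ J, Y i) := by
  have h1 : (symbolAt x).mapMatrix N = Matrix.of fun i j =>
      Y i * MvPolynomial.C (a i j) + MvPolynomial.C (b i j) := by
    ext1 i j
    exact h i j
  rw [normalDet, normalOp_eq_monomialFun, ← symbolAt, RingHom.map_det, h1,
    det_row_mul_add Y (fun i j => MvPolynomial.C (a i j)) fun i j => MvPolynomial.C (b i j),
    map_sum]
  refine Finset.sum_congr rfl fun J _ => ?_
  rw [rowMix_map MvPolynomial.C, ← MvPolynomial.smul_eq_C_mul, map_smul, smul_eq_mul]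

theorem opProd_pd (e : Fin n → S) (J : Finset (Fin n)) (f : S → ℂ) :
    opProd (pd e) J f = dirDerivs e (List.finRange n) J f :=
  opProd_eq_opList _ _ _

theorem monomialFun_pd (e : Fin n → S) (f : S → ℂ) (x : S) (J : Finset (Fin n)) :
    monomialFun (fun m => opMonomial (pd e) m f x) (∏ i ∈ J, MvPolynomial.X i) =
      dirDerivs e (List.finRange n) J f x := by
  rw [monomialFun_prod_X fun m => opMonomial (pd e) m f x, ← opProd_pd]
  rfl

end NormalDet

/-! ### The Lax matrix -/

section Lax

variable {n : ℕ} {S : Submodule ℂ (Fin n → ℂ)}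

theorem laxCoeff_eq_lagrange (τ c u h : ℂ) (i j : Fin n) (x : S) :
    laxCoeff τ c u h i j x = lagrange τ u x.1 j (x.1 i - c * h / n) := by
  unfold laxCoeff lagrange
  congr 2
  · congr 1; ring
  · funext k
    congr 2; ring

theorem laxCoeff_zero {τ c u : ℂ} (hu : theta τ u ≠ 0) {x : S}
    (hx : ∀ i j, i ≠ j → theta τ (x.1 i - x.1 j) ≠ 0) (i j : Fin n) :
    laxCoeff τ c u 0 i j x = if i = j then 1 else 0 := by
  rw [laxCoeff_eq_lagrange, mul_zero, zero_div, sub_zero, lagrange_node hu hx]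

theorem differentiable_laxCoeff {τ : ℂ} (hτ : 0 < τ.im) (c u : ℂ) (i j : Fin n) (x : S) :
    Differentiable ℂ fun h => laxCoeff τ c u h i j x := by
  have hθ : ∀ b : ℂ, Differentiable ℂ fun h : ℂ => theta τ (c * h / n + b) := fun b =>
    (differentiable_theta hτ).comp (by fun_prop)
  intro h
  unfold laxCoeff
  simp only [add_assoc]
  exact ((hθ _ h).div_const _).mul
    (DifferentiableAt.fun_finsetProd fun k _ => (hθ _ h).div_const _)

/-- The derivative at `ħ = 0` of the coefficients of the Lax matrix. -/
def laxSlope (τ c u : ℂ) (x : S) (i j : Fin n) : ℂ :=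
  deriv (fun h => laxCoeff τ c u h i j x) 0

theorem hasDerivAt_laxCoeff {τ : ℂ} (hτ : 0 < τ.im) (c u : ℂ) (i j : Fin n) (x : S) :
    HasDerivAt (fun h => laxCoeff τ c u h i j x) (laxSlope τ c u x i j) 0 :=
  (differentiable_laxCoeff hτ c u i j x 0).hasDerivAt

theorem symbolAt_lax (τ c u h : ℂ) (x : S) (i j : Fin n) :
    symbolAt x (lax S τ c u h i j) =
      MvPolynomial.C (laxCoeff τ c u h i j x) * MvPolynomial.X i := by
  rw [lax, Matrix.of_apply, map_mul, symbolAt_C, symbolAt_X]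

theorem symbolAt_laxDeriv (τ c u : ℂ) (x : S) (i j : Fin n) :
    symbolAt x (laxDeriv S τ c u i j) = MvPolynomial.X i * MvPolynomial.C (if i = j then 1 else 0) +
      MvPolynomial.C (laxSlope τ c u x i j) := by
  rw [laxDeriv, Matrix.of_apply, map_add, symbolAt_C, add_comm]
  congr 1
  split_ifs <;> simp [symbolAt_X]

theorem normalOp_lax (e : Fin n → S) (τ c u h : ℂ) (i j : Fin n) (f : S → ℂ) (x : S) :
    normalOp (shift e h) (lax S τ c u h i j) f x = laxCoeff τ c u h i j x * f (x + h • e i) := by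
  have h1 := monomialFun_prod_X (fun m => opMonomial (shift e h) m f x) {i}
  rw [Finset.prod_singleton, opMonomial_shift, shiftValues_indicator, Finset.sum_singleton] at h1
  rw [normalOp_eq_monomialFun, ← symbolAt, symbolAt_lax, ← MvPolynomial.smul_eq_C_mul, map_smul, h1,
    smul_eq_mul]

theorem normalOp_laxDeriv (e : Fin n → S) (τ c u : ℂ) (i j : Fin n) (f : S → ℂ) (x : S) :
    normalOp (pd e) (laxDeriv S τ c u i j) f x =
      (if i = j then 1 else 0) * lineDeriv ℂ f x (e i) + laxSlope τ c u x i j * f x := by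
  have h1 := monomialFun_prod_X (fun m => opMonomial (pd e) m f x) {i}
  have h2 : opMonomial (pd e) (fun k => if k ∈ ({i} : Finset (Fin n)) then 1 else 0) f x =
      lineDeriv ℂ f x (e i) := by
    have h3 : ∀ l : List (Fin n), l.Nodup → opList (pd e) l {i} f =
        if i ∈ l then pd e i f else f := by
      intro l hl
      induction l with
      | nil => rfl
      | cons k l ih =>
        rw [opList_cons, ih hl.of_cons]
        by_cases hk : k = i
        · subst hk
          simp [(List.nodup_cons.mp hl).1]
        · simp [hk, Ne.symm hk]
    have h4 := opProd_eq_opList (pd e) {i} f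
    rw [h3 _ (List.nodup_finRange n), if_pos (List.mem_finRange i)] at h4
    exact congrFun h4 x
  have h5 := monomialFun_prod_X (fun m => opMonomial (pd e) m f x) ∅
  have h6 : opMonomial (pd e) (fun k => if k ∈ (∅ : Finset (Fin n)) then 1 else 0) f x = f x := by
    have h7 : opProd (pd e) ∅ f = f := by
      rw [opProd_eq_opList]
      generalize List.finRange n = l
      induction l with
      | nil => rfl
      | cons k l ih => rw [opList_cons, ih]; simp
    exact congrFun h7 x
  rw [Finset.prod_singleton, h2] at h1
  rw [Finset.prod_empty, h6] at h5
  rw [normalOp_eq_monomialFun, ← symbolAt, symbolAt_laxDeriv, map_add,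
    mul_comm (MvPolynomial.X i), ← MvPolynomial.smul_eq_C_mul, map_smul, h1, smul_eq_mul,
    ← mul_one (MvPolynomial.C (laxSlope τ c u x i j)), ← MvPolynomial.smul_eq_C_mul, map_smul, h5,
    smul_eq_mul]

theorem hasDerivAt_normalOp_lax {τ : ℂ} (hτ : 0 < τ.im) (c : ℂ) {u : ℂ} (hu : theta τ u ≠ 0)
    (e : Fin n → S) {f : S → ℂ} {x : S} (hf : DifferentiableAt ℂ f x)
    (hx : ∀ i j, i ≠ j → theta τ (x.1 i - x.1 j) ≠ 0) (i j : Fin n) :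
    HasDerivAt (fun h : ℂ => normalOp (shift e h) (lax S τ c u h i j) f x)
      (normalOp (pd e) (laxDeriv S τ c u i j) f x) 0 := by
  simp only [normalOp_lax, normalOp_laxDeriv]
  have h1 : HasDerivAt (fun h : ℂ => f (x + h • e i)) (lineDeriv ℂ f x (e i)) 0 :=
    hf.lineDifferentiableAt.hasLineDerivAt
  have h2 := (hasDerivAt_laxCoeff hτ c u i j x).mul h1
  rw [laxCoeff_zero hu hx, zero_smul, add_zero] at h2
  rw [add_comm]
  exact h2

/-! ### The differential limit -/

theorem normalDet_laxDeriv (e : Fin n → S) (τ c u t : ℂ) (f : S → ℂ) (x : S) :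
    normalDet (pd e) (laxDeriv S τ c u - t • 1) f x =
      ∑ J, rowMix J (fun i j => if i = j then 1 else 0)
        (fun i j => laxSlope τ c u x i j - t * if i = j then 1 else 0) *
          dirDerivs e (List.finRange n) J f x := by
  rw [normalDet_eq_sum (pd e) _ f x MvPolynomial.X (fun i j => if i = j then 1 else 0)
    fun i j => laxSlope τ c u x i j - t * if i = j then 1 else 0]
  · simp only [monomialFun_pd]
  · intro i j
    rw [Matrix.sub_apply, Matrix.smul_apply, map_sub, symbolAt_laxDeriv, symbolAt_smul,
      symbolAt_one_apply, MvPolynomial.C_sub, MvPolynomial.C_mul]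
    ring

theorem symbolAt_lax_sub (τ c u h t : ℂ) (x : S) (i j : Fin n) :
    symbolAt x ((h⁻¹ • (lax S τ c u h - (1 + h * t) • 1)) i j) =
      MvPolynomial.C h⁻¹ * (MvPolynomial.C (laxCoeff τ c u h i j x) * MvPolynomial.X i -
        MvPolynomial.C (1 + h * t) * MvPolynomial.C (if i = j then 1 else 0)) := by
  rw [Matrix.smul_apply, Matrix.sub_apply, Matrix.smul_apply, symbolAt_smul, map_sub, symbolAt_lax,
    symbolAt_smul, symbolAt_one_apply]

/-- With coefficient `a` and `δ` the identity entry, `h⁻¹(a X - (1 + ht)δ) = a · h⁻¹(X - 1) + h⁻¹(a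
- δ) - tδ`. In this form every ingredient has a limit as `h → 0`, since `a` tends to `δ`. -/
theorem normalDet_lax_eq_divDiffs (e : Fin n → S) (τ c u t : ℂ) {h : ℂ} (hh : h ≠ 0) (f : S → ℂ)
    (x : S) :
    normalDet (shift e h) (h⁻¹ • (lax S τ c u h - (1 + h * t) • 1)) f x =
      ∑ J, rowMix J (fun i j => laxCoeff τ c u h i j x)
        (fun i j => h⁻¹ * (laxCoeff τ c u h i j x - if i = j then 1 else 0) -
          t * if i = j then 1 else 0) * divDiffs e J (fun p => f p.2) (h, x) := by
  rw [normalDet_eq_sum (shift e h) _ f x (divDiffSymbol h) (fun i j => laxCoeff τ c u h i j x)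
    fun i j => h⁻¹ * (laxCoeff τ c u h i j x - if i = j then 1 else 0) -
      t * if i = j then 1 else 0]
  · refine Finset.sum_congr rfl fun J _ => ?_
    rw [divDiffs_eq_monomialFun hh]
    simp only [opMonomial_shift]
  · intro i j
    have h1 : (MvPolynomial.C h⁻¹ * MvPolynomial.C h : MvPolynomial (Fin n) ℂ) = 1 := by
      rw [← MvPolynomial.C_mul, inv_mul_cancel₀ hh, MvPolynomial.C_1]
    rw [symbolAt_lax_sub, divDiffSymbol]
    simp only [MvPolynomial.C_sub, MvPolynomial.C_mul, MvPolynomial.C_add, MvPolynomial.C_1]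
    linear_combination (-MvPolynomial.C t * MvPolynomial.C (if i = j then 1 else 0)) * h1

theorem tendsto_normalDet_lax {τ : ℂ} (hτ : 0 < τ.im) (c : ℂ) {u : ℂ} (hu : theta τ u ≠ 0)
    (e : Fin n → S) {f : S → ℂ} {x : S} (hf : HolAt f x)
    (hx : ∀ i j, i ≠ j → theta τ (x.1 i - x.1 j) ≠ 0) (t : ℂ) :
    Tendsto (fun h : ℂ => normalDet (shift e h)
        (h⁻¹ • (lax S τ c u h - (1 + h * t) • 1)) f x) (𝓝[≠] 0)
      (𝓝 (normalDet (pd e) (laxDeriv S τ c u - t • 1) f x)) := by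
  rw [normalDet_laxDeriv]
  have h1 : Tendsto (fun h : ℂ => ∑ J, rowMix J (fun i j => laxCoeff τ c u h i j x)
        (fun i j => h⁻¹ * (laxCoeff τ c u h i j x - if i = j then 1 else 0) -
          t * if i = j then 1 else 0) * divDiffs e J (fun p => f p.2) (h, x)) (𝓝[≠] 0)
      (𝓝 (∑ J, rowMix J (fun i j => if i = j then 1 else 0)
        (fun i j => laxSlope τ c u x i j - t * if i = j then 1 else 0) *
          dirDerivs e (List.finRange n) J f x)) := by
    refine tendsto_finsetSum _ fun J _ => Tendsto.mul (tendsto_rowMix J ?_ ?_)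
      ((tendsto_divDiffs hf e J).mono_left nhdsWithin_le_nhds)
    · intro i j
      have h2 := (differentiable_laxCoeff hτ c u i j x 0).continuousAt.tendsto
      rw [laxCoeff_zero hu hx] at h2
      exact h2.mono_left nhdsWithin_le_nhds
    · intro i j
      have h2 := hasDerivAt_iff_tendsto_slope.mp (hasDerivAt_laxCoeff hτ c u i j x)
      refine Tendsto.sub_const (h2.congr fun h => ?_) _
      rw [slope_def_field, laxCoeff_zero hu hx, sub_zero, div_eq_inv_mul]
  refine h1.congr' ?_
  filter_upwards [self_mem_nhdsWithin] with h hh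
  rw [normalDet_lax_eq_divDiffs e τ c u t hh]

end Lax

section Generating

variable {n : ℕ} {S : Submodule ℂ (Fin n → ℂ)}

/-! ### The generating function -/

theorem normalDet_eq_sum_diffOp (e : Fin n → S) (τ c u t : ℂ) (f : S → ℂ) (x : S) :
    normalDet (pd e) (laxDeriv S τ c u - t • 1) f x =
      ∑ d ∈ Finset.range (n + 1), (-t) ^ (n - d) * diffOp e τ c u d f x := by
  set M : Matrix (Fin n) (Fin n) (Polynomial (OpSymbol S)) :=
    (laxDeriv S τ c u).map Polynomial.C - (Polynomial.X : Polynomial (OpSymbol S)) • 1 with hM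
  have hdeg : M.det.natDegree < n + 1 := by
    -- The degree bound ensures that the coefficients defining the `diffOp` with `d ≤ n` exhaust the
    -- determinant.
    have h1 := Polynomial.natDegree_det_X_add_C_le (-1) (laxDeriv S τ c u)
    have h2 : (Polynomial.X : Polynomial (OpSymbol S)) •
        (-1 : Matrix (Fin n) (Fin n) (OpSymbol S)).map Polynomial.C +
          (laxDeriv S τ c u).map Polynomial.C = M := by
      rw [hM]
      ext1 i j
      by_cases hij : i = j <;> simp [hij] <;> ring
    rw [h2, Fintype.card_fin] at h1
    omega
  have hdet : (laxDeriv S τ c u - t • 1).det =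
      ∑ k ∈ Finset.range (n + 1), M.det.coeff k * MvPolynomial.C (fun _ : S => t) ^ k := by
    rw [← Polynomial.eval_eq_sum_range' hdeg, ← Polynomial.coe_evalRingHom,
      RingHom.map_det (Polynomial.evalRingHom (MvPolynomial.C fun _ : S => t)) M]
    congr 1
    ext1 i j
    simp only [hM, RingHom.mapMatrix_apply, Matrix.map_apply, Matrix.sub_apply, Matrix.smul_apply,
      Polynomial.coe_evalRingHom, Polynomial.eval_sub, Polynomial.eval_C, smul_symbol, smul_eq_mul,
      Polynomial.eval_mul, Polynomial.eval_X]
    rcases eq_or_ne i j with rfl | hij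
    · simp
    · simp [hij]
  rw [normalDet, normalOp_eq_monomialFun, ← symbolAt, hdet, map_sum, map_sum,
    ← Finset.sum_range_reflect]
  refine Finset.sum_congr rfl fun d hd => ?_
  have hk : n + 1 - 1 - d = n - d := by omega
  rw [hk, diffOp, normalOp_eq_monomialFun, ← symbolAt, ← hM, map_mul (symbolAt x),
    map_mul (symbolAt x), map_pow (symbolAt x), map_pow (symbolAt x), symbolAt_C,
    map_neg (symbolAt x), map_one (symbolAt x), mul_comm, ← map_pow MvPolynomial.C,
    ← MvPolynomial.smul_eq_C_mul, map_smul]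
  have h1 : ((-1) ^ (n - d) : MvPolynomial (Fin n) ℂ) = MvPolynomial.C ((-1) ^ (n - d)) := by
    simp
  rw [h1, ← MvPolynomial.smul_eq_C_mul, map_smul, smul_eq_mul, smul_eq_mul, ← mul_assoc, ← mul_pow]
  ring

theorem coeff_unique {a b : ℕ → ℂ} (h : ∀ t : ℂ, ∑ d ∈ Finset.range (n + 1), (-t) ^ (n - d) * a d =
    ∑ d ∈ Finset.range (n + 1), (-t) ^ (n - d) * b d) {d : ℕ} (hd : d ≤ n) : a d = b d := by
  have h1 : (∑ d ∈ Finset.range (n + 1), Polynomial.monomial (n - d) (a d)) =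
      ∑ d ∈ Finset.range (n + 1), Polynomial.monomial (n - d) (b d) := by
    refine Polynomial.funext fun t => ?_
    have := h (-t)
    simp only [neg_neg] at this
    simp only [Polynomial.eval_finsetSum, Polynomial.eval_monomial]
    simpa only [mul_comm] using this
  have h2 : ∀ a : ℕ → ℂ, (∑ d ∈ Finset.range (n + 1),
      Polynomial.monomial (n - d) (a d)).coeff (n - d) = a d := by
    intro a
    rw [Polynomial.finsetSum_coeff, Finset.sum_eq_single d]
    · rw [Polynomial.coeff_monomial, if_pos rfl]
    · intro k hk hkd
      rw [Polynomial.coeff_monomial, if_neg]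
      have := Finset.mem_range.mp hk
      omega
    · intro hk
      exact absurd (Finset.mem_range.mpr (by omega)) hk
  rw [← h2 a, h1, h2 b]

/-! ### Evaluation of the determinant -/

/-- Identity rows are interpolation rows at the nodes themselves. The mixed matrix is therefore the
interpolation matrix at the points obtained by displacing the coordinates in `J` by `-ch/n`, and
`det_lagrange` applies. -/
theorem rowMix_lax {τ : ℂ} (hτ : 0 < τ.im) {c u h : ℂ} (hu : theta τ u ≠ 0) {x : S}
    (hx : ∀ i j, i ≠ j → theta τ (x.1 i - x.1 j) ≠ 0)
    (huh : ∀ k ≤ n, theta τ (u + k * (c * h / n)) ≠ 0)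
    (hxh : ∀ i j, i ≠ j → theta τ (x.1 i - x.1 j + c * h / n) ≠ 0)
    {e : Fin n → S} (he : IsDirections e) (J : Finset (Fin n)) :
    rowMix J (fun i j => laxCoeff τ c u h i j x) (fun i j => if i = j then 1 else 0) =
      theta τ (u + J.card * (c * h / n)) / theta τ u *
        (Delta S τ (x + h • ∑ i ∈ J, (-(c / n)) • e i) / Delta S τ x) := by
  set μ : Fin n → ℂ := fun i => x.1 i - c * h / n with hμ
  have hs : ∀ t : Finset (Fin n), ∑ i ∈ t, (x.1 i - μ i) = t.card * (c * h / n) := by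
    intro t
    simp [hμ]
  have h1 : rowMix J (fun i j => laxCoeff τ c u h i j x) (fun i j => if i = j then 1 else 0) =
      (Matrix.of fun i j => lagrange τ u x.1 j (J.piecewise μ x.1 i)).det := by
    rw [rowMix]
    congr 1
    ext i j
    by_cases hi : i ∈ J
    · simp [hi, laxCoeff_eq_lagrange, hμ]
    · simp [hi, lagrange_node hu hx]
  rw [h1, det_lagrange hτ μ (fun i j hij => by simpa [hμ] using hx i j hij) J u x.1 ?_ hx ?_, hs,
    he.Delta_shift]
  · congr 4
    funext i
    simp only [hμ]
    ring
  · intro t _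
    rw [hs]
    exact huh _ (by simpa using Finset.card_le_univ t)
  · intro i j hij
    have h2 : x.1 i - μ j = x.1 i - x.1 j + c * h / n := by simp only [hμ]; ring
    rw [h2]
    exact hxh i j hij

/-- The function `(y, y', y'') ↦ θ(y) Δ(y') f(y'')`. -/
def tripleFun (S : Submodule ℂ (Fin n → ℂ)) (τ : ℂ) (f : S → ℂ) (p : ℂ × (S × S)) : ℂ :=
  theta τ p.1 * (Delta S τ p.2.1 * f p.2.2)

/-- The direction in which the factors of `tripleFun` are shifted. -/
def tripleDir (e : Fin n → S) (a : ℂ) (i : Fin n) : ℂ × (S × S) := (a, ((-a) • e i, e i))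

theorem sum_tripleDir (e : Fin n → S) (a : ℂ) (J : Finset (Fin n)) :
    ∑ i ∈ J, tripleDir e a i = (J.card * a, (∑ i ∈ J, (-a) • e i, ∑ i ∈ J, e i)) := by
  simp only [tripleDir, Prod.ext_iff, Prod.fst_sum, Prod.snd_sum, Finset.sum_const, nsmul_eq_mul,
    and_self]

/-- By `rowMix_lax` the term with shifts in `J` is the value of the triple product at a point
shifted jointly in the directions `tripleDir`. The determinant thus acts on the triple product
through the symbol `∏ (h⁻¹ X_i + κ)`. -/
theorem normalDet_lax_eq_tripleFun {τ : ℂ} (hτ : 0 < τ.im) {c u h : ℂ} (hh : h ≠ 0)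
    (hu : theta τ u ≠ 0) {x : S} (hx : ∀ i j, i ≠ j → theta τ (x.1 i - x.1 j) ≠ 0)
    (huh : ∀ k ≤ n, theta τ (u + k * (c * h / n)) ≠ 0)
    (hxh : ∀ i j, i ≠ j → theta τ (x.1 i - x.1 j + c * h / n) ≠ 0)
    {e : Fin n → S} (he : IsDirections e) (t : ℂ) (f : S → ℂ) :
    normalDet (shift e h) (h⁻¹ • (lax S τ c u h - (1 + h * t) • 1)) f x =
      (∑ J : Finset (Fin n), (-t) ^ (n - J.card) * divDiffs (tripleDir e (c / n)) J
        (fun p => tripleFun S τ f p.2) (h, (u, (x, x)))) / (theta τ u * Delta S τ x) := by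
  set κ : ℂ := -(h⁻¹ * (1 + h * t)) with hκ
  have hsub : ∀ J : Finset (Fin n), (Finset.univ \ J).card = n - J.card := fun J => by
    rw [← Finset.compl_eq_univ_sdiff, Finset.card_compl, Fintype.card_fin]
  have hsym : ∀ i : Fin n, (MvPolynomial.C h⁻¹ * MvPolynomial.X i + MvPolynomial.C κ :
      MvPolynomial (Fin n) ℂ) = divDiffSymbol h i + MvPolynomial.C (-t) := by
    intro i
    have h1 : κ = -h⁻¹ - t := by
      rw [hκ]; field_simp; ring
    rw [h1, divDiffSymbol, MvPolynomial.C_sub, MvPolynomial.C_neg, MvPolynomial.C_neg]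
    ring
  -- Two expansions of the same product, since `h⁻¹ X_i + κ` is the divided difference symbol minus
  -- `t`.
  have hprod : (∑ J : Finset (Fin n), (h⁻¹ ^ J.card * κ ^ (n - J.card)) •
      ∏ i ∈ J, (MvPolynomial.X i : MvPolynomial (Fin n) ℂ)) =
      ∑ J : Finset (Fin n), ((-t) ^ (n - J.card)) • ∏ i ∈ J, divDiffSymbol h i := by
    have h1 := Finset.prod_congr (rfl : (Finset.univ : Finset (Fin n)) = Finset.univ)
      fun i _ => hsym i
    rw [Finset.prod_add, Finset.prod_add, Finset.powerset_univ] at h1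
    simp only [Finset.prod_mul_distrib, Finset.prod_const, hsub] at h1
    simp only [MvPolynomial.smul_eq_C_mul, map_mul, map_pow]
    convert h1 using 2 with J _ J _ <;> ring
  have hleft : normalDet (shift e h) (h⁻¹ • (lax S τ c u h - (1 + h * t) • 1)) f x =
      ∑ J : Finset (Fin n), h⁻¹ ^ J.card * κ ^ (n - J.card) *
        (theta τ (u + J.card * (c * h / n)) / theta τ u *
        (Delta S τ (x + h • ∑ i ∈ J, (-(c / n)) • e i) / Delta S τ x)) *
          f (x + h • ∑ i ∈ J, e i) := by
    rw [normalDet_eq_sum (shift e h) _ f x MvPolynomial.X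
      (fun i j => h⁻¹ * laxCoeff τ c u h i j x) fun i j => κ * if i = j then 1 else 0]
    · refine Finset.sum_congr rfl fun J _ => ?_
      rw [rowMix_mul, rowMix_lax hτ hu hx huh hxh he,
        monomialFun_prod_X fun m => opMonomial (shift e h) m f x, opMonomial_shift,
        shiftValues_indicator]
    · intro i j
      rw [symbolAt_lax_sub, hκ]
      simp only [MvPolynomial.C_neg, MvPolynomial.C_mul]
      ring
  have hright := congrArg (monomialFun fun m => shiftValues (tripleFun S τ f) h
    (tripleDir e (c / n)) (u, (x, x)) m) hprod
  simp only [map_sum, map_smul, smul_eq_mul] at hright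
  have hdd : ∀ J, divDiffs (tripleDir e (c / n)) J (fun p => tripleFun S τ f p.2)
      (h, (u, (x, x))) = monomialFun (fun m => shiftValues (tripleFun S τ f) h
        (tripleDir e (c / n)) (u, (x, x)) m) (∏ i ∈ J, divDiffSymbol h i) := fun J =>
    divDiffs_eq_monomialFun hh _ _ _ _
  simp only [hdd]
  rw [hleft, ← hright, Finset.sum_div]
  refine Finset.sum_congr rfl fun J _ => ?_
  rw [monomialFun_prod_X fun m => shiftValues (tripleFun S τ f) h (tripleDir e (c / n))
    (u, (x, x)) m, shiftValues_indicator, sum_tripleDir]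
  simp only [tripleFun, Prod.smul_mk, Prod.mk_add_mk, smul_eq_mul]
  have h1 : h * (J.card * (c / n)) = J.card * (c * h / n) := by ring
  rw [h1]
  ring

theorem HolAt.tripleFun {τ : ℂ} (hτ : 0 < τ.im) {f : S → ℂ} {x : S} (hf : HolAt f x) (u : ℂ) :
    HolAt (tripleFun S τ f) (u, (x, x)) := by
  have h1 : HolAt (theta τ) u := Eventually.of_forall (differentiable_theta hτ)
  have h2 : HolAt (fun p : ℂ × (S × S) => theta τ p.1) (u, (x, x)) :=
    HolAt.comp (g := fun p : ℂ × (S × S) => p.1) h1 (by fun_prop)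
  have h3 : HolAt (fun p : ℂ × (S × S) => Delta S τ p.2.1) (u, (x, x)) :=
    HolAt.comp (g := fun p : ℂ × (S × S) => p.2.1) (holAt_Delta hτ x) (by fun_prop)
  have h4 : HolAt (fun p : ℂ × (S × S) => f p.2.2) (u, (x, x)) :=
    HolAt.comp (g := fun p : ℂ × (S × S) => p.2.2) hf (by fun_prop)
  exact h2.mul (h3.mul h4)

/-- The determinant has two limits as `h → 0`: the generating function of the `diffOp`, and the
limit of its divided difference form on the triple product. They agree for all `t`, so the
coefficients agree. -/
theorem diffOp_eq_tripleFun {τ : ℂ} (hτ : 0 < τ.im) (c : ℂ) {u : ℂ} (hu : theta τ u ≠ 0)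
    {e : Fin n → S} (he : IsDirections e) {f : S → ℂ} {x : S} (hf : HolAt f x)
    (hx : ∀ i j, i ≠ j → theta τ (x.1 i - x.1 j) ≠ 0) {d : ℕ} (hd : d ≤ n) :
    diffOp e τ c u d f x =
      (∑ J ∈ Finset.univ.powersetCard d, dirDerivs (tripleDir e (c / n)) (List.finRange n) J
        (tripleFun S τ f) (u, (x, x))) / (theta τ u * Delta S τ x) := by
  refine coeff_unique (a := fun d => diffOp e τ c u d f x) (b := fun d =>
    (∑ J ∈ Finset.univ.powersetCard d, dirDerivs (tripleDir e (c / n)) (List.finRange n) J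
        (tripleFun S τ f) (u, (x, x))) / (theta τ u * Delta S τ x)) (fun t => ?_) hd
  rw [← normalDet_eq_sum_diffOp]
  refine tendsto_nhds_unique (tendsto_normalDet_lax hτ c hu e hf hx t) ?_
  have h1 : Tendsto (fun h : ℂ => (∑ J : Finset (Fin n), (-t) ^ (n - J.card) *
      divDiffs (tripleDir e (c / n)) J (fun p => tripleFun S τ f p.2) (h, (u, (x, x)))) /
        (theta τ u * Delta S τ x)) (𝓝[≠] 0)
      (𝓝 ((∑ J : Finset (Fin n), (-t) ^ (n - J.card) * dirDerivs (tripleDir e (c / n))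
        (List.finRange n) J (tripleFun S τ f) (u, (x, x))) / (theta τ u * Delta S τ x))) := by
    refine Tendsto.div_const (tendsto_finsetSum _ fun J _ => Tendsto.const_mul _ ?_) _
    exact (tendsto_divDiffs (hf.tripleFun hτ u) _ J).mono_left nhdsWithin_le_nhds
  have h2 : (∑ J : Finset (Fin n), (-t) ^ (n - J.card) * dirDerivs (tripleDir e (c / n))
        (List.finRange n) J (tripleFun S τ f) (u, (x, x))) / (theta τ u * Delta S τ x) =
      ∑ d ∈ Finset.range (n + 1), (-t) ^ (n - d) *
        ((∑ J ∈ Finset.univ.powersetCard d, dirDerivs (tripleDir e (c / n)) (List.finRange n) J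
          (tripleFun S τ f) (u, (x, x))) / (theta τ u * Delta S τ x)) := by
    rw [← Finset.powerset_univ, Finset.sum_powerset, Finset.card_univ, Fintype.card_fin,
      Finset.sum_div]
    refine Finset.sum_congr rfl fun k _ => ?_
    rw [← mul_div_assoc, Finset.mul_sum]
    congr 1
    refine Finset.sum_congr rfl fun J hJ => ?_
    rw [(Finset.mem_powersetCard.mp hJ).2]
  rw [h2] at h1
  refine h1.congr' ?_
  have hcont : ∀ k b : ℂ, theta τ b ≠ 0 → ∀ᶠ h in 𝓝[≠] (0 : ℂ),
      theta τ (b + k * (c * h / n)) ≠ 0 := by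
    intro k b hb
    have hc : ContinuousAt (fun h : ℂ => theta τ (b + k * (c * h / n))) 0 :=
      ((differentiable_theta hτ).continuous.comp (by fun_prop)).continuousAt
    exact (hc.eventually_ne (by simpa using hb)).filter_mono nhdsWithin_le_nhds
  have g1 : ∀ᶠ h in 𝓝[≠] (0 : ℂ), ∀ k ∈ Finset.range (n + 1),
      theta τ (u + k * (c * h / n)) ≠ 0 :=
    (Filter.eventually_all_finset _).mpr fun k _ => hcont k u hu
  have g2 : ∀ᶠ h in 𝓝[≠] (0 : ℂ), ∀ i j, i ≠ j → theta τ (x.1 i - x.1 j + c * h / n) ≠ 0 := by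
    simp only [Filter.eventually_all]
    intro i j hij
    simpa using hcont 1 _ (hx i j hij)
  filter_upwards [g1, g2, self_mem_nhdsWithin] with h h1 h2 hh
  rw [normalDet_lax_eq_tripleFun hτ hh hu hx
    (fun k hk => h1 k (Finset.mem_range.mpr (by omega))) h2 he]

/-! ### The explicit formulas -/

theorem diffOp_eq_sum {τ : ℂ} (hτ : 0 < τ.im) (c : ℂ) {u : ℂ} (hu : theta τ u ≠ 0)
    {e : Fin n → S} (he : IsDirections e) {f : S → ℂ} {x : S} (hf : HolAt f x)
    (hx : ∀ i j, i ≠ j → theta τ (x.1 i - x.1 j) ≠ 0) {d : ℕ} (hd : d ≤ n) :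
    diffOp e τ c u d f x =
      (∑ I ∈ Finset.univ.powersetCard d, ∑ K ∈ I.powerset,
        (c / n) ^ K.card * iteratedDeriv K.card (theta τ) u * ∑ J ∈ (I \ K).powerset,
          dirDerivs (fun i => (-(c / n)) • e i) (List.finRange n) J (Delta S τ) x *
            dirDerivs e (List.finRange n) ((I \ K) \ J) f x) / (theta τ u * Delta S τ x) := by
  rw [diffOp_eq_tripleFun hτ c hu he hf hx hd]
  congr 1
  have h1 : HolAt (theta τ) u := Eventually.of_forall (differentiable_theta hτ)
  have h2 : HolAt (fun p : S × S => Delta S τ p.1 * f p.2) (x, x) :=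
    (HolAt.comp (g := fun p : S × S => p.1) (holAt_Delta hτ x) (by fun_prop)).mul
      (HolAt.comp (g := fun p : S × S => p.2) hf (by fun_prop))
  refine Finset.sum_congr rfl fun I _ => ?_
  have h3 := (dirDerivs_finRange_mul h1 h2 (fun _ => c / n) (fun i => ((-(c / n)) • e i, e i))
    I).self_of_nhds
  refine h3.trans (Finset.sum_congr rfl fun K _ => ?_)
  have h4 := (dirDerivs_finRange_mul (holAt_Delta hτ x) hf (fun i => (-(c / n)) • e i) e
    (I \ K)).self_of_nhds
  have h5 : dirDerivs (fun _ : Fin n => c / n) (List.finRange n) K (theta τ) u =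
      (c / n) ^ K.card * iteratedDeriv K.card (theta τ) u := by
    have := dirDerivs_smul (fun _ : Fin n => (1 : ℂ)) (c / n) K (theta τ)
    simp only [smul_eq_mul, mul_one] at this
    rw [this, dirDerivs_one]
  exact congrArg₂ (· * ·) h5 h4

/-- A set with `d - k` elements occurs as `I \ K` once for every `d`-element set `I` containing it,
that is, `(n - d + k).choose k` times. -/
theorem sum_powersetCard_sum_sdiff {d : ℕ} (hd : d ≤ n) (G : ℕ → ℂ) (F : Finset (Fin n) → ℂ) :
    ∑ I ∈ Finset.univ.powersetCard d, ∑ K ∈ I.powerset, G K.card * F (I \ K) =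
      ∑ k ∈ Finset.range (d + 1), ((n - d + k).choose k : ℂ) * G k *
        ∑ I ∈ Finset.univ.powersetCard (d - k), F I := by
  have h1 : ∑ I ∈ (Finset.univ : Finset (Fin n)).powersetCard d, ∑ K ∈ I.powerset,
      G K.card * F (I \ K) = ∑ I ∈ (Finset.univ : Finset (Fin n)).powersetCard d,
        ∑ K ∈ I.powerset, G (d - K.card) * F K := by
    refine Finset.sum_congr rfl fun I hI => ?_
    have hI' := (Finset.mem_powersetCard.mp hI).2
    refine Finset.sum_nbij' (fun K => I \ K) (fun K => I \ K) ?_ ?_ ?_ ?_ ?_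
    · intro K _
      exact Finset.mem_powerset.mpr Finset.sdiff_subset
    · intro K _
      exact Finset.mem_powerset.mpr Finset.sdiff_subset
    · intro K hK
      exact Finset.sdiff_sdiff_eq_self (Finset.mem_powerset.mp hK)
    · intro K hK
      exact Finset.sdiff_sdiff_eq_self (Finset.mem_powerset.mp hK)
    · intro K hK
      have hK' := Finset.mem_powerset.mp hK
      have := Finset.card_le_card hK'
      rw [Finset.card_sdiff_of_subset hK', hI']
      congr 2
      omega
  rw [h1, sum_powersetCard_sum_powerset d fun K => G (d - K.card) * F K,
    sum_supersetCount hd fun K => G (d - K.card) * F K]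
  refine Finset.sum_congr rfl fun k hk => ?_
  rw [mul_assoc]
  congr 1
  have hk' := Finset.mem_range.mp hk
  rw [Finset.mul_sum]
  refine Finset.sum_congr rfl fun K hK => ?_
  rw [(Finset.mem_powersetCard.mp hK).2]
  congr 2
  omega

/-- Separates the spectral parameter, which occurs only in scalar coefficients. There is no division
by `c`, so commutativity also covers `c = 0`. -/
theorem diffOp_eq_sum_cmOp {τ : ℂ} (hτ : 0 < τ.im) (c : ℂ) {u : ℂ} (hu : theta τ u ≠ 0)
    {e : Fin n → S} (he : IsDirections e) {f : S → ℂ} {x : S} (hf : HolAt f x)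
    (hx : ∀ i j, i ≠ j → theta τ (x.1 i - x.1 j) ≠ 0) {d : ℕ} (hd : d ≤ n) :
    diffOp e τ c u d f x = ∑ k ∈ Finset.range (d + 1), ((n - d + k).choose k : ℂ) *
      ((c / n) ^ k * iteratedDeriv k (theta τ) u / theta τ u) *
        cmOp e τ (-(c / n)) (d - k) f x := by
  rw [diffOp_eq_sum hτ c hu he hf hx hd, sum_powersetCard_sum_sdiff hd
    (fun k => (c / n) ^ k * iteratedDeriv k (theta τ) u) fun I => ∑ J ∈ I.powerset,
      dirDerivs (fun i => (-(c / n)) • e i) (List.finRange n) J (Delta S τ) x *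
        dirDerivs e (List.finRange n) (I \ J) f x, Finset.sum_div]
  refine Finset.sum_congr rfl fun k _ => ?_
  rw [cmOp, mul_div_mul_comm, mul_div_assoc]

theorem sdiff_sdiff_eq_sdiff_union (I J K : Finset (Fin n)) : (I \ J) \ K = I \ (J ∪ K) :=
  sdiff_sdiff_left

theorem opProd_smul_pd (e : Fin n → S) (a : ℂ) (J : Finset (Fin n)) (f : S → ℂ) (x : S) :
    opProd (fun i g => a • pd e i g) J f x = a ^ J.card * dirDerivs e (List.finRange n) J f x := by
  have h1 : (fun (i : Fin n) (g : S → ℂ) => a • pd e i g) =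
      fun i g y => lineDeriv ℂ g y (a • e i) := by
    funext i g y
    rw [lineDeriv_smul]
    rfl
  have h2 := dirDerivs_smul e a J f
  rw [opProd_eq_opList, h1]
  exact congrFun h2 x

theorem diffOp_eq_sum_sum {τ : ℂ} (hτ : 0 < τ.im) {c : ℂ} (hc : c / n ≠ 0) {u : ℂ}
    (hu : theta τ u ≠ 0) {e : Fin n → S} (he : IsDirections e) {f : S → ℂ} {x : S} (hf : HolAt f x)
    (hx : ∀ i j, i ≠ j → theta τ (x.1 i - x.1 j) ≠ 0) {d : ℕ} (hd : d ≤ n) :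
    diffOp e τ c u d f x = (-(c / n)) ^ d * ∑ I ∈ Finset.univ.powersetCard d,
      ∑ J' ∈ I.powerset, ∑ J'' ∈ (I \ J').powerset,
        (-1) ^ J'.card * (iteratedDeriv J'.card (theta τ) u / theta τ u) *
          (opProd (pd e) J'' (Delta S τ) x / Delta S τ x) *
            opProd (fun i g => (-(n / c)) • pd e i g) (I \ (J' ∪ J'')) f x := by
  have hinv : -(n / c) * -(c / n) = 1 := by
    rw [neg_mul_neg, ← inv_div c, inv_mul_cancel₀ hc]
  rw [diffOp_eq_sum hτ c hu he hf hx hd, Finset.sum_div, Finset.mul_sum]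
  refine Finset.sum_congr rfl fun I hI => ?_
  rw [Finset.sum_div, Finset.mul_sum]
  refine Finset.sum_congr rfl fun K hK => ?_
  rw [Finset.mul_sum, Finset.sum_div, Finset.mul_sum]
  refine Finset.sum_congr rfl fun J hJ => ?_
  have hK' := Finset.mem_powerset.mp hK
  have hJ' := Finset.mem_powerset.mp hJ
  have hcard : d = K.card + (J.card + ((I \ K) \ J).card) := by
    rw [add_comm J.card, Finset.card_sdiff_add_card_eq_card hJ', add_comm,
      Finset.card_sdiff_add_card_eq_card hK', (Finset.mem_powersetCard.mp hI).2]
  -- The prefactor of degree `d` is distributed over the three parts of `I`: it restores the sign on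
  -- `K`, scales the derivatives of `Δ` on `J`, and cancels `-(n/c)` on the rest.
  have hpow : (-(c / n)) ^ d * (-1) ^ K.card * (-(n / c)) ^ ((I \ K) \ J).card =
      (c / n) ^ K.card * (-(c / n)) ^ J.card := by
    have h1 : (-(n / c) : ℂ) ^ ((I \ K) \ J).card * (-(c / n)) ^ ((I \ K) \ J).card = 1 := by
      rw [← mul_pow, hinv, one_pow]
    have h2 : (-(c / n)) ^ K.card * (-1) ^ K.card = (c / n) ^ K.card := by
      rw [← mul_pow]; simp
    rw [congrArg (fun m => (-(c / n)) ^ m) hcard, pow_add, pow_add, ← h2]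
    linear_combination ((-(c / n)) ^ K.card * (-1) ^ K.card * (-(c / n)) ^ J.card) * h1
  rw [← sdiff_sdiff_eq_sdiff_union, opProd_smul_pd, opProd_pd, dirDerivs_smul]
  simp only [div_eq_mul_inv, mul_inv] at hpow ⊢
  linear_combination (-(iteratedDeriv K.card (theta τ) u * (theta τ u)⁻¹ * (Delta S τ x)⁻¹ *
    dirDerivs e (List.finRange n) J (Delta S τ) x *
      dirDerivs e (List.finRange n) ((I \ K) \ J) f x)) * hpow

theorem diffOp_eq_sum_choose {τ : ℂ} (hτ : 0 < τ.im) {c : ℂ} (hc : c / n ≠ 0) {u : ℂ}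
    (hu : theta τ u ≠ 0) {e : Fin n → S} (he : IsDirections e) {f : S → ℂ} {x : S} (hf : HolAt f x)
    (hx : ∀ i j, i ≠ j → theta τ (x.1 i - x.1 j) ≠ 0) {d : ℕ} (hd : d ≤ n) :
    diffOp e τ c u d f x = (-(c / n)) ^ d * ∑ k ∈ Finset.range (d + 1),
      (-1) ^ k * ((n - d + k).choose k : ℂ) * (iteratedDeriv k (theta τ) u / theta τ u) *
        ∑ I ∈ Finset.univ.powersetCard (d - k), ∑ J ∈ I.powerset,
          (opProd (pd e) J (Delta S τ) x / Delta S τ x) *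
            opProd (fun i g => (-(n / c)) • pd e i g) (I \ J) f x := by
  rw [diffOp_eq_sum_sum hτ hc hu he hf hx hd]
  congr 1
  have h1 := sum_powersetCard_sum_sdiff hd
    (fun k => (-1) ^ k * (iteratedDeriv k (theta τ) u / theta τ u)) fun I => ∑ J ∈ I.powerset,
      (opProd (pd e) J (Delta S τ) x / Delta S τ x) *
        opProd (fun i g => (-(n / c)) • pd e i g) (I \ J) f x
  simp only [← sdiff_sdiff_eq_sdiff_union, mul_assoc, Finset.mul_sum] at h1 ⊢
  rw [h1]
  refine Finset.sum_congr rfl fun k _ => Finset.sum_congr rfl fun I _ =>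
    Finset.sum_congr rfl fun J _ => ?_
  ring

/-! ### Commutativity -/

theorem dirDerivs_sum (e : Fin n → S) (l : List (Fin n)) (J : Finset (Fin n)) {s : Finset ℕ}
    (a : ℕ → ℂ) (g : ℕ → S → ℂ) {x : S} (hg : ∀ k ∈ s, HolAt (g k) x) :
    dirDerivs e l J (fun y => ∑ k ∈ s, a k * g k y) =ᶠ[𝓝 x]
      fun y => ∑ k ∈ s, a k * dirDerivs e l J (g k) y := by
  induction l with
  | nil => exact EventuallyEq.rfl
  | cons i l ih =>
    by_cases hi : i ∈ J
    · have hd : ∀ᶠ y in 𝓝 x, ∀ k ∈ s, DifferentiableAt ℂ (dirDerivs e l J (g k)) y :=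
        (Filter.eventually_all_finset s).mpr fun k hk => (hg k hk).dirDerivs e l J
      simp only [dirDerivs_cons_of_mem hi]
      filter_upwards [ih.eventuallyEq_nhds, hd] with y hy hyd
      rw [hy.lineDeriv_eq, lineDeriv_sum fun k hk => (hyd k hk).const_mul (a k)]
      refine Finset.sum_congr rfl fun k _ => ?_
      unfold lineDeriv
      rw [deriv_const_mul_field]
    · simp only [dirDerivs_cons_of_notMem hi]
      exact ih

theorem cmOp_sum (e : Fin n → S) (τ b : ℂ) (m : ℕ) {s : Finset ℕ} (a : ℕ → ℂ)
    (g : ℕ → S → ℂ) {x : S} (hg : ∀ k ∈ s, HolAt (g k) x) :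
    cmOp e τ b m (fun y => ∑ k ∈ s, a k * g k y) x = ∑ k ∈ s, a k * cmOp e τ b m (g k) x := by
  unfold cmOp
  simp only [← mul_div_assoc]
  rw [← Finset.sum_div]
  congr 1
  simp only [Finset.mul_sum]
  rw [Finset.sum_comm]
  refine Finset.sum_congr rfl fun I _ => ?_
  rw [Finset.sum_comm]
  refine Finset.sum_congr rfl fun J _ => ?_
  rw [(dirDerivs_sum e _ (I \ J) a g hg).self_of_nhds, Finset.mul_sum]
  refine Finset.sum_congr rfl fun k _ => ?_
  ring

theorem eventually_theta_sub_ne_zero {τ : ℂ} (hτ : 0 < τ.im) {x : S}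
    (hx : ∀ i j, i ≠ j → theta τ (x.1 i - x.1 j) ≠ 0) :
    ∀ᶠ y : S in 𝓝 x, ∀ i j, i ≠ j → theta τ (y.1 i - y.1 j) ≠ 0 := by
  simp only [Filter.eventually_all]
  intro i j hij
  have hc : ∀ k, Continuous fun y : S => y.1 k := fun k =>
    (continuous_apply k).comp continuous_subtype_val
  exact ((differentiable_theta hτ).continuous.comp
    ((hc i).sub (hc j))).continuousAt.eventually_ne (hx i j hij)

theorem diffOp_diffOp {τ : ℂ} (hτ : 0 < τ.im) (c : ℂ) {u v : ℂ} (hu : theta τ u ≠ 0)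
    (hv : theta τ v ≠ 0) {e : Fin n → S} (he : IsDirections e) {f : S → ℂ} {x : S} (hf : HolAt f x)
    (hx : ∀ i j, i ≠ j → theta τ (x.1 i - x.1 j) ≠ 0) {d d' : ℕ} (hd : d ≤ n) (hd' : d' ≤ n) :
    diffOp e τ c u d (diffOp e τ c v d' f) x =
      ∑ k ∈ Finset.range (d + 1), ∑ k' ∈ Finset.range (d' + 1),
        (((n - d + k).choose k : ℂ) * ((c / n) ^ k * iteratedDeriv k (theta τ) u / theta τ u)) *
        (((n - d' + k').choose k' : ℂ) *
          ((c / n) ^ k' * iteratedDeriv k' (theta τ) v / theta τ v)) *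
        cmOp e τ (-(c / n)) (d - k) (cmOp e τ (-(c / n)) (d' - k') f) x := by
  -- The outer operator differentiates, so the expansion of the inner one is needed on a
  -- neighbourhood of `x`.
  have hev : diffOp e τ c v d' f =ᶠ[𝓝 x] fun y => ∑ k ∈ Finset.range (d' + 1),
      (((n - d' + k).choose k : ℂ) * ((c / n) ^ k * iteratedDeriv k (theta τ) v / theta τ v)) *
        cmOp e τ (-(c / n)) (d' - k) f y := by
    filter_upwards [eventually_theta_sub_ne_zero hτ hx, eventually_eventually_nhds.mpr hf]
      with y hy hfy
    exact diffOp_eq_sum_cmOp hτ c hv he hfy hy hd'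
  have hcm : ∀ k ∈ Finset.range (d' + 1), HolAt (cmOp e τ (-(c / n)) (d' - k) f) x := fun k _ =>
    hf.cmOp hτ e _ _ (Delta_ne_zero hx)
  have hhol : HolAt (diffOp e τ c v d' f) x :=
    HolAt.congr (HolAt.sum fun k hk => (HolAt.const _ x).mul (hcm k hk)) hev
  rw [diffOp_eq_sum_cmOp hτ c hu he hhol hx hd]
  refine Finset.sum_congr rfl fun k _ => ?_
  rw [cmOp_congr e τ _ _ hev, cmOp_sum e τ _ _ _ _ hcm, Finset.mul_sum]
  refine Finset.sum_congr rfl fun k' _ => ?_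
  ring

theorem diffOp_comm {τ : ℂ} (hτ : 0 < τ.im) (c : ℂ) {u v : ℂ} (hu : theta τ u ≠ 0)
    (hv : theta τ v ≠ 0) {e : Fin n → S} (he : IsDirections e) {f : S → ℂ} {x : S} (hf : HolAt f x)
    (hx : ∀ i j, i ≠ j → theta τ (x.1 i - x.1 j) ≠ 0) {d d' : ℕ} (hd : d ≤ n) (hd' : d' ≤ n) :
    diffOp e τ c u d (diffOp e τ c v d' f) x = diffOp e τ c v d' (diffOp e τ c u d f) x := by
  rw [diffOp_diffOp hτ c hu hv he hf hx hd hd', diffOp_diffOp hτ c hv hu he hf hx hd' hd,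
    Finset.sum_comm]
  refine Finset.sum_congr rfl fun k' _ => Finset.sum_congr rfl fun k _ => ?_
  rw [he.cmOp_comm hτ _ (d - k) (d' - k') hf hx]
  ring

end Generating

end EllipticCM

end

open EllipticCM Filter Topology in
theorem proposition4 (n : ℕ) (hn : 2 ≤ n) (τ : ℂ) (hτ : 0 < τ.im) (c u : ℂ)
    (hu : u ∉ lattice τ) (r : Realization)
    (U : Set (r.space n)) (hU : IsOpen U) (f : r.space n → ℂ) (hf : DifferentiableOn ℂ f U)
    (x : r.space n) (hxU : x ∈ U)
    (hx : ∀ i j : Fin n, i ≠ j → x.1 i - x.1 j ∉ lattice τ) :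
    -- `L̃'_0` is the derivative of `L̃_ħ` at `ħ = 0`
    (∀ i j : Fin n,
      HasDerivAt
        (fun h : ℂ => normalOp (shift (r.dir n) h) (lax (r.space n) τ c u h i j) f x)
        (normalOp (pd (r.dir n)) (laxDeriv (r.space n) τ c u i j) f x) 0) ∧
    -- the differential limit, and the generating function of the `D_d`
    (∀ t : ℂ,
      Tendsto
        (fun h : ℂ => normalDet (shift (r.dir n) h)
          (h⁻¹ • (lax (r.space n) τ c u h - (1 + h * t) • 1)) f x)
        (𝓝[≠] 0)
        (𝓝 (normalDet (pd (r.dir n)) (laxDeriv (r.space n) τ c u - t • 1) f x)) ∧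
      normalDet (pd (r.dir n)) (laxDeriv (r.space n) τ c u - t • 1) f x =
        ∑ d ∈ Finset.range (n + 1), (-t) ^ (n - d) * diffOp (r.dir n) τ c u d f x) ∧
    -- commutativity
    (∀ v : ℂ, v ∉ lattice τ → ∀ d ≤ n, ∀ d' ≤ n,
      diffOp (r.dir n) τ c u d (diffOp (r.dir n) τ c v d' f) x =
        diffOp (r.dir n) τ c v d' (diffOp (r.dir n) τ c u d f) x) ∧
    -- the two explicit formulas
    (c ≠ 0 → ∀ d ≤ n,
      diffOp (r.dir n) τ c u d f x =
        (-(c / n)) ^ d *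
          ∑ I ∈ Finset.univ.powersetCard d,
            ∑ J' ∈ I.powerset, ∑ J'' ∈ (I \ J').powerset,
              (-1) ^ J'.card * (iteratedDeriv J'.card (theta τ) u / theta τ u) *
                (opProd (pd (r.dir n)) J'' (Delta (r.space n) τ) x /
                  Delta (r.space n) τ x) *
                opProd (fun i g => (-(n / c)) • pd (r.dir n) i g) (I \ (J' ∪ J'')) f x ∧
      diffOp (r.dir n) τ c u d f x =
        (-(c / n)) ^ d *
          ∑ k ∈ Finset.range (d + 1),
            (-1) ^ k * ((n - d + k).choose k : ℂ) *
              (iteratedDeriv k (theta τ) u / theta τ u) *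
              ∑ I ∈ Finset.univ.powersetCard (d - k), ∑ J ∈ I.powerset,
                (opProd (pd (r.dir n)) J (Delta (r.space n) τ) x /
                  Delta (r.space n) τ x) *
                opProd (fun i g => (-(n / c)) • pd (r.dir n) i g) (I \ J) f x) := by
  have hxθ : ∀ i j, i ≠ j → theta τ (x.1 i - x.1 j) ≠ 0 := fun i j hij =>
    theta_ne_zero hτ (hx i j hij)
  have huθ := theta_ne_zero hτ hu
  have hfx : HolAt f x := by
    filter_upwards [hU.mem_nhds hxU] with y hy using hf.differentiableAt (hU.mem_nhds hy)
  have he := Realization.isDirections_dir (n := n) r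
  refine ⟨fun i j => ?_, fun t => ⟨?_, ?_⟩, fun v hv d hd d' hd' => ?_, fun hc d hd => ?_⟩
  · exact hasDerivAt_normalOp_lax hτ c huθ _ hfx.self_of_nhds hxθ i j
  · exact tendsto_normalDet_lax hτ c huθ _ hfx hxθ t
  · exact normalDet_eq_sum_diffOp _ τ c u t f x
  · exact diffOp_comm hτ c huθ (theta_ne_zero hτ hv) he hfx hxθ hd hd'
  · have hcn : c / n ≠ 0 := div_ne_zero hc (Nat.cast_ne_zero.mpr (by omega))
    exact ⟨diffOp_eq_sum_sum hτ hcn huθ he hfx hxθ hd,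
      diffOp_eq_sum_choose hτ hcn huθ he hfx hxθ hd⟩
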